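/- Let $M=\mathbb{C}H^2$ be the complex hyperbolic plane, $2<p<4$, $q=r=2p$, and let $\eta\in\partial_\infty M$ be a point at infinity. Write $\overline M=M\cup\partial_\infty M$ for the visual compactification, and call an open set $W\subset M$ *admissible* if its closure in $\overline M$ does not contain $\eta$. For $s\ge 1$ let $\Omega^{k,s}_{loc}(M,\eta)$ be the space of differential $k$-forms on $M$ that are in $L^s(W)$, together with their distributional exterior derivative, for every admissible $W$; let $H^{k,s}_{loc}(M,\eta)$ be the cohomology of the complex $(\Omega^{*,s}_{loc}(M,\eta),d)$; and let $\mathcal R^{q}_{loc}(M,\eta)$ be the algebra of functions on $M$ that are bounded and have $L^q$ differential on every admissible $W$. The exterior product of forms induces a cup product $\smile\,: H^{1,q}_{loc}(M,\eta)\times H^{1,r}_{loc}(M,\eta)\to H^{2,p}_{loc}(M,\eta)$, since $\frac1p=\frac1q+\frac1r$. Then there exist a class $\kappa\in H^{1,r}_{loc}(M,\eta)$ and a function $u\in\mathcal R^{q}_{loc}(M,\eta)$ (with $u^2\in\mathcal R^{q}_{loc}(M,\eta)$) such that 1. $[du]\smile\kappa=0$ in $H^{2,p}_{loc}(M,\eta)$;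 2. $[d(u^2)]\smile\kappa\neq 0$ in $H^{2,p}_{loc}(M,\eta)$. Moreover $u$ and $\kappa$ can be chosen as follows. Identify $\partial_\infty M\setminus\{\eta\}$ with the $3$-dimensional Heisenberg group $N$, and let $(x,y)$ be the coordinates on $N/[N,N]=\mathbb{R}^2$. (In the unit ball model of $M$ in $\mathbb{C}^2$, where $\partial_\infty M$ is the unit sphere, $x+iy=\dfrac{\eta_1\zeta_2-\eta_2\zeta_1}{1-\langle\zeta,\eta\rangle}$ at the point $\zeta\ne\eta$ of the sphere.) Then $\kappa=[dv]$ for a function $v\in\mathcal R^{r}_{loc}(M,\eta)$, and $u$ and $v$ extend continuously to $\partial_\infty M\setminus\{\eta\}$ with boundary values $x$ and $y$ respectively. -/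

import Mathlib

open MeasureTheory Set Filter Topology
open scoped ENNReal

noncomputable section

namespace CH2

/-- `ℂ²` with its standard Hermitian structure.  The complex hyperbolic plane is realised as the
open unit ball of `ℂ²` with the Bergman metric; its visual compactification is the closed unit
ball, and its boundary at infinity is the unit sphere. -/
abbrev C2 : Type := EuclideanSpace ℂ (Fin 2)

/-- The underlying manifold of the complex hyperbolic plane. -/
def ball : Set C2 := Metric.ball (0 : C2) 1

/-- The Bergman metric at a point `z` of the ball (sectional curvature in `[-4, -1]`):
`g_z(v, v) = ((1 - |z|²) |v|² + |⟨v, z⟩|²) / (1 - |z|²)²`. -/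
def bergmanSq (z v : C2) : ℝ :=
  ((1 - ‖z‖ ^ 2) * ‖v‖ ^ 2 + ‖inner ℂ z v‖ ^ 2) / (1 - ‖z‖ ^ 2) ^ 2

/-- An explicit frame for the Bergman metric: for `z` in the ball, `bergmanFrame z` is a linear
isometry from `ℂ²` with the Euclidean metric onto the tangent space at `z` with the Bergman
metric (see `bergmanSq_bergmanFrame`). -/
def bergmanFrame (z : C2) : C2 →L[ℝ] C2 :=
  Real.sqrt (1 - ‖z‖ ^ 2) •
    (ContinuousLinearMap.id ℝ C2 -
      (((1 + Real.sqrt (1 - ‖z‖ ^ 2))⁻¹ : ℝ) : ℂ) •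
        (((innerSL ℂ z).smulRight z).restrictScalars ℝ))

theorem bergmanSq_bergmanFrame {z : C2} (hz : z ∈ ball) (v : C2) :
    bergmanSq z (bergmanFrame z v) = ‖v‖ ^ 2 := by
  have hz1 : ‖z‖ < 1 := by simpa [ball] using hz
  have hρ : 0 < 1 - ‖z‖ ^ 2 := by nlinarith [norm_nonneg z]
  set s : ℝ := Real.sqrt (1 - ‖z‖ ^ 2) with hs
  have hs0 : 0 < s := Real.sqrt_pos.2 hρ
  have hs2 : s ^ 2 = 1 - ‖z‖ ^ 2 := Real.sq_sqrt hρ.le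
  set t : ℝ := (1 + s)⁻¹ with ht
  have hts : t * (1 + s) = 1 := inv_mul_cancel₀ (by positivity)
  set c : ℂ := inner ℂ z v with hc
  have hA : bergmanFrame z v = (s : ℂ) • (v - ((t : ℂ) * c) • z) := by
    simp [bergmanFrame, ← hs, ← ht, ← hc, mul_smul]
  have hin : inner ℂ z (bergmanFrame z v) = ((s ^ 2 : ℝ) : ℂ) * c := by
    rw [hA, inner_smul_right, inner_sub_right, inner_smul_right, inner_self_eq_norm_sq_to_K, ← hc]
    have h1 : (‖z‖ : ℂ) ^ 2 = ((1 - s ^ 2 : ℝ) : ℂ) := by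
      rw [hs2]; push_cast; ring
    have h2 : 1 - t * (1 - s ^ 2) = s := by
      linear_combination (1 - s) * (-hts)
    have h2' : (1 : ℂ) - t * (1 - (s : ℂ) ^ 2) = s := by exact_mod_cast h2
    simp only [RCLike.ofReal_eq_complex_ofReal]
    rw [h1]
    push_cast
    linear_combination (s : ℂ) * c * h2'
  have hnorm : ‖v - ((t : ℂ) * c) • z‖ ^ 2 = ‖v‖ ^ 2 - ‖c‖ ^ 2 := by
    rw [@norm_sub_sq ℂ, inner_smul_right, norm_smul, norm_mul]
    have h3 : inner ℂ v z = (starRingEnd ℂ) c := by rw [hc, inner_conj_symm]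
    have h4 : RCLike.re ((t : ℂ) * c * (starRingEnd ℂ) c) = t * ‖c‖ ^ 2 := by
      rw [mul_assoc, Complex.mul_conj, Complex.normSq_eq_norm_sq]
      rw [← Complex.ofReal_mul]
      exact Complex.ofReal_re _
    have ht0 : 0 < t := by positivity
    rw [h3, h4, Complex.norm_real, Real.norm_of_nonneg ht0.le]
    have h5 : (t * ‖c‖ * ‖z‖) ^ 2 = t ^ 2 * ‖c‖ ^ 2 * (1 - s ^ 2) := by rw [hs2]; ring
    rw [h5]
    linear_combination (-‖c‖ ^ 2) * (t * (1 - s) * (-hts) + hts)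
  unfold bergmanSq
  rw [hin, hA, norm_smul, norm_mul, ← hs2, mul_pow, hnorm, Complex.norm_real, Complex.norm_real,
    Real.norm_of_nonneg hs0.le, Real.norm_of_nonneg (by positivity : 0 ≤ s ^ 2)]
  field_simp
  ring

/-- The Riemannian volume of the Bergman metric: the square root of the determinant of the metric
at `z` with respect to the Euclidean metric of `ℂ² = ℝ⁴` is `(1 - |z|²)⁻³`. -/
def bergmanVol : Measure C2 :=
  (volume.restrict ball).withDensity (fun z => ENNReal.ofReal (((1 - ‖z‖ ^ 2) ^ 3)⁻¹))

/-- Not necessarily continuous differential forms of degree `k` on the ball (the values outside of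
the ball are irrelevant). -/
abbrev Form (k : ℕ) : Type := C2 → C2 [⋀^Fin k]→L[ℝ] ℝ

/- The pointwise vector space structure on forms; these three instances only fix a form of it that
lets Lean find quotients by submodules. -/
instance instAddCommGroupForm (k : ℕ) : AddCommGroup (Form k) := Pi.addCommGroup
instance instAddCommMonoidForm (k : ℕ) : AddCommMonoid (Form k) :=
  (instAddCommGroupForm k).toAddCommMonoid
instance instModuleForm (k : ℕ) : Module ℝ (Form k) := Pi.module _ _ _

/-- A function, seen as a form of degree `0`. -/
def funForm (u : C2 → ℝ) : Form 0 :=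
  fun z => ContinuousAlternatingMap.constOfIsEmpty ℝ C2 (Fin 0) (u z)

/-- The form `ω` read in the orthonormal frames `bergmanFrame z`.  Its Euclidean norm at `z` is the
norm of `ω z` for the Bergman metric. -/
def inFrame {k : ℕ} (ω : Form k) : Form k :=
  fun z => (ω z).compContinuousLinearMap (bergmanFrame z)

/-- `ω` is an `L^p` form on `W` for the Bergman metric: the pointwise norm of `ω` for the
Bergman metric is in `L^p` for the Riemannian volume. -/
def MemLpForm {k : ℕ} (p : ℝ≥0∞) (ω : Form k) (W : Set C2) : Prop :=
  MemLp (inFrame ω) p (bergmanVol.restrict W)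

/-- `θ` is the exterior derivative of `ω` on the ball in the sense of distributions. -/
def HasWeakExtDeriv {k : ℕ} (ω : Form k) (θ : Form (k + 1)) : Prop :=
  ∀ φ : C2 → ℝ, ContDiff ℝ (⊤ : ℕ∞) φ → HasCompactSupport φ → tsupport φ ⊆ ball →
    ∀ v : Fin (k + 1) → C2,
      ∫ z in ball, φ z * θ z v =
        -∑ i : Fin (k + 1), (-1 : ℝ) ^ (i : ℕ) *
          ∫ z in ball, fderiv ℝ φ z (v i) * ω z (i.removeNth v)

/-- The open subsets of the complex hyperbolic plane whose closure in the visual compactification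
does not contain the point at infinity `η`. -/
def IsAway (η : C2) (W : Set C2) : Prop :=
  IsOpen W ∧ W ⊆ ball ∧ η ∉ closure W

theorem memLp_add {X F : Type*} [MeasurableSpace X] [NormedAddCommGroup F] {f g : X → F}
    {μ : Measure X} {p : ℝ≥0∞} (h : MemLp f p μ) (h' : MemLp g p μ) : MemLp (f + g) p μ :=
  h.add h'

theorem locallyIntegrableOn_add {X F : Type*} [MeasurableSpace X] [TopologicalSpace X]
    [NormedAddCommGroup F] {f g : X → F} {μ : Measure X} {s : Set X}
    (h : LocallyIntegrableOn f s μ) (h' : LocallyIntegrableOn g s μ) :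
    LocallyIntegrableOn (f + g) s μ :=
  h.add h'

theorem locallyIntegrableOn_smul {X F : Type*} [MeasurableSpace X] [TopologicalSpace X]
    [NormedAddCommGroup F] [NormedSpace ℝ F] {f : X → F} {μ : Measure X} {s : Set X} (c : ℝ)
    (h : LocallyIntegrableOn f s μ) : LocallyIntegrableOn (c • f) s μ :=
  h.smul c

theorem inFrame_add {k : ℕ} (ω ω' : Form k) : inFrame (ω + ω') = inFrame ω + inFrame ω' := by
  funext z
  ext v
  simp [inFrame]

theorem inFrame_smul {k : ℕ} (c : ℝ) (ω : Form k) : inFrame (c • ω) = c • inFrame ω := by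
  funext z
  ext v
  simp [inFrame]

theorem inFrame_zero {k : ℕ} : inFrame (0 : Form k) = fun _ => 0 := by
  funext z
  ext v
  simp [inFrame]

theorem MemLpForm.add {k : ℕ} {p : ℝ≥0∞} {ω ω' : Form k} {W : Set C2}
    (h : MemLpForm p ω W) (h' : MemLpForm p ω' W) : MemLpForm p (ω + ω') W := by
  unfold MemLpForm at *
  rw [inFrame_add]
  exact memLp_add h h'

theorem MemLpForm.smul {k : ℕ} {p : ℝ≥0∞} {ω : Form k} {W : Set C2} (c : ℝ)
    (h : MemLpForm p ω W) : MemLpForm p (c • ω) W := by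
  unfold MemLpForm at *
  rw [inFrame_smul]
  exact MemLp.const_smul (𝕜 := ℝ) h c

theorem MemLpForm.zero {k : ℕ} {p : ℝ≥0∞} {W : Set C2} : MemLpForm p (0 : Form k) W := by
  unfold MemLpForm
  rw [inFrame_zero]
  exact MemLp.zero' (ε := C2 [⋀^Fin k]→L[ℝ] ℝ)

/-- The integrals in the definition of the distributional derivative converge for locally
integrable forms. -/
theorem integrableOn_test {k : ℕ} {ω : Form k} (hω : LocallyIntegrableOn ω ball)
    {g : C2 → ℝ} (hg : Continuous g) (hgc : HasCompactSupport g) (hgs : tsupport g ⊆ ball)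
    (v : Fin k → C2) : IntegrableOn (fun z => g z * ω z v) ball := by
  have h1 : IntegrableOn ω (tsupport g) := hω.integrableOn_compact_subset hgs hgc
  have h2 : IntegrableOn (fun z => ω z v) (tsupport g) :=
    (ContinuousAlternatingMap.apply ℝ C2 ℝ v).integrable_comp h1
  have h3 : IntegrableOn (fun z => g z * ω z v) (tsupport g) :=
    h2.continuousOn_mul hg.continuousOn hgc
  refine IntegrableOn.mono_set ?_ (subset_univ ball)
  rw [integrableOn_univ]
  refine (integrableOn_iff_integrable_of_support_subset ?_).1 h3
  intro z hz
  refine subset_tsupport g ?_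
  intro h0
  exact hz (by simp [h0])

theorem integrableOn_test_fderiv {k : ℕ} {ω : Form k} (hω : LocallyIntegrableOn ω ball)
    {g : C2 → ℝ} (hg : ContDiff ℝ (⊤ : ℕ∞) g) (hgc : HasCompactSupport g) (hgs : tsupport g ⊆ ball)
    (w : C2) (v : Fin k → C2) : IntegrableOn (fun z => fderiv ℝ g z w * ω z v) ball :=
  integrableOn_test hω (hg.continuous_fderiv_apply (by simp) |>.comp (continuous_id.prodMk continuous_const))
    (hgc.fderiv_apply ℝ w) ((tsupport_fderiv_apply_subset ℝ w).trans hgs) v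

theorem HasWeakExtDeriv.add {k : ℕ} {ω ω' : Form k} {θ θ' : Form (k + 1)}
    (hω : LocallyIntegrableOn ω ball) (hω' : LocallyIntegrableOn ω' ball)
    (hθ : LocallyIntegrableOn θ ball) (hθ' : LocallyIntegrableOn θ' ball)
    (h : HasWeakExtDeriv ω θ) (h' : HasWeakExtDeriv ω' θ') :
    HasWeakExtDeriv (ω + ω') (θ + θ') := by
  intro φ hφ hc hs v
  have e1 := h φ hφ hc hs v
  have e2 := h' φ hφ hc hs v
  simp only [Pi.add_apply, ContinuousAlternatingMap.add_apply, mul_add]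
  rw [integral_add (integrableOn_test hθ hφ.continuous hc hs v)
    (integrableOn_test hθ' hφ.continuous hc hs v), e1, e2, ← neg_add, ← Finset.sum_add_distrib]
  congr 1
  refine Finset.sum_congr rfl fun i _ => ?_
  rw [integral_add (integrableOn_test_fderiv hω hφ hc hs _ _)
    (integrableOn_test_fderiv hω' hφ hc hs _ _), mul_add]

theorem HasWeakExtDeriv.smul {k : ℕ} {ω : Form k} {θ : Form (k + 1)} (c : ℝ)
    (h : HasWeakExtDeriv ω θ) : HasWeakExtDeriv (c • ω) (c • θ) := by
  intro φ hφ hc hs v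
  have e1 := h φ hφ hc hs v
  simp only [Pi.smul_apply, ContinuousAlternatingMap.smul_apply, smul_eq_mul, mul_left_comm _ c,
    integral_const_mul]
  rw [e1, ← Finset.mul_sum, mul_neg]

theorem HasWeakExtDeriv.zero {k : ℕ} : HasWeakExtDeriv (0 : Form k) 0 := by
  intro φ hφ hc hs v
  simp

theorem locallyIntegrableOn_zero_form {k : ℕ} : LocallyIntegrableOn (0 : Form k) ball :=
  fun _ _ => ⟨univ, univ_mem, (integrable_zero C2 (C2 [⋀^Fin k]→L[ℝ] ℝ) _ : _)⟩

/-- The space of forms that are `L^p` on every open set whose closure does not contain `η`.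
(Local integrability, which makes sense of distributional derivatives, is automatic for
`1 ≤ p`.) -/
def LpLoc (k : ℕ) (p : ℝ≥0∞) (η : C2) : Submodule ℝ (Form k) where
  carrier := {ω | LocallyIntegrableOn ω ball ∧ ∀ W, IsAway η W → MemLpForm p ω W}
  add_mem' := by
    rintro ω ω' ⟨h1, h2⟩ ⟨h1', h2'⟩
    exact ⟨locallyIntegrableOn_add h1 h1', fun W hW => (h2 W hW).add (h2' W hW)⟩
  zero_mem' := by
    exact ⟨locallyIntegrableOn_zero_form, fun W hW => MemLpForm.zero⟩
  smul_mem' := by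
    rintro c ω ⟨h1, h2⟩
    exact ⟨locallyIntegrableOn_smul c h1, fun W hW => (h2 W hW).smul c⟩

/-- The closed forms in `Ω^{k,p}_loc(M, η)`. -/
def closedForms (k : ℕ) (p : ℝ≥0∞) (η : C2) : Submodule ℝ (Form k) where
  carrier := {ω | ω ∈ LpLoc k p η ∧ HasWeakExtDeriv ω 0}
  add_mem' := by
    rintro ω ω' ⟨h1, h2⟩ ⟨h1', h2'⟩
    refine ⟨add_mem h1 h1', ?_⟩
    have := h2.add h1.1 h1'.1 locallyIntegrableOn_zero_form locallyIntegrableOn_zero_form h2'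
    rwa [add_zero] at this
  zero_mem' := by
    exact ⟨zero_mem _, HasWeakExtDeriv.zero⟩
  smul_mem' := by
    rintro c ω ⟨h1, h2⟩
    refine ⟨Submodule.smul_mem _ c h1, ?_⟩
    have := h2.smul c
    rwa [smul_zero] at this

/-- The exact forms in `Ω^{k,p}_loc(M, η)`: those which are almost everywhere `0` if `k = 0`, and
the differentials of the elements of `Ω^{k-1,p}_loc(M, η)` otherwise. -/
def exactForms : (k : ℕ) → (p : ℝ≥0∞) → (η : C2) → Submodule ℝ (Form k)
  | 0, p, η =>
    { carrier := {ω | ω ∈ LpLoc 0 p η ∧ ∀ᵐ z ∂(volume.restrict ball), ω z = 0}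
      add_mem' := by
        rintro ω ω' ⟨h1, h2⟩ ⟨h1', h2'⟩
        refine ⟨add_mem h1 h1', ?_⟩
        filter_upwards [h2, h2'] with z hz hz'
        simp [hz, hz']
      zero_mem' := by
        exact ⟨zero_mem _, by simp⟩
      smul_mem' := by
        rintro c ω ⟨h1, h2⟩
        refine ⟨Submodule.smul_mem _ c h1, ?_⟩
        filter_upwards [h2] with z hz
        simp [hz] }
  | k + 1, p, η =>
    { carrier := {ω | ω ∈ LpLoc (k + 1) p η ∧ ∃ ψ ∈ LpLoc k p η, HasWeakExtDeriv ψ ω}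
      add_mem' := by
        rintro ω ω' ⟨h1, ψ, h2, h3⟩ ⟨h1', ψ', h2', h3'⟩
        exact ⟨add_mem h1 h1', ψ + ψ', add_mem h2 h2', h3.add h2.1 h2'.1 h1.1 h1'.1 h3'⟩
      zero_mem' := by
        exact ⟨zero_mem _, 0, zero_mem _, HasWeakExtDeriv.zero⟩
      smul_mem' := by
        rintro c ω ⟨h1, ψ, h2, h3⟩
        exact ⟨Submodule.smul_mem _ c h1, c • ψ, Submodule.smul_mem _ c h2, h3.smul c⟩ }

/-- The localised `L^p` cohomology `H^{k,p}_loc(M, η)`: closed forms modulo exact forms. -/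
abbrev HLoc (k : ℕ) (p : ℝ≥0∞) (η : C2) : Type :=
  closedForms k p η ⧸ (exactForms k p η).submoduleOf (closedForms k p η)

/-- The class of a closed form. -/
def cls {k : ℕ} {p : ℝ≥0∞} {η : C2} (ω : closedForms k p η) : HLoc k p η :=
  Submodule.Quotient.mk ω

/-- The exterior product of two `1`-forms. -/
def wedge (α β : Form 1) : Form 2 := fun z =>
  ContinuousAlternatingMap.alternatizeUncurryFin
    (((ContinuousAlternatingMap.ofSubsingleton ℝ C2 ℝ (0 : Fin 1)).symm (α z)).smulRight (β z))

theorem wedge_apply (α β : Form 1) (z v w : C2) :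
    wedge α β z ![v, w] = α z ![v] * β z ![w] - α z ![w] * β z ![v] := by
  have e1 : (fun _ : Fin 1 => v) = ![v] := by ext i; fin_cases i; rfl
  have e2 : (fun _ : Fin 1 => w) = ![w] := by ext i; fin_cases i; rfl
  have e3 : (1 : Fin 2).removeNth ![v, w] = ![v] := by
    ext i; fin_cases i; simp [Fin.removeNth]
  simp [wedge, ContinuousAlternatingMap.alternatizeUncurryFin_apply, Fin.sum_univ_two, e1, e2, e3,
    sub_eq_add_neg]

/-- `c` is the cup product of the classes `a` and `b`: for all closed forms `α` and `β`
representing `a` and `b`, the form `α ∧ β` is a closed form in `Ω^{2,p}_loc(M, η)` and its class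
is `c`. -/
def IsCup {p q r : ℝ≥0∞} {η : C2} (a : HLoc 1 q η) (b : HLoc 1 r η) (c : HLoc 2 p η) : Prop :=
  ∀ (α : closedForms 1 q η) (β : closedForms 1 r η), cls α = a → cls β = b →
    ∃ h : wedge α β ∈ closedForms 2 p η, cls ⟨wedge α β, h⟩ = c

/-- The space `R^q_loc(M, η)` of functions that are bounded and have an `L^q` differential on every
open set whose closure does not contain `η`. -/
def Royden (q : ℝ≥0∞) (η : C2) : Set (C2 → ℝ) :=
  {u | LocallyIntegrableOn u ball ∧
    (∀ W, IsAway η W → ∃ C : ℝ, ∀ z ∈ W, |u z| ≤ C) ∧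
    ∃ α ∈ LpLoc 1 q η, HasWeakExtDeriv (funForm u) α}

theorem two_le_smooth : (2 : WithTop ℕ∞) ≤ ((⊤ : ℕ∞) : WithTop ℕ∞) :=
  WithTop.coe_le_coe.2 (le_top : (2 : ℕ∞) ≤ ⊤)

/-- The differential of a distribution is closed. -/
theorem HasWeakExtDeriv.closed {u : C2 → ℝ} (hu : LocallyIntegrableOn u ball) {α : Form 1}
    (h : HasWeakExtDeriv (funForm u) α) : HasWeakExtDeriv α 0 := by
  have hu' : LocallyIntegrableOn (funForm u) ball := by
    intro z hz
    obtain ⟨t, ht, hi⟩ := hu z hz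
    exact ⟨t, ht, (ContinuousAlternatingMap.constOfIsEmptyLIE ℝ C2 ℝ (Fin 0)).toContinuousLinearEquiv.toContinuousLinearMap.integrable_comp hi⟩
  intro φ hφ hc hs v
  have key : ∀ a b : C2, ∫ z in ball, fderiv ℝ φ z a * α z ![b] =
      -∫ z in ball, fderiv ℝ (fun y => fderiv ℝ φ y a) z b * u z := by
    intro a b
    have := h (fun z => fderiv ℝ φ z a)
      ((hφ.fderiv_right (m := (⊤ : ℕ∞)) (by simp)).clm_apply contDiff_const) (hc.fderiv_apply ℝ a)
      ((tsupport_fderiv_apply_subset ℝ a).trans hs) ![b]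
    simpa [funForm] using this
  have hsymm : ∀ z a b, fderiv ℝ (fun y => fderiv ℝ φ y a) z b =
      fderiv ℝ (fun y => fderiv ℝ φ y b) z a := by
    intro z a b
    have hd : DifferentiableAt ℝ (fderiv ℝ φ) z :=
      ((hφ.fderiv_right (m := (⊤ : ℕ∞)) (by simp)).differentiable (by simp)) z
    have := (hφ.contDiffAt (x := z)).isSymmSndFDerivAt (by simpa using two_le_smooth)
    rw [fderiv_clm_apply hd (differentiableAt_const a), fderiv_clm_apply hd (differentiableAt_const b)]
    simpa using this b a
  have r0 : (0 : Fin 2).removeNth v = ![v 1] := by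
    ext i; fin_cases i; simp [Fin.removeNth]
  have r1 : (1 : Fin 2).removeNth v = ![v 0] := by
    ext i; fin_cases i; simp [Fin.removeNth]
  rw [Fin.sum_univ_two, r0, r1, key, key]
  simp [hsymm _ (v 0) (v 1)]

/-- The distributional differential `du` of `u ∈ R^q_loc(M, η)`, as a closed form. -/
def dForm {q : ℝ≥0∞} {η : C2} (u : C2 → ℝ) (hu : u ∈ Royden q η) : closedForms 1 q η :=
  ⟨hu.2.2.choose, hu.2.2.choose_spec.1, hu.2.2.choose_spec.2.closed hu.1⟩

/-- Heisenberg coordinates on the sphere minus `η`.  The sphere minus `η` is identified with the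
Heisenberg group `N` through the Cayley transform that sends `η` to infinity, and this is the
coordinate `x + i y` with values in `N / [N, N] = ℂ = ℝ²`:
`ζ ↦ (η₁ ζ₂ - η₂ ζ₁) / (1 - ⟨ζ, η⟩)`. -/
def heisenberg (η ζ : C2) : ℂ :=
  (η 0 * ζ 1 - η 1 * ζ 0) / (1 - inner ℂ η ζ)

end CH2

end

/-! Write ρ = 1 - |z|². In a Bergman frame at `z`, vectors Hermitian-orthogonal to `z` (the
horizontal ones) shrink by ρ^(1/2), the complex line of `z` shrinks by ρ, and the volume density is
ρ⁻³. So a form of Bergman norm O(ρ^s) away from `η` is in L^p there once s p > 2. The differential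
of a function smooth up to the sphere minus `η` has s = 1/2, hence is L^q for q > 4, and q = 2p
qualifies.

The functions u and v are the real and imaginary parts of the Heisenberg coordinate, extended to the
ball by the same holomorphic formula. With t the imaginary part of the Siegel coordinate, θ = dt/2 -
(u dv - v du) satisfies dθ = -2 du ∧ dv. On the sphere θ vanishes on horizontal vectors, and inside
its Bergman norm is O(ρ), so θ is L^p for every p > 2 (`norm_inFrame_contact_le`,
`smul_contact_mem_LpLoc`). Thus du ∧ dv is exact in L^p and [du] ⌣ [dv] = 0. The same holds for uθ,
and d(uθ) = du ∧ θ - d(u²) ∧ dv (`hasWeakExtDeriv_smul_contact`), so d(u²) ∧ dv is cohomologous to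
du ∧ θ.

It remains to see that du ∧ θ = dψ is impossible with ψ in L^p, p < 4
(`not_hasWeakExtDeriv_wedge_contact`). The fields T = iz, J and K = iJ are tangent to the spheres,
divergence free, and satisfy [J, K] = -2T. Pair the equation with a cutoff of ρ times a bivector
field f₁ T∧J + f₂ T∧K + f₃ J∧K and integrate by parts. Because [J, K] is a multiple of T, f₃ can be
chosen to cancel the T component of the divergence (`HasWeakExtDeriv.integral_quaternion`), so only
the horizontal values of ψ remain. They are at most ρ · (ρ^(-3/2)|ψ|), and by Hölder ρ^(-3/2)|ψ| is
integrable near -η for Lebesgue measure exactly because p < 4 enters. On a shell ρ ~ ε their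
contribution is therefore o(ε). Taking (f₁, f₂) to be the horizontal gradient of u times a bump at
-η makes the contribution of du ∧ θ at least a constant times the shell volume, that is a multiple
of ε, up to an error also of size o(ε): contradiction (`false_of_integral_radial_eq_zero`).

Forms here are only measurable and derivatives are distributional. Independence of the cup product
from representatives therefore requires a Leibniz rule for weak derivatives, proved by mollification
(`HasWeakExtDeriv.mul_closed`, `isCup_of_potential`). -/

noncomputable section

namespace CH2

/-! ### Weak convergence of mollifications in L². -/

section Mollification

variable {E : Type*} [NormedAddCommGroup E] [NormedSpace ℝ E] [FiniteDimensional ℝ E]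
  [MeasurableSpace E] [BorelSpace E] {μ : Measure E} [μ.IsAddHaarMeasure]

/-- The correlation of two `L²` functions is continuous. -/
theorem continuous_integral_translate_mul {G H : E → ℝ} (hG : MemLp G 2 μ) (hH : MemLp H 2 μ) :
    Continuous fun y => ∫ z, G (z + y) * H z ∂μ := by
  have hmp : ∀ y : E, MeasurePreserving (fun z => z + y) μ μ := fun y =>
    measurePreserving_add_right μ y
  have hadd : Continuous fun q : E × E => q.2 + q.1 := by fun_prop
  let g : E → C(E, E) := fun y => ⟨fun z => z + y, by fun_prop⟩
  have hg : Continuous g := (ContinuousMap.curry ⟨fun q : E × E => q.2 + q.1, hadd⟩).continuous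
  have hgm : ∀ y, MeasurePreserving (g y) μ μ := hmp
  have hc : Continuous fun y => Lp.compMeasurePreserving (g y) (hgm y) (hG.toLp G) :=
    Continuous.compMeasurePreservingLp continuous_const hg hgm (by simp)
  have hi : Continuous fun y =>
      (inner ℝ (hH.toLp H) (Lp.compMeasurePreserving (g y) (hgm y) (hG.toLp G)) : ℝ) :=
    continuous_const.inner hc
  refine hi.congr fun y => ?_
  rw [L2.inner_def]
  refine integral_congr_ae ?_
  have h1 := Lp.coeFn_compMeasurePreserving (hG.toLp G) (hgm y)
  have h2 := (hgm y).quasiMeasurePreserving.ae_eq_comp hG.coeFn_toLp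
  filter_upwards [h1, h2, hH.coeFn_toLp] with z h1 h2 h3
  rw [h1, h2, h3]
  simp [g]

/-- From 2|GH| ≤ G² + H², the integrand is dominated by two integrable functions on the product.
This is the hypothesis for Fubini in the next lemma. -/
theorem integrable_mollifier_mul {G H η : E → ℝ} (hG : MemLp G 2 μ) (hH : MemLp H 2 μ)
    (hη : Integrable η μ) :
    Integrable (fun q : E × E => η q.2 * G (q.1 - q.2) * H q.1) (μ.prod μ) := by
  have h1 : Integrable (fun q : E × E => ‖η q.2‖ * (G (q.1 - q.2) ^ 2)) (μ.prod μ) :=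
    hη.norm.convolution_integrand (ContinuousLinearMap.mul ℝ ℝ) hG.integrable_sq
  have h2 : Integrable (fun q : E × E => H q.1 ^ 2 * ‖η q.2‖) (μ.prod μ) :=
    hH.integrable_sq.mul_prod hη.norm
  have hm1 : AEStronglyMeasurable (fun q : E × E => η q.2 * G (q.1 - q.2)) (μ.prod μ) :=
    hη.1.convolution_integrand (ContinuousLinearMap.mul ℝ ℝ) hG.1
  refine (h1.add h2).mono' (hm1.mul hH.1.comp_fst) (Eventually.of_forall fun q => ?_)
  simp only [Pi.add_apply, norm_mul]
  have := two_mul_le_add_sq ‖G (q.1 - q.2)‖ ‖H q.1‖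
  simp only [Real.norm_eq_abs, sq_abs] at this ⊢
  have h0 := abs_nonneg (η q.2)
  have h3 : 0 ≤ |G (q.1 - q.2)| * |H q.1| := by positivity
  nlinarith

/-- Mollification is weakly continuous at the identity in `L²`. -/
theorem tendsto_integral_convolution_mul {ι : Type*} {l : Filter ι}
    {φ : ι → ContDiffBump (0 : E)} (hφ : Tendsto (fun i => (φ i).rOut) l (𝓝 0))
    {G H : E → ℝ} (hG : MemLp G 2 μ) (hH : MemLp H 2 μ) :
    Tendsto (fun i => ∫ z, convolution ((φ i).normed μ) G (ContinuousLinearMap.lsmul ℝ ℝ) μ z * H z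
      ∂μ) l (𝓝 (∫ z, G z * H z ∂μ)) := by
  -- After Fubini the pairing is the mollification, evaluated at 0, of the continuous correlation
  -- function of `G` and `H`.
  have key := ContDiffBump.convolution_tendsto_right_of_continuous (μ := μ) hφ
    (continuous_integral_translate_mul hG hH) 0
  simp only [add_zero] at key
  refine key.congr fun i => ?_
  have hη : Integrable ((φ i).normed μ) μ := (φ i).integrable_normed
  have hF := integral_integral_swap (f := fun z t => (φ i).normed μ t * G (z - t) * H z)
    (integrable_mollifier_mul hG hH hη)
  simp only [convolution, ContinuousLinearMap.lsmul_apply, smul_eq_mul]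
  rw [← integral_congr_ae (Eventually.of_forall fun z =>
    integral_mul_const (H z) (fun t => (φ i).normed μ t * G (z - t))), hF]
  refine integral_congr_ae (Eventually.of_forall fun t => ?_)
  simp only [mul_assoc, integral_const_mul, zero_add, sub_eq_add_neg]

end Mollification

/-! ### Weak exterior derivatives: smooth approximation, Leibniz rule, d² = 0. -/

/-- Functions that are square integrable on the compact subsets of the ball. -/
def LocL2 {F : Type*} [NormedAddCommGroup F] (f : C2 → F) : Prop :=
  ∀ K ⊆ ball, IsCompact K → MemLp f 2 (volume.restrict K)

theorem LocL2.apply {k : ℕ} {ω : Form k} (h : LocL2 ω) (v : Fin k → C2) :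
    LocL2 fun z => ω z v := fun K hK hc =>
  (ContinuousAlternatingMap.apply ℝ C2 ℝ v).comp_memLp' (h K hK hc)

theorem one_form_apply (ω : C2 [⋀^Fin 1]→L[ℝ] ℝ) (v : Fin 1 → C2) : ω v = ω ![v 0] := by
  congr 1; ext i; fin_cases i; rfl

theorem removeNth_zero_pair (v : Fin 2 → C2) : (0 : Fin 2).removeNth v = ![v 1] := by
  ext i; fin_cases i; simp [Fin.removeNth]

theorem removeNth_one_pair (v : Fin 2 → C2) : (1 : Fin 2).removeNth v = ![v 0] := by
  ext i; fin_cases i; simp [Fin.removeNth]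

theorem eq_pair (v : Fin 2 → C2) : v = ![v 0, v 1] := by
  ext i; fin_cases i <;> rfl

/-- The weak derivative of a function, in directional form. -/
theorem hasWeakExtDeriv_funForm_iff {f : C2 → ℝ} {α : Form 1} :
    HasWeakExtDeriv (funForm f) α ↔
      ∀ φ : C2 → ℝ, ContDiff ℝ (⊤ : ℕ∞) φ → HasCompactSupport φ → tsupport φ ⊆ ball → ∀ a : C2,
        ∫ z in ball, φ z * α z ![a] = -∫ z in ball, fderiv ℝ φ z a * f z := by
  constructor
  · intro h φ h1 h2 h3 a
    simpa [funForm] using h φ h1 h2 h3 ![a]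
  · intro h φ h1 h2 h3 v
    have := h φ h1 h2 h3 (v 0)
    simpa [funForm, one_form_apply _ v] using this

/-- The weak derivative of a `1`-form, in directional form. -/
theorem hasWeakExtDeriv_one_iff {ψ : Form 1} {ω : Form 2} :
    HasWeakExtDeriv ψ ω ↔
      ∀ φ : C2 → ℝ, ContDiff ℝ (⊤ : ℕ∞) φ → HasCompactSupport φ → tsupport φ ⊆ ball → ∀ a b : C2,
        ∫ z in ball, φ z * ω z ![a, b] =
          -((∫ z in ball, fderiv ℝ φ z a * ψ z ![b]) - ∫ z in ball, fderiv ℝ φ z b * ψ z ![a]) := by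
  constructor
  · intro h φ h1 h2 h3 a b
    have := h φ h1 h2 h3 ![a, b]
    rw [Fin.sum_univ_two, removeNth_zero_pair, removeNth_one_pair] at this
    rw [this]
    simp
    ring
  · intro h φ h1 h2 h3 v
    have := h φ h1 h2 h3 (v 0) (v 1)
    rw [← eq_pair v] at this
    rw [this, Fin.sum_univ_two, removeNth_zero_pair, removeNth_one_pair]
    simp
    ring

theorem exists_radius {K : Set C2} (hK : K ⊆ ball) (hc : IsCompact K) :
    ∃ s, 0 < s ∧ s < 1 ∧ K ⊆ Metric.closedBall 0 s := by
  rcases K.eq_empty_or_nonempty with rfl | hne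
  · exact ⟨1 / 2, by norm_num, by norm_num, by simp⟩
  obtain ⟨x, hx, hm⟩ := hc.exists_isMaxOn hne continuous_norm.continuousOn
  have hx1 : ‖x‖ < 1 := by simpa [ball] using hK hx
  refine ⟨(‖x‖ + 1) / 2, by positivity, by linarith, fun z hz => ?_⟩
  have : ‖z‖ ≤ ‖x‖ := hm hz
  simp only [Metric.mem_closedBall, dist_zero_right]
  linarith

theorem closedBall_subset_ball {s : ℝ} (hs : s < 1) : Metric.closedBall (0 : C2) s ⊆ ball :=
  Metric.closedBall_subset_ball hs

set_option maxHeartbeats 1000000 in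
/-- Simultaneous smooth approximation of a function and of its weak derivative. -/
theorem exists_smooth_approx {f : C2 → ℝ} {α : Form 1} (hf : LocL2 f) (hα : LocL2 α)
    (h : HasWeakExtDeriv (funForm f) α) {K : Set C2} (hK : K ⊆ ball) (hc : IsCompact K) :
    ∃ F : ℕ → C2 → ℝ, (∀ n, ContDiff ℝ (⊤ : ℕ∞) (F n)) ∧
      (∀ H : C2 → ℝ, MemLp H 2 volume → Function.support H ⊆ K →
        Tendsto (fun n => ∫ z, F n z * H z) atTop (𝓝 (∫ z, f z * H z))) ∧
      ∀ (a : C2) (H : C2 → ℝ), MemLp H 2 volume → Function.support H ⊆ K →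
        Tendsto (fun n => ∫ z, fderiv ℝ (F n) z a * H z) atTop (𝓝 (∫ z, α z ![a] * H z)) := by
  obtain ⟨s, hs0, hs1, hKs⟩ := exists_radius hK hc
  set B : Set C2 := Metric.closedBall 0 ((s + 1) / 2) with hB
  have hBb : B ⊆ ball := closedBall_subset_ball (by linarith)
  have hBc : IsCompact B := isCompact_closedBall _ _
  have hKB : K ⊆ B := hKs.trans (Metric.closedBall_subset_closedBall (by linarith))
  have hloc : ∀ g : C2 → ℝ, LocL2 g → MemLp (B.indicator g) 2 volume := fun g hg =>
    (memLp_indicator_iff_restrict hBc.measurableSet).2 (hg B hBb hBc)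
  -- With mollifiers of radius at most (1 - s)/2, the smoothed function at a point of `K` only sees
  -- `B`, where truncation by the indicator changes nothing.
  let δ : ℕ → ℝ := fun n => (1 - s) / 2 / (n + 1)
  have hδ : ∀ n, 0 < δ n := fun n => by
    have : 0 < 1 - s := by linarith
    positivity
  have hδ1 : ∀ n, δ n ≤ (1 - s) / 2 := fun n =>
    div_le_self (by linarith) (by linarith [(Nat.cast_nonneg n : (0 : ℝ) ≤ n)])
  let χ : ℕ → ContDiffBump (0 : C2) := fun n => ⟨δ n / 2, δ n, by linarith [hδ n], by linarith [hδ n]⟩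
  have hχ : Tendsto (fun n => (χ n).rOut) atTop (𝓝 0) := by
    have := (tendsto_one_div_add_atTop_nhds_zero_nat (𝕜 := ℝ)).const_mul ((1 - s) / 2)
    rw [mul_zero] at this
    refine this.congr fun n => ?_
    simp only [χ, δ]
    ring
  have hcd : ∀ n, ContDiff ℝ (⊤ : ℕ∞) ((χ n).normed volume) := fun n => (χ n).contDiff_normed
  have hcs : ∀ n, HasCompactSupport ((χ n).normed volume) := fun n =>
    (χ n).hasCompactSupport_normed
  have hli : ∀ g : C2 → ℝ, LocL2 g → LocallyIntegrable (B.indicator g) volume := fun g hg =>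
    (hloc g hg).locallyIntegrable (by norm_num)
  have hsupp : ∀ n z t, z ∈ K → t ∉ B → (χ n).normed volume (z - t) = 0 := by
    intro n z t hz ht
    by_contra h0
    have h1 : z - t ∈ Metric.ball (0 : C2) (δ n) := by
      rw [← (χ n).support_normed_eq (μ := volume)]
      exact h0
    have h2 : ‖z‖ ≤ s := by simpa using hKs hz
    have h3 : ‖z - t‖ < δ n := by simpa using h1
    have h4 : ‖t‖ ≤ ‖z‖ + ‖z - t‖ := by
      simpa [sub_sub_cancel] using norm_sub_le z (z - t)
    apply ht
    simp only [hB, Metric.mem_closedBall, dist_zero_right]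
    linarith [hδ1 n]
  have hconv : ∀ (g : C2 → ℝ) n z,
      convolution (B.indicator g) ((χ n).normed volume) (ContinuousLinearMap.lsmul ℝ ℝ) volume z =
      convolution ((χ n).normed volume) (B.indicator g) (ContinuousLinearMap.lsmul ℝ ℝ) volume z := by
    intro g n z
    rw [convolution_eq_swap]
    exact integral_congr_ae (Eventually.of_forall fun t => mul_comm _ _)
  refine ⟨fun n => convolution (B.indicator f) ((χ n).normed volume)
    (ContinuousLinearMap.lsmul ℝ ℝ) volume, fun n => ?_, fun H hH hHK => ?_, fun a H hH hHK => ?_⟩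
  · exact (hcs n).contDiff_convolution_right _ (hli f hf) (hcd n)
  · have := tendsto_integral_convolution_mul hχ (hloc f hf) hH
    have e : ∫ z, B.indicator f z * H z = ∫ z, f z * H z := by
      refine integral_congr_ae (Eventually.of_forall fun z => ?_)
      by_cases hz : z ∈ K
      · simp [indicator_of_mem (hKB hz)]
      · have : H z = 0 := by by_contra h0; exact hz (hHK h0)
        simp [this]
    rw [← e]
    refine this.congr fun n => ?_
    refine integral_congr_ae (Eventually.of_forall fun z => ?_)
    simp only [hconv]
  · have hαa : LocL2 fun z => α z ![a] := hα.apply ![a]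
    have := tendsto_integral_convolution_mul hχ (hloc _ hαa) hH
    have e : ∫ z, B.indicator (fun z => α z ![a]) z * H z = ∫ z, α z ![a] * H z := by
      refine integral_congr_ae (Eventually.of_forall fun z => ?_)
      by_cases hz : z ∈ K
      · simp [indicator_of_mem (hKB hz)]
      · have : H z = 0 := by by_contra h0; exact hz (hHK h0)
        simp [this]
    rw [← e]
    refine this.congr fun n => ?_
    refine integral_congr_ae (Eventually.of_forall fun z => ?_)
    by_cases hz : z ∈ K
    swap
    · have : H z = 0 := by by_contra h0; exact hz (hHK h0)
      simp [this]
    simp only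
    congr 1
    have hd := (hcs n).hasFDerivAt_convolution_right (ContinuousLinearMap.lsmul ℝ ℝ)
      (hli f hf) ((hcd n).of_le (by simp)) z
    rw [hd.fderiv, convolution_precompR_apply _ (hli f hf) ((hcs n).fderiv ℝ)
      ((hcd n).continuous_fderiv (by simp)), ← hconv]
    simp only [convolution, ContinuousLinearMap.lsmul_apply, smul_eq_mul]
    -- The derivative of the convolution falls on the mollifier. The reflected and translated
    -- mollifier is itself a test function, and testing the weak derivative against it moves the
    -- derivative onto `α`.
    set ψ : C2 → ℝ := fun y => (χ n).normed volume (z - y) with hψ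
    have hψB : Function.support ψ ⊆ B := fun y hy => by
      by_contra hyB
      exact hy (hsupp n z y hz hyB)
    have hψt : tsupport ψ ⊆ B := closure_minimal hψB hBc.isClosed
    have hψc : HasCompactSupport ψ := HasCompactSupport.of_support_subset_isCompact hBc hψB
    have hψd : ContDiff ℝ (⊤ : ℕ∞) ψ := (hcd n).comp (contDiff_const.sub contDiff_id)
    have hψf : ∀ y, fderiv ℝ ψ y a = -fderiv ℝ ((χ n).normed volume) (z - y) a := by
      intro y
      have h1 : HasFDerivAt ψ ((fderiv ℝ ((χ n).normed volume) (z - y)).comp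
          (-ContinuousLinearMap.id ℝ C2)) y :=
        (((hcd n).differentiable (by simp)) (z - y)).hasFDerivAt.comp y
          ((hasFDerivAt_id y).const_sub z)
      rw [h1.fderiv]
      simp
    have hw := hasWeakExtDeriv_funForm_iff.1 h ψ hψd hψc (hψt.trans hBb) a
    have hmb : MeasurableSet ball := Metric.isOpen_ball.measurableSet
    have hL : ∫ y, B.indicator (fun z => α z ![a]) y * (χ n).normed volume (z - y) =
        ∫ y in ball, ψ y * α y ![a] := by
      rw [← integral_indicator hmb]
      refine integral_congr_ae (Eventually.of_forall fun y => ?_)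
      beta_reduce
      by_cases hy : y ∈ B
      · rw [indicator_of_mem hy, indicator_of_mem (hBb hy)]
        exact mul_comm _ _
      · have : ψ y = 0 := hsupp n z y hz hy
        rw [indicator_of_notMem hy, zero_mul]
        simp only [indicator, this, zero_mul, ite_self]
    have hR : ∫ y, B.indicator f y * fderiv ℝ ((χ n).normed volume) (z - y) a =
        -∫ y in ball, fderiv ℝ ψ y a * f y := by
      rw [← integral_neg, ← integral_indicator hmb]
      refine integral_congr_ae (Eventually.of_forall fun y => ?_)
      beta_reduce
      by_cases hy : y ∈ B
      · rw [indicator_of_mem hy, indicator_of_mem (hBb hy), hψf, neg_mul, neg_neg]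
        exact mul_comm _ _
      · have : fderiv ℝ ψ y = 0 := by
          by_contra h0
          exact hy (hψt (support_fderiv_subset ℝ h0))
        rw [indicator_of_notMem hy, zero_mul]
        simp only [indicator, this, _root_.zero_apply, zero_mul, neg_zero, ite_self]
    rw [hL, hR, hw]

theorem isOpen_ball : IsOpen ball := Metric.isOpen_ball

theorem LocL2.locallyIntegrableOn {F : Type*} [NormedAddCommGroup F] {f : C2 → F} (h : LocL2 f) :
    LocallyIntegrableOn f ball := by
  rw [locallyIntegrableOn_iff isOpen_ball.isLocallyClosed]
  intro K hK hc
  have : IsFiniteMeasure (volume.restrict K) := ⟨by simpa using hc.measure_lt_top⟩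
  exact (h K hK hc).integrable (by norm_num)

theorem LocL2.memLp_mul {g c : C2 → ℝ} (hg : LocL2 g) (hc : Continuous c)
    (hcs : HasCompactSupport c) (hs : tsupport c ⊆ ball) :
    MemLp (fun z => c z * g z) 2 volume := by
  obtain ⟨M, hM⟩ := hcs.exists_bound_of_continuous hc
  have h1 : MemLp (fun z => c z * g z) 2 (volume.restrict (tsupport c)) :=
    MemLp.of_le_mul (c := M) (hg _ hs hcs)
      (hc.aestronglyMeasurable.mul (hg _ hs hcs).1)
      (Eventually.of_forall fun z => by
        rw [norm_mul]
        exact mul_le_mul_of_nonneg_right (hM z) (norm_nonneg _))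
  rw [← memLp_indicator_iff_restrict hcs.isCompact.measurableSet] at h1
  refine (memLp_congr_ae (Eventually.of_forall fun z => ?_)).1 h1
  by_cases hz : z ∈ tsupport c
  · simp [indicator_of_mem hz]
  · simp [indicator_of_notMem hz, image_eq_zero_of_notMem_tsupport hz]

theorem LocL2.integrable_mul {g H : C2 → ℝ} (hg : LocL2 g) (hH : MemLp H 2 volume) {K : Set C2}
    (hK : K ⊆ ball) (hc : IsCompact K) (hs : Function.support H ⊆ K) :
    Integrable fun z => g z * H z := by
  have h1 : MemLp (K.indicator g) 2 volume :=
    (memLp_indicator_iff_restrict hc.measurableSet).2 (hg K hK hc)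
  refine (h1.integrable_mul hH).congr (Eventually.of_forall fun z => ?_)
  by_cases hz : z ∈ K
  · simp [indicator_of_mem hz]
  · have : H z = 0 := by by_contra h0; exact hz (hs h0)
    simp [this]

theorem setIntegral_ball_eq {X : C2 → ℝ} (h : Function.support X ⊆ ball) :
    ∫ z in ball, X z = ∫ z, X z :=
  setIntegral_eq_integral_of_forall_compl_eq_zero fun z hz => by
    by_contra h0
    exact hz (h h0)

theorem HasWeakExtDeriv.congr {k : ℕ} {ω ω' : Form k} {θ θ' : Form (k + 1)}
    (h : HasWeakExtDeriv ω θ) (h1 : ∀ z ∈ ball, ω z = ω' z) (h2 : ∀ z ∈ ball, θ z = θ' z) :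
    HasWeakExtDeriv ω' θ' := by
  intro φ hφ hc hs v
  have hmb : MeasurableSet ball := Metric.isOpen_ball.measurableSet
  have := h φ hφ hc hs v
  have e : ∫ z in ball, φ z * θ z v = ∫ z in ball, φ z * θ' z v :=
    setIntegral_congr_fun hmb fun z hz => by simp only [h2 z hz]
  rw [← e, this]
  congr 1
  refine Finset.sum_congr rfl fun i _ => ?_
  congr 1
  exact setIntegral_congr_fun hmb fun z hz => by simp only [h1 z hz]

/-- The Leibniz rule for a function and a closed `1`-form, all locally square integrable. -/
theorem HasWeakExtDeriv.mul_closed {f : C2 → ℝ} {α β : Form 1} (hf : LocL2 f) (hα : LocL2 α)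
    (hβ : LocL2 β) (h : HasWeakExtDeriv (funForm f) α) (hc : HasWeakExtDeriv β 0) :
    HasWeakExtDeriv (fun z => f z • β z : Form 1) (wedge α β) := by
  rw [hasWeakExtDeriv_one_iff] at hc ⊢
  intro φ hφ hφc hφs a b
  -- For smooth `F n`, the product `φ * F n` is a legitimate test function for the closedness of
  -- `β`. The resulting identity is linear in `F n` and its differential, so weak convergence
  -- against fixed L² functions suffices for the limit.
  obtain ⟨F, hF, hF0, hF1⟩ := exists_smooth_approx hf hα h hφs hφc
  have hβi := hβ.locallyIntegrableOn
  have hφd : ∀ a, Continuous fun z => fderiv ℝ φ z a := fun a =>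
    hφ.continuous_fderiv_apply (by simp) |>.comp (continuous_id.prodMk continuous_const)
  have hφdc : ∀ a, HasCompactSupport fun z => fderiv ℝ φ z a := fun a => hφc.fderiv_apply ℝ a
  have hφds : ∀ a, tsupport (fun z => fderiv ℝ φ z a) ⊆ tsupport φ := fun a =>
    tsupport_fderiv_apply_subset ℝ a
  have hH : ∀ c, MemLp (fun z => φ z * β z ![c]) 2 volume := fun c =>
    (hβ.apply ![c]).memLp_mul hφ.continuous hφc hφs
  have hD : ∀ a c, MemLp (fun z => fderiv ℝ φ z a * β z ![c]) 2 volume := fun a c =>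
    (hβ.apply ![c]).memLp_mul (hφd a) (hφdc a) ((hφds a).trans hφs)
  have hHs : ∀ c, Function.support (fun z => φ z * β z ![c]) ⊆ tsupport φ := fun c z hz =>
    subset_tsupport φ (left_ne_zero_of_mul hz)
  have hDs : ∀ a c, Function.support (fun z => fderiv ℝ φ z a * β z ![c]) ⊆ tsupport φ :=
    fun a c z hz => hφds a (subset_tsupport _ (left_ne_zero_of_mul hz))
  have hFd : ∀ n a, Continuous fun z => fderiv ℝ (F n) z a := fun n a =>
    (hF n).continuous_fderiv_apply (by simp) |>.comp (continuous_id.prodMk continuous_const)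
  have hsplit : ∀ n a c, ∫ z in ball, fderiv ℝ (fun y => φ y * F n y) z a * β z ![c] =
      (∫ z, F n z * (fderiv ℝ φ z a * β z ![c])) +
        ∫ z, fderiv ℝ (F n) z a * (φ z * β z ![c]) := by
    intro n a c
    rw [← setIntegral_ball_eq fun z hz => hφs (hDs a c (right_ne_zero_of_mul hz)),
      ← setIntegral_ball_eq fun z hz => hφs (hHs c (right_ne_zero_of_mul hz)), ← integral_add]
    · refine integral_congr_ae (Eventually.of_forall fun z => ?_)
      have e : fderiv ℝ (fun y => φ y * F n y) z = φ z • fderiv ℝ (F n) z + F n z • fderiv ℝ φ z :=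
        fderiv_fun_mul ((hφ.differentiable (by simp)) z) (((hF n).differentiable (by simp)) z)
      simp only [e, _root_.add_apply, _root_.smul_apply, smul_eq_mul]
      ring
    · have := integrableOn_test hβi ((hF n).continuous.mul (hφd a)) ((hφdc a).mul_left)
        ((tsupport_mul_subset_right).trans ((hφds a).trans hφs)) ![c]
      refine this.congr (Eventually.of_forall fun z => ?_)
      simp only [Pi.mul_apply]
      ring
    · have := integrableOn_test hβi ((hFd n a).mul hφ.continuous) (hφc.mul_left)
        ((tsupport_mul_subset_right).trans hφs) ![c]
      refine this.congr (Eventually.of_forall fun z => ?_)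
      simp only [Pi.mul_apply]
      ring
  have hz : ∀ n, ((∫ z, F n z * (fderiv ℝ φ z a * β z ![b])) +
        ∫ z, fderiv ℝ (F n) z a * (φ z * β z ![b])) -
      ((∫ z, F n z * (fderiv ℝ φ z b * β z ![a])) +
        ∫ z, fderiv ℝ (F n) z b * (φ z * β z ![a])) = 0 := by
    intro n
    have := hc (fun y => φ y * F n y) (hφ.mul (hF n)) hφc.mul_right
      ((tsupport_mul_subset_left).trans hφs) a b
    rw [hsplit, hsplit] at this
    have z0 : ∫ z in ball, φ z * F n z * (0 : Form 2) z ![a, b] = 0 := by simp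
    linarith
  have hlim := (((hF0 _ (hD a b) (hDs a b)).add (hF1 a _ (hH b) (hHs b))).sub
    ((hF0 _ (hD b a) (hDs b a)).add (hF1 b _ (hH a) (hHs a))))
  have h0 := tendsto_nhds_unique hlim (tendsto_const_nhds.congr fun n => (hz n).symm)
  have e1 : ∀ a b, ∫ z in ball, fderiv ℝ φ z a * (f z • β z) ![b] =
      ∫ z, f z * (fderiv ℝ φ z a * β z ![b]) := by
    intro a b
    rw [← setIntegral_ball_eq fun z hz => hφs (hDs a b (right_ne_zero_of_mul hz))]
    refine integral_congr_ae (Eventually.of_forall fun z => ?_)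
    simp only [ContinuousAlternatingMap.smul_apply, smul_eq_mul]
    ring
  have e2 : ∫ z in ball, φ z * wedge α β z ![a, b] =
      (∫ z, α z ![a] * (φ z * β z ![b])) - ∫ z, α z ![b] * (φ z * β z ![a]) := by
    rw [← integral_sub ((hα.apply ![a]).integrable_mul (hH b) hφs hφc (hHs b))
      ((hα.apply ![b]).integrable_mul (hH a) hφs hφc (hHs a)),
      setIntegral_ball_eq fun z hz => hφs (subset_tsupport φ (left_ne_zero_of_mul hz))]
    refine integral_congr_ae (Eventually.of_forall fun z => ?_)
    simp only [wedge_apply]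
    ring
  rw [e1, e1, e2]
  linarith

/-- The weak exterior derivative of a `1`-form is closed. -/
theorem HasWeakExtDeriv.closed_one {ψ : Form 1} {ω : Form 2} (h : HasWeakExtDeriv ψ ω) :
    HasWeakExtDeriv ω 0 := by
  intro φ hφ hc hs v
  have hcd : ∀ a, ContDiff ℝ (⊤ : ℕ∞) fun z => fderiv ℝ φ z a := fun a =>
    (hφ.fderiv_right (m := (⊤ : ℕ∞)) (by simp)).clm_apply contDiff_const
  -- Testing with the partial derivatives of `φ` turns the claim into a sum of second derivatives of
  -- `φ`, which cancels by their symmetry.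
  have key : ∀ a b c : C2, ∫ z in ball, fderiv ℝ φ z a * ω z ![b, c] =
      -((∫ z in ball, fderiv ℝ (fun y => fderiv ℝ φ y a) z b * ψ z ![c]) -
        ∫ z in ball, fderiv ℝ (fun y => fderiv ℝ φ y a) z c * ψ z ![b]) := fun a b c =>
    hasWeakExtDeriv_one_iff.1 h _ (hcd a) (hc.fderiv_apply ℝ a)
      ((tsupport_fderiv_apply_subset ℝ a).trans hs) b c
  have hsymm : ∀ z a b, fderiv ℝ (fun y => fderiv ℝ φ y a) z b =
      fderiv ℝ (fun y => fderiv ℝ φ y b) z a := by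
    intro z a b
    have hd : DifferentiableAt ℝ (fderiv ℝ φ) z :=
      ((hφ.fderiv_right (m := (⊤ : ℕ∞)) (by simp)).differentiable (by simp)) z
    have := (hφ.contDiffAt (x := z)).isSymmSndFDerivAt (by simpa using two_le_smooth)
    rw [fderiv_clm_apply hd (differentiableAt_const a),
      fderiv_clm_apply hd (differentiableAt_const b)]
    simpa using this b a
  have r0 : (0 : Fin 3).removeNth v = ![v 1, v 2] := by
    ext i; fin_cases i <;> simp [Fin.removeNth]
  have r1 : (1 : Fin 3).removeNth v = ![v 0, v 2] := by
    ext i; fin_cases i <;> simp [Fin.removeNth]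
  have r2 : (2 : Fin 3).removeNth v = ![v 0, v 1] := by
    ext i; fin_cases i <;> simp [Fin.removeNth]
    rfl
  rw [Fin.sum_univ_three, r0, r1, r2, key, key, key]
  simp only [hsymm _ (v 1) (v 0), hsymm _ (v 2) (v 0), hsymm _ (v 2) (v 1)]
  simp

/-- The differential of a function, as a form. -/
def dfun (f : C2 → ℝ) : Form 1 := fun z =>
  ContinuousAlternatingMap.ofSubsingleton ℝ C2 ℝ (0 : Fin 1) (fderiv ℝ f z)

@[simp]
theorem dfun_apply (f : C2 → ℝ) (z a : C2) : dfun f z ![a] = fderiv ℝ f z a := by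
  simp [dfun]

/-- Smoothness is needed only inside the ball, since the test function confines the integration by
parts to its support. -/
theorem hasWeakExtDeriv_dfun {f : C2 → ℝ} (hf : ∀ z ∈ ball, ContDiffAt ℝ (⊤ : ℕ∞) f z) :
    HasWeakExtDeriv (funForm f) (dfun f) := by
  rw [hasWeakExtDeriv_funForm_iff]
  intro φ hφ hφc hφs a
  have hmb : MeasurableSet ball := Metric.isOpen_ball.measurableSet
  have hfi : LocallyIntegrableOn (fun z => f z) ball :=
    ContinuousOn.locallyIntegrableOn (fun z hz => (hf z hz).continuousAt.continuousWithinAt) hmb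
  have hfdi : LocallyIntegrableOn (fun z => fderiv ℝ f z a) ball :=
    ContinuousOn.locallyIntegrableOn (fun z hz => (((hf z hz).fderiv_right (m := 0)
      (by simp)).continuousAt.clm_apply continuousAt_const).continuousWithinAt) hmb
  have hφd : Continuous fun z => fderiv ℝ φ z a :=
    hφ.continuous_fderiv_apply (by simp) |>.comp (continuous_id.prodMk continuous_const)
  have hφds := tsupport_fderiv_apply_subset ℝ (f := φ) a
  have hs1 : ∀ {c g : C2 → ℝ}, tsupport c ⊆ ball → Function.support (fun z => c z * g z) ⊆ ball :=
    fun h z hz => h (subset_tsupport _ (left_ne_zero_of_mul hz))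
  have hint : ∀ {c g : C2 → ℝ}, LocallyIntegrableOn g ball → Continuous c →
      HasCompactSupport c → tsupport c ⊆ ball → Integrable fun z => c z * g z := by
    intro c g h1 h2 h3 h4
    refine (integrableOn_iff_integrable_of_support_subset (hs1 h4)).1 ?_
    refine integrableOn_test (k := 0) (ω := funForm g) ?_ h2 h3 h4 ![]
    intro z hz
    obtain ⟨t, ht, hi⟩ := h1 z hz
    exact ⟨t, ht, (ContinuousAlternatingMap.constOfIsEmptyLIE ℝ C2 ℝ
      (Fin 0)).toContinuousLinearEquiv.toContinuousLinearMap.integrable_comp hi⟩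
  simp only [dfun_apply]
  rw [setIntegral_ball_eq (hs1 hφs), setIntegral_ball_eq (hs1 (hφds.trans hφs))]
  exact integral_mul_fderiv_eq_neg_fderiv_mul_of_integrable
    (hint hfi hφd (hφc.fderiv_apply ℝ a) (hφds.trans hφs)) (hint hfdi hφ.continuous hφc hφs)
    (hint hfi hφ.continuous hφc hφs) (fun z _ => (hφ.differentiable (by simp)) z)
    fun z hz => (hf z (hφs hz)).differentiableAt (by simp)

/-! ### Anisotropy of the Bergman frame. -/

/-- The defining function `1 - |z|²` of the ball. -/
def rho (z : C2) : ℝ := 1 - ‖z‖ ^ 2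

theorem mem_ball_iff {z : C2} : z ∈ ball ↔ ‖z‖ < 1 := by simp [ball]

theorem rho_pos {z : C2} (hz : z ∈ ball) : 0 < rho z := by
  have := mem_ball_iff.1 hz
  unfold rho
  nlinarith [norm_nonneg z]

theorem rho_le_one (z : C2) : rho z ≤ 1 := by
  unfold rho
  nlinarith [sq_nonneg ‖z‖]

theorem contDiff_rho : ContDiff ℝ (⊤ : ℕ∞) rho :=
  contDiff_const.sub (contDiff_norm_sq ℝ)

theorem continuous_rho : Continuous rho := contDiff_rho.continuous

section Frame

theorem bergmanFrame_apply (z v : C2) :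
    bergmanFrame z v = ((Real.sqrt (rho z) : ℝ) : ℂ) •
      (v - ((((1 + Real.sqrt (rho z))⁻¹ : ℝ) : ℂ) * inner ℂ z v) • z) := by
  simp [bergmanFrame, rho, mul_smul]

/-- The component along the complex line of `z` is scaled by the full factor `rho z`, not by its
square root. This gain is what makes the contact form small. -/
theorem inner_bergmanFrame {z : C2} (hz : z ∈ ball) (v : C2) :
    inner ℂ z (bergmanFrame z v) = (rho z : ℂ) * inner ℂ z v := by
  set s : ℝ := Real.sqrt (rho z) with hs
  have hs0 : 0 < s := Real.sqrt_pos.2 (rho_pos hz)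
  have hs2 : s ^ 2 = 1 - ‖z‖ ^ 2 := Real.sq_sqrt (rho_pos hz).le
  set t : ℝ := (1 + s)⁻¹ with ht
  have hts : t * (1 + s) = 1 := inv_mul_cancel₀ (by positivity)
  set c : ℂ := inner ℂ z v with hc
  rw [bergmanFrame_apply, inner_smul_right, inner_sub_right, inner_smul_right,
    inner_self_eq_norm_sq_to_K, ← hc, ← hs, ← ht]
  have h1 : (‖z‖ : ℂ) ^ 2 = ((1 - s ^ 2 : ℝ) : ℂ) := by
    rw [hs2]; push_cast; ring
  have h2 : 1 - t * (1 - s ^ 2) = s := by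
    linear_combination (1 - s) * (-hts)
  have h2' : (1 : ℂ) - t * (1 - (s : ℂ) ^ 2) = s := by exact_mod_cast h2
  have h3 : (rho z : ℂ) = (s : ℂ) ^ 2 := by
    rw [← Complex.ofReal_pow, hs2, rho]
  simp only [RCLike.ofReal_eq_complex_ofReal]
  rw [h1, h3]
  push_cast
  linear_combination (s : ℂ) * c * h2'

theorem bergmanFrame_of_inner_eq_zero {z v : C2} (h : inner ℂ z v = 0) :
    bergmanFrame z v = Real.sqrt (rho z) • v := by
  rw [bergmanFrame_apply, h]
  simp

/-- The Bergman metric dominates the Euclidean metric divided by `1 - |z|²`. -/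
theorem norm_bergmanFrame_le {z : C2} (hz : z ∈ ball) (v : C2) :
    ‖bergmanFrame z v‖ ≤ Real.sqrt (rho z) * ‖v‖ := by
  have h := bergmanSq_bergmanFrame hz v
  have hρ := rho_pos hz
  set w := bergmanFrame z v
  have h1 : rho z * ‖w‖ ^ 2 / rho z ^ 2 ≤ bergmanSq z w := by
    unfold bergmanSq
    rw [← rho]
    gcongr
    nlinarith [sq_nonneg ‖inner ℂ z w‖]
  have h2 : ‖w‖ ^ 2 ≤ (Real.sqrt (rho z) * ‖v‖) ^ 2 := by
    rw [mul_pow, Real.sq_sqrt hρ.le, ← h]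
    have : rho z * ‖w‖ ^ 2 / rho z ^ 2 = ‖w‖ ^ 2 / rho z := by field_simp
    rw [this, div_le_iff₀ hρ] at h1
    linarith
  exact le_of_sq_le_sq h2 (by positivity)

theorem le_norm_bergmanFrame {z : C2} (hz : z ∈ ball) (v : C2) :
    rho z * ‖v‖ ≤ ‖bergmanFrame z v‖ := by
  have h := bergmanSq_bergmanFrame hz v
  have hρ := rho_pos hz
  set w := bergmanFrame z v
  have h0 : ‖inner ℂ z w‖ ≤ ‖z‖ * ‖w‖ := norm_inner_le_norm z w
  have h0' : ‖inner ℂ z w‖ ^ 2 ≤ ‖z‖ ^ 2 * ‖w‖ ^ 2 := by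
    rw [← mul_pow]; gcongr
  have h1 : bergmanSq z w ≤ ‖w‖ ^ 2 / rho z ^ 2 := by
    unfold bergmanSq
    rw [← rho]
    gcongr
    unfold rho
    linarith
  rw [h, le_div_iff₀ (by positivity)] at h1
  exact le_of_sq_le_sq (by nlinarith) (norm_nonneg _)

/-- The lower bound on the frame makes it injective, hence surjective by dimension. -/
theorem exists_bergmanFrame_eq {z : C2} (hz : z ∈ ball) (v : C2) :
    ∃ w, bergmanFrame z w = v ∧ rho z * ‖w‖ ≤ ‖v‖ := by
  have hinj : Function.Injective (bergmanFrame z : C2 →ₗ[ℝ] C2) := by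
    rw [← LinearMap.ker_eq_bot, LinearMap.ker_eq_bot']
    intro m hm
    have h1 := le_norm_bergmanFrame hz m
    have h2 : bergmanFrame z m = 0 := hm
    rw [h2, norm_zero] at h1
    have h3 := rho_pos hz
    have h4 : ‖m‖ ≤ 0 := by
      by_contra h5
      have : 0 < rho z * ‖m‖ := mul_pos h3 (not_le.1 h5)
      linarith
    exact norm_le_zero_iff.1 h4
  obtain ⟨w, hw⟩ := (LinearMap.injective_iff_surjective.1 hinj) v
  have hw' : bergmanFrame z w = v := hw
  exact ⟨w, hw', hw' ▸ le_norm_bergmanFrame hz w⟩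

theorem continuous_bergmanFrame : Continuous bergmanFrame := by
  have h1 : Continuous fun z : C2 => Real.sqrt (1 - ‖z‖ ^ 2) := by fun_prop
  have h2 : Continuous fun z : C2 => ((((1 + Real.sqrt (1 - ‖z‖ ^ 2))⁻¹ : ℝ) : ℂ)) := by
    refine Complex.continuous_ofReal.comp ((continuous_const.add h1).inv₀ fun z => ?_)
    exact (add_pos_of_pos_of_nonneg one_pos (Real.sqrt_nonneg _)).ne'
  have h3 : Continuous fun z : C2 => ((innerSL ℂ z).smulRight z).restrictScalars ℝ := by
    have h4 : Continuous fun z : C2 => (innerSL ℂ z).smulRight z :=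
      ((ContinuousLinearMap.smulRightL ℂ C2 C2).continuous₂).comp
        ((innerSL ℂ (E := C2)).continuous.prodMk continuous_id)
    exact (ContinuousLinearMap.restrictScalarsL ℂ C2 C2 ℝ ℝ).continuous.comp h4
  exact h1.smul (continuous_const.sub (h2.smul h3))

theorem norm_le_norm_inFrame {k : ℕ} (ω : Form k) {z : C2} (hz : z ∈ ball) :
    ‖ω z‖ ≤ (rho z ^ k)⁻¹ * ‖inFrame ω z‖ := by
  have hρ := rho_pos hz
  refine ContinuousAlternatingMap.opNorm_le_bound _ (by positivity) fun v => ?_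
  choose w hw hwn using fun i => exists_bergmanFrame_eq hz (v i)
  have e : ω z v = inFrame ω z w := by
    simp only [inFrame, ContinuousAlternatingMap.compContinuousLinearMap_apply]
    congr 1
    funext i
    exact (hw i).symm
  rw [e]
  refine (ContinuousAlternatingMap.le_opNorm _ _).trans ?_
  have : rho z ^ k * ∏ i, ‖w i‖ ≤ ∏ i, ‖v i‖ := by
    calc rho z ^ k * ∏ i, ‖w i‖ = ∏ i, (rho z * ‖w i‖) := by
          rw [Finset.prod_mul_distrib]; simp
      _ ≤ _ := Finset.prod_le_prod (fun i _ => by positivity) fun i _ => hwn i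
  rw [mul_comm (rho z ^ k)⁻¹, mul_assoc]
  refine mul_le_mul_of_nonneg_left ?_ (norm_nonneg _)
  rwa [le_inv_mul_iff₀ (by positivity)]

end Frame

/-! ### Integrability of powers of `rho`. -/

section Integrability

theorem finrank_C2 : Module.finrank ℝ C2 = 4 := by
  have h := Module.finrank_mul_finrank ℝ ℂ C2
  rw [Complex.finrank_real_complex, finrank_euclideanSpace_fin] at h
  omega

/-- In polar coordinates the integrand is y³(1 + y)^a (1 - y)^a; the first two factors are bounded
on [0, 1]. -/
theorem integrableOn_rho_rpow {a : ℝ} (ha : -1 < a) :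
    IntegrableOn (fun z => rho z ^ a) ball := by
  have h := (integrableOn_fun_norm_addHaar (E := C2) volume
    (f := fun y : ℝ => (1 - y ^ 2) ^ a) (r := 1)).2
  refine h ?_
  have h1 : IntervalIntegrable (fun y : ℝ => (1 - y) ^ a) volume 0 1 := by
    have := (intervalIntegral.intervalIntegrable_rpow' (a := 0) (b := 1) ha).comp_sub_left 1
    simpa using this.symm
  have h2 : IntegrableOn (fun y : ℝ => (1 - y) ^ a) (Ioo 0 1) := by
    rw [intervalIntegrable_iff_integrableOn_Ioo_of_le zero_le_one] at h1
    exact h1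
  have hc : ContinuousOn (fun y : ℝ => y ^ 3 * (1 + y) ^ a) (Icc 0 1) := by
    refine (continuousOn_id.pow 3).mul (ContinuousOn.rpow_const (by fun_prop) fun y hy => ?_)
    left
    linarith [hy.1]
  obtain ⟨M, hM⟩ := isCompact_Icc.exists_bound_of_continuousOn hc
  refine Integrable.mono' (h2.const_mul M) ?_ ?_
  · refine Measurable.aestronglyMeasurable ?_
    fun_prop
  · refine (ae_restrict_iff' measurableSet_Ioo).2 (Eventually.of_forall fun y hy => ?_)
    have e : (1 - y ^ 2) ^ a = (1 - y) ^ a * (1 + y) ^ a := by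
      rw [← Real.mul_rpow (by linarith [hy.2]) (by linarith [hy.1])]
      ring_nf
    have hp : 0 ≤ (1 - y) ^ a := Real.rpow_nonneg (by linarith [hy.2]) _
    rw [finrank_C2, smul_eq_mul, e]
    calc ‖y ^ (4 - 1) * ((1 - y) ^ a * (1 + y) ^ a)‖
        = ‖y ^ 3 * (1 + y) ^ a‖ * (1 - y) ^ a := by
          rw [← Real.norm_of_nonneg hp, ← norm_mul, Real.norm_of_nonneg hp]
          ring_nf
      _ ≤ M * (1 - y) ^ a := mul_le_mul_of_nonneg_right (hM y ⟨hy.1.le, hy.2.le⟩) hp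

theorem integrable_bergmanVol_iff {g : C2 → ℝ} :
    Integrable g bergmanVol ↔ IntegrableOn (fun z => (rho z ^ 3)⁻¹ * g z) ball := by
  unfold bergmanVol
  rw [integrable_withDensity_iff_integrable_smul']
  · refine integrable_congr ?_
    refine (ae_restrict_iff' isOpen_ball.measurableSet).2 (Eventually.of_forall fun z hz => ?_)
    have := rho_pos hz
    simp only [smul_eq_mul]
    rw [ENNReal.toReal_ofReal]
    · rfl
    · have : 0 < 1 - ‖z‖ ^ 2 := rho_pos hz
      positivity
  · have := continuous_rho.measurable
    unfold rho at this
    fun_prop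
  · exact Eventually.of_forall fun z => ENNReal.ofReal_lt_top

/-- The volume density ρ⁻³ turns the p-th power into ρ^(sp - 3), and sp - 3 > -1 is the condition.
All the exponent thresholds of the proof come from here. -/
theorem memLp_rho_rpow {s p : ℝ} (hp : 0 < p) (h : 2 < s * p) :
    MemLp (fun z => rho z ^ s) (ENNReal.ofReal p) bergmanVol := by
  have hm : Measurable fun z => rho z ^ s := continuous_rho.measurable.pow_const s
  rw [← integrable_norm_rpow_iff hm.aestronglyMeasurable (by simpa using hp) (by simp),
    ENNReal.toReal_ofReal hp.le, integrable_bergmanVol_iff]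
  refine (integrableOn_rho_rpow (a := s * p - 3) (by linarith)).congr_fun (fun z hz => ?_)
    isOpen_ball.measurableSet
  have hρ := rho_pos hz
  simp only
  rw [Real.norm_of_nonneg (Real.rpow_nonneg hρ.le _), ← Real.rpow_mul hρ.le, Real.rpow_sub hρ]
  rw [show ((3 : ℝ)) = ((3 : ℕ) : ℝ) by norm_num, Real.rpow_natCast]
  field_simp

theorem volume_restrict_le_bergmanVol : volume.restrict ball ≤ bergmanVol := by
  unfold bergmanVol
  refine Measure.le_iff.2 fun s hs => ?_
  rw [withDensity_apply _ hs]
  calc (volume.restrict ball) s = ∫⁻ _ in s, 1 ∂(volume.restrict ball) := by simp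
    _ ≤ _ := by
      refine lintegral_mono_ae ?_
      refine ae_restrict_of_ae ((ae_restrict_iff' isOpen_ball.measurableSet).2
        (Eventually.of_forall fun z hz => ?_))
      have h0 : 0 < 1 - ‖z‖ ^ 2 := rho_pos hz
      have h1 : 1 - ‖z‖ ^ 2 ≤ 1 := rho_le_one z
      rw [← ENNReal.ofReal_one]
      refine ENNReal.ofReal_le_ofReal ?_
      exact (one_le_inv₀ (by positivity)).2 (pow_le_one₀ h0.le h1)

end Integrability

/-! ### Exterior products of L^p forms and independence of representatives. -/

/-- A compact subset of the ball lies in a smaller concentric ball, which is admissible because `η`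
is on the unit sphere. There the Bergman norm controls the Euclidean one up to a constant, and
finite measure lowers the exponent to 2. -/
theorem LpLoc.locL2 {k : ℕ} {p : ℝ≥0∞} {η : C2} (hη : ‖η‖ = 1) (hp : 2 ≤ p) {ω : Form k}
    (hω : ω ∈ LpLoc k p η) : LocL2 ω := by
  intro K hK hc
  obtain ⟨s, hs0, hs1, hKs⟩ := exists_radius hK hc
  set W : Set C2 := Metric.ball 0 ((s + 1) / 2) with hW
  have hWb : W ⊆ ball := Metric.ball_subset_ball (by linarith)
  have hKW : K ⊆ W := hKs.trans (Metric.closedBall_subset_ball (by linarith))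
  have haway : IsAway η W := by
    refine ⟨Metric.isOpen_ball, hWb, fun h => ?_⟩
    have := Metric.closure_ball_subset_closedBall h
    simp only [Metric.mem_closedBall, dist_zero_right, hη] at this
    linarith
  have hle : volume.restrict K ≤ bergmanVol.restrict W := by
    calc volume.restrict K = (volume.restrict ball).restrict K := by
          rw [Measure.restrict_restrict_of_subset hK]
      _ ≤ bergmanVol.restrict W :=
          Measure.restrict_mono hKW volume_restrict_le_bergmanVol
  have hfin : IsFiniteMeasure (volume.restrict K) := ⟨by simpa using hc.measure_lt_top⟩
  have h1 : MemLp (inFrame ω) 2 (volume.restrict K) :=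
    ((hω.2 W haway).mono_measure hle).mono_exponent hp
  refine MemLp.of_le_mul (c := ((1 - s ^ 2) ^ k)⁻¹) h1
    ((hω.1.integrableOn_compact_subset hK hc).1) ?_
  refine (ae_restrict_iff' hc.measurableSet).2 (Eventually.of_forall fun z hz => ?_)
  refine (norm_le_norm_inFrame ω (hK hz)).trans ?_
  have hz' : ‖z‖ ≤ s := by simpa using hKs hz
  have h2 : 1 - s ^ 2 ≤ rho z := by
    unfold rho
    nlinarith [norm_nonneg z]
  have h3 : 0 < 1 - s ^ 2 := by nlinarith
  gcongr

instance holderTriple_double (p : ℝ) :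
    ENNReal.HolderTriple (ENNReal.ofReal (2 * p)) (ENNReal.ofReal (2 * p)) (ENNReal.ofReal p) where
  inv_add_inv_eq_inv := by
    rw [ENNReal.ofReal_mul (by norm_num), ← two_mul, ENNReal.mul_inv (by simp) (by simp),
      ENNReal.ofReal_ofNat, ← mul_assoc, ENNReal.mul_inv_cancel (by simp) (by simp), one_mul]

/-- The exterior product of two covectors. -/
def wedgePt (a b : C2 [⋀^Fin 1]→L[ℝ] ℝ) : C2 [⋀^Fin 2]→L[ℝ] ℝ :=
  ContinuousAlternatingMap.alternatizeUncurryFin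
    (((ContinuousAlternatingMap.ofSubsingleton ℝ C2 ℝ (0 : Fin 1)).symm a).smulRight b)

theorem wedge_eq (α β : Form 1) (z : C2) : wedge α β z = wedgePt (α z) (β z) := rfl

theorem wedgePt_apply (a b : C2 [⋀^Fin 1]→L[ℝ] ℝ) (v w : C2) :
    wedgePt a b ![v, w] = a ![v] * b ![w] - a ![w] * b ![v] :=
  wedge_apply (fun _ => a) (fun _ => b) 0 v w

theorem abs_one_form_le (a : C2 [⋀^Fin 1]→L[ℝ] ℝ) (v : C2) : |a ![v]| ≤ ‖a‖ * ‖v‖ := by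
  simpa using a.le_opNorm ![v]

theorem norm_wedgePt_le (a b : C2 [⋀^Fin 1]→L[ℝ] ℝ) : ‖wedgePt a b‖ ≤ 2 * ‖a‖ * ‖b‖ := by
  refine ContinuousAlternatingMap.opNorm_le_bound _ (by positivity) fun v => ?_
  rw [eq_pair v, wedgePt_apply, Real.norm_eq_abs, Fin.prod_univ_two]
  simp only [Matrix.cons_val_zero, Matrix.cons_val_one]
  refine (abs_sub _ _).trans ?_
  rw [abs_mul, abs_mul]
  have h1 := mul_le_mul (abs_one_form_le a (v 0)) (abs_one_form_le b (v 1)) (abs_nonneg _)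
    (by positivity)
  have h2 := mul_le_mul (abs_one_form_le a (v 1)) (abs_one_form_le b (v 0)) (abs_nonneg _)
    (by positivity)
  linarith

theorem continuous_wedgePt :
    Continuous fun q : (C2 [⋀^Fin 1]→L[ℝ] ℝ) × (C2 [⋀^Fin 1]→L[ℝ] ℝ) => wedgePt q.1 q.2 := by
  have h1 : Continuous fun q : (C2 [⋀^Fin 1]→L[ℝ] ℝ) × (C2 [⋀^Fin 1]→L[ℝ] ℝ) =>
      ((ContinuousAlternatingMap.ofSubsingletonLIE (𝕜 := ℝ) (E := C2) (F := ℝ) (0 : Fin 1)).symm q.1).smulRight q.2 :=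
    ((ContinuousLinearMap.smulRightL ℝ C2 (C2 [⋀^Fin 1]→L[ℝ] ℝ)).continuous₂).comp
      (((ContinuousAlternatingMap.ofSubsingletonLIE (𝕜 := ℝ) (E := C2) (F := ℝ) (0 : Fin 1)).symm.continuous.comp
        continuous_fst).prodMk continuous_snd)
  exact (ContinuousAlternatingMap.alternatizeUncurryFinCLM ℝ C2 ℝ).continuous.comp h1

attribute [irreducible] wedgePt

theorem memLp_wedgePt {μ : Measure C2} {p q r : ℝ≥0∞} [ENNReal.HolderTriple q r p]
    {a b : C2 → C2 [⋀^Fin 1]→L[ℝ] ℝ} (ha : MemLp a q μ) (hb : MemLp b r μ) :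
    MemLp (fun z => wedgePt (a z) (b z)) p μ := by
  have hm : AEStronglyMeasurable (fun z => wedgePt (a z) (b z)) μ :=
    continuous_wedgePt.comp_aestronglyMeasurable (ha.1.prodMk hb.1)
  refine MemLp.of_bilin (q := r) (p := q) wedgePt 2 ha hb hm (Eventually.of_forall fun z => ?_)
  have := norm_wedgePt_le (a z) (b z)
  exact_mod_cast this

theorem inFrame_wedge (α β : Form 1) :
    inFrame (wedge α β) = fun z => wedgePt (inFrame α z) (inFrame β z) := by
  have h : ∀ (γ : Form 1) z a, inFrame γ z ![a] = γ z ![bergmanFrame z a] := by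
    intro γ z a
    simp only [inFrame, ContinuousAlternatingMap.compContinuousLinearMap_apply]
    congr 1
    ext i; fin_cases i; rfl
  funext z
  ext v
  rw [eq_pair v, wedgePt_apply, h, h, h, h, ← wedge_apply]
  simp only [inFrame, ContinuousAlternatingMap.compContinuousLinearMap_apply]
  congr 1
  ext i; fin_cases i <;> rfl

instance : ENNReal.HolderTriple 2 2 1 where
  inv_add_inv_eq_inv := by rw [ENNReal.inv_two_add_inv_two, inv_one]

theorem locallyIntegrableOn_of_memLp_one {F : Type*} [NormedAddCommGroup F] {f : C2 → F}
    (h : ∀ K ⊆ ball, IsCompact K → MemLp f 1 (volume.restrict K)) :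
    LocallyIntegrableOn f ball := by
  rw [locallyIntegrableOn_iff isOpen_ball.isLocallyClosed]
  exact fun K hK hc => memLp_one_iff_integrable.1 (h K hK hc)

/-- Hölder in the Bergman frames gives the L^p bound on admissible sets, and L² times L² gives local
integrability. -/
theorem wedge_mem_LpLoc {p : ℝ} {η : C2} (hη : ‖η‖ = 1) (hp : 1 ≤ p) {α β : Form 1}
    (hα : α ∈ LpLoc 1 (ENNReal.ofReal (2 * p)) η) (hβ : β ∈ LpLoc 1 (ENNReal.ofReal (2 * p)) η) :
    wedge α β ∈ LpLoc 2 (ENNReal.ofReal p) η := by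
  have h2 : 2 ≤ ENNReal.ofReal (2 * p) := by
    rw [← ENNReal.ofReal_ofNat]
    exact ENNReal.ofReal_le_ofReal (by linarith)
  refine ⟨locallyIntegrableOn_of_memLp_one fun K hK hc => ?_, fun W hW => ?_⟩
  · rw [show wedge α β = fun z => wedgePt (α z) (β z) from funext (wedge_eq α β)]
    exact memLp_wedgePt (LpLoc.locL2 hη h2 hα K hK hc) (LpLoc.locL2 hη h2 hβ K hK hc)
  unfold MemLpForm
  rw [inFrame_wedge]
  exact memLp_wedgePt (hα.2 W hW) (hβ.2 W hW)

theorem funForm_apply_self (ψ : Form 0) : funForm (fun z => ψ z ![]) = ψ := by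
  funext z
  ext v
  simp only [funForm, ContinuousAlternatingMap.constOfIsEmpty_apply]
  congr 1
  exact Subsingleton.elim _ _

theorem inFrame_smul_fun {k : ℕ} (f : C2 → ℝ) (ω : Form k) :
    inFrame (fun z => f z • ω z) = fun z => f z • inFrame ω z := by
  funext z
  ext v
  simp [inFrame]

theorem memLp_apply_zero_form {μ : Measure C2} {p : ℝ≥0∞} {ψ : C2 → C2 [⋀^Fin 0]→L[ℝ] ℝ}
    (h : MemLp ψ p μ) : MemLp (fun z => ψ z ![]) p μ :=
  (ContinuousAlternatingMap.apply ℝ C2 ℝ (![] : Fin 0 → C2)).comp_memLp' h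

theorem smul_mem_LpLoc {p : ℝ} {η : C2} (hη : ‖η‖ = 1) (hp : 1 ≤ p) {ψ : Form 0} {β : Form 1}
    (hψ : ψ ∈ LpLoc 0 (ENNReal.ofReal (2 * p)) η) (hβ : β ∈ LpLoc 1 (ENNReal.ofReal (2 * p)) η) :
    (fun z => ψ z ![] • β z : Form 1) ∈ LpLoc 1 (ENNReal.ofReal p) η := by
  have h2 : 2 ≤ ENNReal.ofReal (2 * p) := by
    rw [← ENNReal.ofReal_ofNat]
    exact ENNReal.ofReal_le_ofReal (by linarith)
  refine ⟨locallyIntegrableOn_of_memLp_one fun K hK hc =>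
    MemLp.smul (LpLoc.locL2 hη h2 hβ K hK hc)
      (memLp_apply_zero_form (LpLoc.locL2 hη h2 hψ K hK hc)), fun W hW => ?_⟩
  unfold MemLpForm
  rw [inFrame_smul_fun]
  have e : inFrame ψ = ψ := by
    funext z
    ext v
    simp only [inFrame, ContinuousAlternatingMap.compContinuousLinearMap_apply]
    congr 1
    exact Subsingleton.elim _ _
  have h := hψ.2 W hW
  unfold MemLpForm at h
  rw [e] at h
  exact MemLp.smul (hβ.2 W hW) (memLp_apply_zero_form h)

theorem cls_eq_iff {k : ℕ} {p : ℝ≥0∞} {η : C2} {ω ω' : closedForms (k + 1) p η} :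
    cls ω = cls ω' ↔ ∃ ψ ∈ LpLoc k p η, HasWeakExtDeriv ψ ((ω : Form (k + 1)) - ω') := by
  unfold cls
  rw [Submodule.Quotient.eq]
  constructor
  · rintro ⟨-, h⟩
    exact h
  · exact fun h => ⟨sub_mem ω.2.1 ω'.2.1, h⟩

theorem wedge_add_left (α α' β : Form 1) : wedge (α + α') β = wedge α β + wedge α' β := by
  funext z
  ext v
  rw [eq_pair v, wedge_apply, Pi.add_apply, Pi.add_apply, ContinuousAlternatingMap.add_apply,
    ContinuousAlternatingMap.add_apply, ContinuousAlternatingMap.add_apply, wedge_apply,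
    wedge_apply]
  ring

theorem wedge_swap (α β : Form 1) : wedge α β = (-1 : ℝ) • wedge β α := by
  funext z
  ext v
  rw [eq_pair v, wedge_apply, Pi.smul_apply, ContinuousAlternatingMap.smul_apply, wedge_apply]
  simp only [smul_eq_mul]
  ring

theorem wedge_add_right (α β β' : Form 1) : wedge α (β + β') = wedge α β + wedge α β' := by
  rw [wedge_swap, wedge_add_left, wedge_swap α β, wedge_swap α β', smul_add]

/-- The cup product of the class of a differential with any class of degree one. -/
theorem isCup_of_potential {p : ℝ} {η : C2} (hη : ‖η‖ = 1) (hp : 1 ≤ p) {f : C2 → ℝ}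
    {α₀ β₀ : closedForms 1 (ENNReal.ofReal (2 * p)) η} (hf : LocL2 f)
    (hα : HasWeakExtDeriv (funForm f) α₀) :
    ∃ h : wedge α₀ β₀ ∈ closedForms 2 (ENNReal.ofReal p) η,
      IsCup (cls α₀) (cls β₀) (cls ⟨wedge α₀ β₀, h⟩) := by
  have h2 : 2 ≤ ENNReal.ofReal (2 * p) := by
    rw [← ENNReal.ofReal_ofNat]
    exact ENNReal.ofReal_le_ofReal (by linarith)
  have hfF : LocallyIntegrableOn (funForm f) ball := by
    intro z hz
    obtain ⟨t, ht, hi⟩ := hf.locallyIntegrableOn z hz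
    exact ⟨t, ht, (ContinuousAlternatingMap.constOfIsEmptyLIE ℝ C2 ℝ
      (Fin 0)).toContinuousLinearEquiv.toContinuousLinearMap.integrable_comp hi⟩
  have hclosed : ∀ {g : C2 → ℝ} {α β : closedForms 1 (ENNReal.ofReal (2 * p)) η}, LocL2 g →
      HasWeakExtDeriv (funForm g) α → wedge α β ∈ closedForms 2 (ENNReal.ofReal p) η := by
    intro g α β hg h
    exact ⟨wedge_mem_LpLoc hη hp α.2.1 β.2.1, (h.mul_closed hg (LpLoc.locL2 hη h2 α.2.1)
      (LpLoc.locL2 hη h2 β.2.1) β.2.2).closed_one⟩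
  refine ⟨hclosed hf hα, fun α β ha hb => ?_⟩
  obtain ⟨ψ, hψ, hψd⟩ := cls_eq_iff.1 ha
  obtain ⟨χ, hχ, hχd⟩ := cls_eq_iff.1 hb
  have hα2 := LpLoc.locL2 hη h2 α.2.1
  have hβ2 := LpLoc.locL2 hη h2 β.2.1
  have hα02 := LpLoc.locL2 hη h2 α₀.2.1
  have hβ02 := LpLoc.locL2 hη h2 β₀.2.1
  have hψ2 := LpLoc.locL2 hη h2 hψ
  have hχ2 := LpLoc.locL2 hη h2 hχ
  have hαsub2 : LocL2 ((α : Form 1) - (α₀ : Form 1)) := fun K hK hc => (hα2 K hK hc).sub (hα02 K hK hc)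
  have hβsub2 : LocL2 ((β : Form 1) - (β₀ : Form 1)) := fun K hK hc => (hβ2 K hK hc).sub (hβ02 K hK hc)
  -- Any other representative of the class again has a potential, so its exterior product with a
  -- closed form is closed by the Leibniz rule.
  have hsum : HasWeakExtDeriv (funForm fun z => ψ z ![] + f z) α := by
    have := hψd.add hψ.1 hfF hαsub2.locallyIntegrableOn hα02.locallyIntegrableOn hα
    rw [sub_add_cancel] at this
    have e : (funForm fun z => ψ z ![] + f z) = ψ + funForm f := by
      nth_rewrite 2 [← funForm_apply_self ψ]
      funext z
      ext v
      simp [funForm]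
    rwa [e]
  have hsum2 : LocL2 fun z => ψ z ![] + f z := fun K hK hc =>
    (memLp_apply_zero_form (hψ2 K hK hc)).add (hf K hK hc)
  refine ⟨hclosed hsum2 hsum, cls_eq_iff.2 ?_⟩
  have d1 : HasWeakExtDeriv (fun z => ψ z ![] • (β : Form 1) z : Form 1)
      (wedge ((α : Form 1) - α₀) β) :=
    HasWeakExtDeriv.mul_closed (fun K hK hc => memLp_apply_zero_form (hψ2 K hK hc)) hαsub2 hβ2
      (by rwa [funForm_apply_self]) β.2.2
  have d2 : HasWeakExtDeriv (fun z => χ z ![] • (α₀ : Form 1) z : Form 1)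
      (wedge ((β : Form 1) - β₀) α₀) :=
    HasWeakExtDeriv.mul_closed (fun K hK hc => memLp_apply_zero_form (hχ2 K hK hc)) hβsub2 hα02
      (by rwa [funForm_apply_self]) α₀.2.2
  have m1 := smul_mem_LpLoc hη hp hψ β.2.1
  have m2 := smul_mem_LpLoc hη hp hχ α₀.2.1
  have hαs : (α : Form 1) - α₀ ∈ LpLoc 1 (ENNReal.ofReal (2 * p)) η := sub_mem α.2.1 α₀.2.1
  have hβs : (β : Form 1) - β₀ ∈ LpLoc 1 (ENNReal.ofReal (2 * p)) η := sub_mem β.2.1 β₀.2.1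
  have l1 := (wedge_mem_LpLoc hη hp hαs β.2.1).1
  have l2 := (wedge_mem_LpLoc hη hp hβs α₀.2.1).1
  refine ⟨_, add_mem m1 (Submodule.smul_mem _ (-1 : ℝ) m2), ?_⟩
  have d := d1.add m1.1 (locallyIntegrableOn_smul (-1 : ℝ) m2.1) l1
    (locallyIntegrableOn_smul (-1 : ℝ) l2) (d2.smul (-1))
  -- α∧β - α₀∧β₀ = (α - α₀)∧β + α₀∧(β - β₀), with primitive ψβ - χα₀; this is in L^p because each
  -- factor is in L^(2p).
  have e : wedge ((α : Form 1) - α₀) β + (-1 : ℝ) • wedge ((β : Form 1) - β₀) α₀ =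
      wedge (α : Form 1) β - wedge (α₀ : Form 1) β₀ := by
    rw [← wedge_swap]
    have e1 : wedge (α : Form 1) β = wedge ((α : Form 1) - α₀) β + wedge α₀ β := by
      rw [← wedge_add_left, sub_add_cancel]
    have e2 : wedge (α₀ : Form 1) β = wedge (α₀ : Form 1) ((β : Form 1) - β₀) + wedge α₀ β₀ := by
      rw [← wedge_add_right, sub_add_cancel]
    rw [e1, e2]
    abel
  rwa [e] at d

/-- The class of the differential of `u` does not depend on the choice of a representative. -/
theorem cls_dForm_eq {q : ℝ≥0∞} {η : C2} {u : C2 → ℝ} (hu : u ∈ Royden q η)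
    (α : closedForms 1 q η) (h : HasWeakExtDeriv (funForm u) α) : cls (dForm u hu) = cls α := by
  refine cls_eq_iff.2 ⟨0, zero_mem _, ?_⟩
  have huF : LocallyIntegrableOn (funForm u) ball := by
    intro z hz
    obtain ⟨t, ht, hi⟩ := hu.1 z hz
    exact ⟨t, ht, (ContinuousAlternatingMap.constOfIsEmptyLIE ℝ C2 ℝ
      (Fin 0)).toContinuousLinearEquiv.toContinuousLinearMap.integrable_comp hi⟩
  have hd : HasWeakExtDeriv (funForm u) (dForm u hu : Form 1) := hu.2.2.choose_spec.2
  have := hd.add huF (locallyIntegrableOn_smul (-1 : ℝ) huF) (dForm u hu).2.1.1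
    (locallyIntegrableOn_smul (-1 : ℝ) α.2.1.1) (h.smul (-1))
  have e1 : funForm u + (-1 : ℝ) • funForm u = 0 := by
    rw [neg_smul, one_smul, add_neg_cancel]
  have e2 : (dForm u hu : Form 1) + (-1 : ℝ) • (α : Form 1) = dForm u hu - α := by
    rw [neg_smul, one_smul, sub_eq_add_neg]
  rwa [e1, e2] at this

/-! ### Functions smooth up to the sphere minus `η`. -/

section SmoothAway

/-- Functions that are smooth near the closed ball deprived of `η`. -/
def SmoothAway (η : C2) (f : C2 → ℝ) : Prop :=
  ∀ z, ‖z‖ ≤ 1 → z ≠ η → ContDiffAt ℝ (⊤ : ℕ∞) f z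

variable {η : C2}

theorem ne_of_mem_ball (hη : ‖η‖ = 1) {z : C2} (hz : z ∈ ball) : z ≠ η := by
  rintro rfl
  have := mem_ball_iff.1 hz
  linarith

theorem SmoothAway.contDiffAt {f : C2 → ℝ} (hf : SmoothAway η f) (hη : ‖η‖ = 1) {z : C2}
    (hz : z ∈ ball) : ContDiffAt ℝ (⊤ : ℕ∞) f z :=
  hf z (mem_ball_iff.1 hz).le (ne_of_mem_ball hη hz)

theorem SmoothAway.mul {f g : C2 → ℝ} (hf : SmoothAway η f) (hg : SmoothAway η g) :
    SmoothAway η fun z => f z * g z := fun z hz hz' => (hf z hz hz').mul (hg z hz hz')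

theorem SmoothAway.continuousOn {f : C2 → ℝ} (hf : SmoothAway η f) (hη : ‖η‖ = 1) :
    ContinuousOn f ball := fun _ hz => (hf.contDiffAt hη hz).continuousAt.continuousWithinAt

theorem SmoothAway.continuousOn_dfun {f : C2 → ℝ} (hf : SmoothAway η f) (hη : ‖η‖ = 1) :
    ContinuousOn (dfun f) ball := fun z hz => by
  have h1 : ContinuousAt (fderiv ℝ f) z :=
    ((hf.contDiffAt hη hz).fderiv_right (m := 0) (by simp)).continuousAt
  exact ((ContinuousAlternatingMap.ofSubsingletonLIE (𝕜 := ℝ) (E := C2) (F := ℝ)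
    (0 : Fin 1)).continuous.continuousAt.comp h1).continuousWithinAt

theorem locL2_of_continuousOn {F : Type*} [NormedAddCommGroup F] {f : C2 → F}
    (h : ContinuousOn f ball) : LocL2 f := by
  intro K hK hc
  obtain ⟨C, hC⟩ := hc.exists_bound_of_continuousOn (h.mono hK)
  have : IsFiniteMeasure (volume.restrict K) := ⟨by simpa using hc.measure_lt_top⟩
  exact MemLp.of_bound ((h.mono hK).aestronglyMeasurable_of_isCompact hc hc.measurableSet) C
    ((ae_restrict_iff' hc.measurableSet).2 (Eventually.of_forall hC))

/-- The closure of an admissible set is a compact subset of the closed ball that misses `η`. -/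
theorem exists_bound_of_isAway {F : Type*} [NormedAddCommGroup F] {g : C2 → F}
    (hg : ∀ z, ‖z‖ ≤ 1 → z ≠ η → ContinuousAt g z) {W : Set C2} (hW : IsAway η W) :
    ∃ C, 0 ≤ C ∧ ∀ z ∈ W, ‖g z‖ ≤ C := by
  have hcl : closure W ⊆ Metric.closedBall 0 1 :=
    closure_minimal (hW.2.1.trans Metric.ball_subset_closedBall) Metric.isClosed_closedBall
  have hc : IsCompact (closure W) :=
    (isCompact_closedBall (0 : C2) 1).of_isClosed_subset isClosed_closure hcl
  obtain ⟨C, hC⟩ := hc.exists_bound_of_continuousOn (f := g) fun z hz =>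
    (hg z (by simpa using hcl hz) (by rintro rfl; exact hW.2.2 hz)).continuousWithinAt
  exact ⟨max C 0, le_max_right _ _, fun z hz => (hC z (subset_closure hz)).trans (le_max_left _ _)⟩

theorem inFrame_one_apply (ω : Form 1) (z : C2) (v : Fin 1 → C2) :
    inFrame ω z v = ω z ![bergmanFrame z (v 0)] := by
  simp only [inFrame, ContinuousAlternatingMap.compContinuousLinearMap_apply]
  congr 1
  ext i; fin_cases i; rfl

theorem norm_inFrame_one_le {ω : Form 1} {z : C2} {C : ℝ} (hC : 0 ≤ C)
    (h : ∀ a, |ω z ![bergmanFrame z a]| ≤ C * ‖a‖) : ‖inFrame ω z‖ ≤ C := by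
  refine ContinuousAlternatingMap.opNorm_le_bound _ hC fun v => ?_
  rw [inFrame_one_apply]
  simpa using h (v 0)

theorem continuousOn_inFrame {ω : Form 1} (h : ContinuousOn ω ball) :
    ContinuousOn (inFrame ω) ball := by
  have h1 : Continuous fun z => ContinuousAlternatingMap.compContinuousLinearMapCLM (𝕜 := ℝ)
      (F := ℝ) (ι := Fin 1) (bergmanFrame z) :=
    ContinuousAlternatingMap.continuous_compContinuousLinearMapCLM.comp continuous_bergmanFrame
  exact h1.continuousOn.clm_apply h

/-- A continuous `1`-form whose norm is `O((1 - |z|²)ˢ)` away from `η` is in `L^p` away from `η` as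
soon as `s p > 2`. -/
theorem mem_LpLoc_of_bound {ω : Form 1} {s p : ℝ} (hp : 0 < p) (hsp : 2 < s * p)
    (hc : ContinuousOn ω ball)
    (hb : ∀ W, IsAway η W → ∃ C, ∀ z ∈ W, ‖inFrame ω z‖ ≤ C * rho z ^ s) :
    ω ∈ LpLoc 1 (ENNReal.ofReal p) η := by
  refine ⟨(locL2_of_continuousOn hc).locallyIntegrableOn, fun W hW => ?_⟩
  obtain ⟨C, hC⟩ := hb W hW
  refine MemLp.of_le_mul (c := C) ((memLp_rho_rpow hp hsp).restrict W)
    (((continuousOn_inFrame hc).mono hW.2.1).aestronglyMeasurable hW.1.measurableSet) ?_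
  refine (ae_restrict_iff' hW.1.measurableSet).2 (Eventually.of_forall fun z hz => ?_)
  rw [Real.norm_of_nonneg (Real.rpow_nonneg (rho_pos (hW.2.1 hz)).le _)]
  exact hC z hz

/-- The frame contracts every vector by at least ρ^(1/2), so the Bergman norm is O(ρ^(1/2)) and the
threshold s q > 2 becomes q > 4. -/
theorem SmoothAway.dfun_mem_LpLoc {f : C2 → ℝ} (hf : SmoothAway η f) (hη : ‖η‖ = 1) {q : ℝ}
    (hq : 4 < q) : dfun f ∈ LpLoc 1 (ENNReal.ofReal q) η := by
  refine mem_LpLoc_of_bound (s := 1 / 2) (by linarith) (by linarith) (hf.continuousOn_dfun hη)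
    fun W hW => ?_
  obtain ⟨C, hC0, hC⟩ := exists_bound_of_isAway (g := fderiv ℝ f) (fun z hz hz' =>
    ((hf z hz hz').fderiv_right (m := 0) (by simp)).continuousAt) hW
  refine ⟨C, fun z hz => ?_⟩
  rw [← Real.sqrt_eq_rpow]
  refine norm_inFrame_one_le (by positivity) fun a => ?_
  rw [dfun_apply]
  calc |fderiv ℝ f z (bergmanFrame z a)| ≤ ‖fderiv ℝ f z‖ * ‖bergmanFrame z a‖ :=
        (fderiv ℝ f z).le_opNorm _
    _ ≤ C * (Real.sqrt (rho z) * ‖a‖) :=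
        mul_le_mul (hC z hz) (norm_bergmanFrame_le (hW.2.1 hz) a) (norm_nonneg _) hC0
    _ = _ := by ring

theorem SmoothAway.hasWeakExtDeriv {f : C2 → ℝ} (hf : SmoothAway η f) (hη : ‖η‖ = 1) :
    HasWeakExtDeriv (funForm f) (dfun f) :=
  hasWeakExtDeriv_dfun fun _ hz => hf.contDiffAt hη hz

theorem SmoothAway.locL2 {f : C2 → ℝ} (hf : SmoothAway η f) (hη : ‖η‖ = 1) : LocL2 f :=
  locL2_of_continuousOn (hf.continuousOn hη)

theorem SmoothAway.locL2_dfun {f : C2 → ℝ} (hf : SmoothAway η f) (hη : ‖η‖ = 1) :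
    LocL2 (dfun f) :=
  locL2_of_continuousOn (hf.continuousOn_dfun hη)

theorem SmoothAway.dfun_closed {f : C2 → ℝ} (hf : SmoothAway η f) (hη : ‖η‖ = 1) :
    HasWeakExtDeriv (dfun f) 0 :=
  (hf.hasWeakExtDeriv hη).closed (hf.locL2 hη).locallyIntegrableOn

theorem SmoothAway.mem_Royden {f : C2 → ℝ} (hf : SmoothAway η f) (hη : ‖η‖ = 1) {q : ℝ}
    (hq : 4 < q) : f ∈ Royden (ENNReal.ofReal q) η := by
  refine ⟨(hf.locL2 hη).locallyIntegrableOn, fun W hW => ?_, dfun f, hf.dfun_mem_LpLoc hη hq,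
    hf.hasWeakExtDeriv hη⟩
  obtain ⟨C, -, hC⟩ := exists_bound_of_isAway (g := f) (fun z hz hz' =>
    (hf z hz hz').continuousAt) hW
  exact ⟨C, hC⟩

theorem SmoothAway.smul_dfun {f g : C2 → ℝ} (hf : SmoothAway η f) (hg : SmoothAway η g)
    (hη : ‖η‖ = 1) :
    HasWeakExtDeriv (fun z => f z • dfun g z : Form 1) (wedge (dfun f) (dfun g)) :=
  (hf.hasWeakExtDeriv hη).mul_closed (hf.locL2 hη) (hf.locL2_dfun hη) (hg.locL2_dfun hη)
    (hg.dfun_closed hη)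

end SmoothAway

/-! ### Heisenberg and Siegel coordinates, and the contact form. -/

section Heisenberg

/-- The coordinate `⟨z, η⟩`. -/
def w1 (η : C2) : C2 →L[ℂ] ℂ := innerSL ℂ η

/-- The coordinate on the orthogonal of `η`. -/
def w2 (η : C2) : C2 →L[ℂ] ℂ :=
  η 0 • EuclideanSpace.proj (1 : Fin 2) - η 1 • EuclideanSpace.proj (0 : Fin 2)

theorem w1_apply (η z : C2) : w1 η z = inner ℂ η z := rfl

theorem w2_apply (η z : C2) : w2 η z = η 0 * z 1 - η 1 * z 0 := by simp [w2]

theorem inner_C2 (z a : C2) :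
    inner ℂ z a = starRingEnd ℂ (z 0) * a 0 + starRingEnd ℂ (z 1) * a 1 := by
  simp [PiLp.inner_apply, Fin.sum_univ_two, mul_comm]

theorem w1_apply' (η z : C2) :
    w1 η z = starRingEnd ℂ (η 0) * z 0 + starRingEnd ℂ (η 1) * z 1 := by
  rw [w1_apply, inner_C2]

theorem unit_eq {η : C2} (hη : ‖η‖ = 1) :
    starRingEnd ℂ (η 0) * η 0 + starRingEnd ℂ (η 1) * η 1 = 1 := by
  rw [← inner_C2, inner_self_eq_norm_sq_to_K, hη]
  simp

/-- For unit `η` the pair (`w1 η`, `w2 η`) is a system of unitary coordinates, so identities may be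
checked as if `η` were the first basis vector. -/
theorem conj_w_mul_w {η : C2} (hη : ‖η‖ = 1) (z a : C2) :
    starRingEnd ℂ (w1 η z) * w1 η a + starRingEnd ℂ (w2 η z) * w2 η a = inner ℂ z a := by
  rw [inner_C2, w1_apply', w1_apply', w2_apply, w2_apply]
  simp only [map_add, map_sub, map_mul, Complex.conj_conj]
  linear_combination (starRingEnd ℂ (z 0) * a 0 + starRingEnd ℂ (z 1) * a 1) * unit_eq hη

theorem rho_eq {η : C2} (hη : ‖η‖ = 1) (z : C2) :
    (rho z : ℂ) = 1 - (starRingEnd ℂ (w1 η z) * w1 η z + starRingEnd ℂ (w2 η z) * w2 η z) := by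
  rw [conj_w_mul_w hη, inner_self_eq_norm_sq_to_K, rho]
  push_cast
  rfl

/-- Equality case of Cauchy–Schwarz: ⟨z, η⟩ = 1 in the closed ball forces |η - z|² ≤ 0. So the
coordinates are singular only at `η`. -/
theorem one_sub_w1_ne_zero {η : C2} (hη : ‖η‖ = 1) {z : C2} (hz : ‖z‖ ≤ 1) (hne : z ≠ η) :
    1 - w1 η z ≠ 0 := by
  intro h
  have h1 : inner ℂ η z = 1 := (sub_eq_zero.1 h).symm
  have h2 : ‖η - z‖ ^ 2 = ‖η‖ ^ 2 - 2 * RCLike.re (inner ℂ η z : ℂ) + ‖z‖ ^ 2 :=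
    @norm_sub_sq ℂ _ _ _ _ η z
  rw [h1, hη] at h2
  rw [RCLike.one_re] at h2
  have h3 : ‖η - z‖ ^ 2 ≤ 0 := by nlinarith [norm_nonneg z]
  have h4 : ‖η - z‖ = 0 := by nlinarith [norm_nonneg (η - z), sq_nonneg ‖η - z‖]
  exact hne (sub_eq_zero.1 (norm_eq_zero.1 h4)).symm

/-- The Siegel coordinate. -/
def siegel (η z : C2) : ℂ := (1 + w1 η z) / (1 - w1 η z)

/-- The differential of the Heisenberg coordinate. -/
def dHeis (η z a : C2) : ℂ :=
  w2 η a / (1 - w1 η z) + w2 η z * w1 η a / (1 - w1 η z) ^ 2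

/-- The differential of the Siegel coordinate. -/
def dSiegel (η z a : C2) : ℂ := 2 * w1 η a / (1 - w1 η z) ^ 2

theorem heisenberg_eq (η z : C2) : heisenberg η z = w2 η z / (1 - w1 η z) := by
  rw [heisenberg, w2_apply, w1_apply]

theorem contDiffAt_heisenberg {η z : C2} (h : 1 - w1 η z ≠ 0) :
    ContDiffAt ℝ (⊤ : ℕ∞) (heisenberg η) z := by
  have h1 : ContDiffAt ℝ (⊤ : ℕ∞) (fun z => 1 - w1 η z) z :=
    contDiffAt_const.sub ((w1 η).restrictScalars ℝ).contDiff.contDiffAt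
  have h2 : ContDiffAt ℝ (⊤ : ℕ∞) (fun z => w2 η z) z :=
    ((w2 η).restrictScalars ℝ).contDiff.contDiffAt
  simp only [funext (heisenberg_eq η), div_eq_mul_inv]
  exact h2.mul (h1.inv h)

theorem contDiffAt_siegel {η z : C2} (h : 1 - w1 η z ≠ 0) :
    ContDiffAt ℝ (⊤ : ℕ∞) (siegel η) z := by
  have h2 : ContDiffAt ℝ (⊤ : ℕ∞) (fun z => w1 η z) z :=
    ((w1 η).restrictScalars ℝ).contDiff.contDiffAt
  have h1 : ContDiffAt ℝ (⊤ : ℕ∞) (fun z => 1 - w1 η z) z := contDiffAt_const.sub h2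
  unfold siegel
  simp only [div_eq_mul_inv]
  exact (contDiffAt_const.add h2).mul (h1.inv h)

theorem hasFDerivAt_inv_one_sub {η z : C2} (h : 1 - w1 η z ≠ 0) :
    HasFDerivAt (𝕜 := ℂ) (fun z => (1 - w1 η z)⁻¹)
      ((-((1 - w1 η z) ^ 2)⁻¹) • (-(w1 η))) z :=
  (hasDerivAt_inv h).comp_hasFDerivAt z ((w1 η).hasFDerivAt.const_sub 1)

theorem fderiv_heisenberg {η z : C2} (h : 1 - w1 η z ≠ 0) (a : C2) :
    fderiv ℝ (heisenberg η) z a = dHeis η z a := by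
  have h1 := ((w2 η).hasFDerivAt (x := z)).mul (hasFDerivAt_inv_one_sub h)
  have h2 : HasFDerivAt (heisenberg η) _ z :=
    (h1.restrictScalars ℝ).congr_of_eventuallyEq
      (Eventually.of_forall fun y => by rw [heisenberg_eq]; rfl)
  rw [h2.fderiv]
  simp [dHeis]
  field_simp
  ring

theorem fderiv_siegel {η z : C2} (h : 1 - w1 η z ≠ 0) (a : C2) :
    fderiv ℝ (siegel η) z a = dSiegel η z a := by
  have h1 := ((w1 η).hasFDerivAt (x := z) |>.const_add 1).mul (hasFDerivAt_inv_one_sub h)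
  have h2 : HasFDerivAt (siegel η) _ z :=
    (h1.restrictScalars ℝ).congr_of_eventuallyEq (Eventually.of_forall fun y => rfl)
  rw [h2.fderiv]
  simp [dSiegel]
  field_simp
  ring

theorem fderiv_re {f : C2 → ℂ} {z : C2} (h : DifferentiableAt ℝ f z) (a : C2) :
    fderiv ℝ (fun y => (f y).re) z a = (fderiv ℝ f z a).re := by
  have := (Complex.reCLM.hasFDerivAt (x := f z)).comp z h.hasFDerivAt
  exact congrArg (fun L => L a) this.fderiv

theorem fderiv_im {f : C2 → ℂ} {z : C2} (h : DifferentiableAt ℝ f z) (a : C2) :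
    fderiv ℝ (fun y => (f y).im) z a = (fderiv ℝ f z a).im := by
  have := (Complex.imCLM.hasFDerivAt (x := f z)).comp z h.hasFDerivAt
  exact congrArg (fun L => L a) this.fderiv

/-- The function `u`, with boundary value `x`. -/
def uH (η z : C2) : ℝ := (heisenberg η z).re

/-- The function `v`, with boundary value `y`. -/
def vH (η z : C2) : ℝ := (heisenberg η z).im

/-- The imaginary part of the Siegel coordinate, the central coordinate of the Heisenberg group. -/
def tH (η z : C2) : ℝ := (siegel η z).im

variable {η : C2}

theorem smoothAway_uH (hη : ‖η‖ = 1) : SmoothAway η (uH η) := fun _ hz hne =>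
  Complex.reCLM.contDiff.contDiffAt.comp _ (contDiffAt_heisenberg (one_sub_w1_ne_zero hη hz hne))

theorem smoothAway_vH (hη : ‖η‖ = 1) : SmoothAway η (vH η) := fun _ hz hne =>
  Complex.imCLM.contDiff.contDiffAt.comp _ (contDiffAt_heisenberg (one_sub_w1_ne_zero hη hz hne))

theorem smoothAway_tH (hη : ‖η‖ = 1) : SmoothAway η (tH η) := fun _ hz hne =>
  Complex.imCLM.contDiff.contDiffAt.comp _ (contDiffAt_siegel (one_sub_w1_ne_zero hη hz hne))

theorem fderiv_uH {z : C2} (h : 1 - w1 η z ≠ 0) (a : C2) :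
    fderiv ℝ (uH η) z a = (dHeis η z a).re := by
  rw [← fderiv_heisenberg h, ← fderiv_re ((contDiffAt_heisenberg h).differentiableAt (by simp))]
  rfl

theorem fderiv_vH {z : C2} (h : 1 - w1 η z ≠ 0) (a : C2) :
    fderiv ℝ (vH η) z a = (dHeis η z a).im := by
  rw [← fderiv_heisenberg h, ← fderiv_im ((contDiffAt_heisenberg h).differentiableAt (by simp))]
  rfl

theorem fderiv_tH {z : C2} (h : 1 - w1 η z ≠ 0) (a : C2) :
    fderiv ℝ (tH η) z a = (dSiegel η z a).im := by
  rw [← fderiv_siegel h, ← fderiv_im ((contDiffAt_siegel h).differentiableAt (by simp))]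
  rfl

/-- A contact form: `dt / 2 - (u dv - v du)`. -/
def contact (η : C2) : Form 1 :=
  (1 / 2 : ℝ) • dfun (tH η) + ((-1 : ℝ) • (fun z => uH η z • dfun (vH η) z : Form 1) +
    (fun z => vH η z • dfun (uH η) z : Form 1))

theorem contact_apply (η z a : C2) : contact η z ![a] =
    1 / 2 * fderiv ℝ (tH η) z a - uH η z * fderiv ℝ (vH η) z a +
      vH η z * fderiv ℝ (uH η) z a := by
  simp [contact]
  ring

/-- The contact form is the imaginary part of `∂((1 - |z|²) / |1 - ⟨z, η⟩|²)`. -/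
theorem contact_eq (hη : ‖η‖ = 1) {z : C2} (h : 1 - w1 η z ≠ 0) (a : C2) :
    contact η z ![a] = (-(inner ℂ z a) / ((1 - w1 η z) * (1 - starRingEnd ℂ (w1 η z))) +
      rho z * w1 η a / ((1 - w1 η z) ^ 2 * (1 - starRingEnd ℂ (w1 η z)))).im := by
  have h' : 1 - starRingEnd ℂ (w1 η z) ≠ 0 := by
    intro h0
    apply h
    have := congrArg (starRingEnd ℂ) h0
    simpa using this
  -- Before taking imaginary parts, the form is half the differential of the Siegel coordinate minus
  -- conj(h) dh, with h the Heisenberg coordinate.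
  have e : -(inner ℂ z a) / ((1 - w1 η z) * (1 - starRingEnd ℂ (w1 η z))) +
      rho z * w1 η a / ((1 - w1 η z) ^ 2 * (1 - starRingEnd ℂ (w1 η z))) =
      dSiegel η z a / 2 - starRingEnd ℂ (heisenberg η z) * dHeis η z a := by
    rw [rho_eq hη, ← conj_w_mul_w hη, dSiegel, dHeis, heisenberg_eq, map_div₀, map_sub, map_one]
    field_simp
    ring
  rw [e, contact_apply, fderiv_uH h, fderiv_vH h, fderiv_tH h]
  have e2 : (dSiegel η z a / 2).im = 1 / 2 * (dSiegel η z a).im := by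
    rw [show dSiegel η z a / 2 = ((1 / 2 : ℝ) : ℂ) * dSiegel η z a by push_cast; ring,
      Complex.im_ofReal_mul]
  rw [Complex.sub_im, e2, Complex.mul_im, Complex.conj_re, Complex.conj_im, uH, vH]
  ring

/-- In `contact_eq` one term carries `rho z` explicitly and the other contains the Hermitian product
with `z`, which the frame multiplies by `rho z`. Hence O(ρ) instead of the O(ρ^(1/2)) of a general
smooth form. -/
theorem norm_inFrame_contact_le (hη : ‖η‖ = 1) {z : C2} (hz : z ∈ ball) :
    ‖inFrame (contact η) z‖ ≤ (‖(1 - w1 η z)⁻¹‖ ^ 2 + ‖(1 - w1 η z)⁻¹‖ ^ 3) * rho z := by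
  have hρ := rho_pos hz
  have h := one_sub_w1_ne_zero hη (mem_ball_iff.1 hz).le (ne_of_mem_ball hη hz)
  refine norm_inFrame_one_le (by positivity) fun a => ?_
  rw [contact_eq hη h, inner_bergmanFrame hz]
  refine (Complex.abs_im_le_norm _).trans ((norm_add_le _ _).trans ?_)
  have hc : ‖1 - starRingEnd ℂ (w1 η z)‖ = ‖1 - w1 η z‖ := by
    rw [← Complex.norm_conj (1 - w1 η z), map_sub, map_one]
  have hz1 := (mem_ball_iff.1 hz).le
  have i1 : ‖inner ℂ z a‖ ≤ ‖a‖ :=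
    (norm_inner_le_norm z a).trans (mul_le_of_le_one_left (norm_nonneg _) hz1)
  have i2 : ‖w1 η (bergmanFrame z a)‖ ≤ ‖a‖ := by
    rw [w1_apply]
    refine (norm_inner_le_norm _ _).trans ?_
    rw [hη, one_mul]
    refine (norm_bergmanFrame_le hz a).trans (mul_le_of_le_one_left (norm_nonneg _) ?_)
    exact Real.sqrt_le_one.2 (rho_le_one z)
  rw [norm_div, norm_div, norm_neg, norm_mul, norm_mul, norm_mul, norm_mul, norm_pow, hc,
    Complex.norm_real, Real.norm_of_nonneg hρ.le, norm_inv]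
  have hn : 0 < ‖1 - w1 η z‖ := norm_pos_iff.2 h
  have j1 : rho z * ‖inner ℂ z a‖ / (‖1 - w1 η z‖ * ‖1 - w1 η z‖) ≤
      rho z * ‖a‖ / (‖1 - w1 η z‖ * ‖1 - w1 η z‖) := by gcongr
  have j2 : rho z * ‖w1 η (bergmanFrame z a)‖ / (‖1 - w1 η z‖ ^ 2 * ‖1 - w1 η z‖) ≤
      rho z * ‖a‖ / (‖1 - w1 η z‖ ^ 2 * ‖1 - w1 η z‖) := by gcongr
  refine (add_le_add j1 j2).trans (le_of_eq ?_)
  field_simp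

theorem continuousOn_contact (hη : ‖η‖ = 1) : ContinuousOn (contact η) ball :=
  (((smoothAway_tH hη).continuousOn_dfun hη).const_smul (1 / 2 : ℝ)).add
    (((((smoothAway_uH hη).continuousOn hη).smul
      ((smoothAway_vH hη).continuousOn_dfun hη)).const_smul (-1 : ℝ)).add
      (((smoothAway_vH hη).continuousOn hη).smul ((smoothAway_uH hη).continuousOn_dfun hη)))

/-- The decay exponent is s = 1, so p > 2 suffices. This puts the primitives used below in L^p. -/
theorem smul_contact_mem_LpLoc (hη : ‖η‖ = 1) {f : C2 → ℝ} (hf : SmoothAway η f) {p : ℝ}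
    (hp : 2 < p) : (fun z => f z • contact η z : Form 1) ∈ LpLoc 1 (ENNReal.ofReal p) η := by
  refine mem_LpLoc_of_bound (s := 1) (by linarith) (by linarith)
    ((hf.continuousOn hη).smul (continuousOn_contact hη)) fun W hW => ?_
  obtain ⟨C, hC0, hC⟩ := exists_bound_of_isAway (η := η)
    (g := fun z => f z * (‖(1 - w1 η z)⁻¹‖ ^ 2 + ‖(1 - w1 η z)⁻¹‖ ^ 3)) (fun z hz hne => by
      have h1 : ContinuousAt (fun z => (1 - w1 η z)⁻¹) z :=
        ContinuousAt.inv₀ (by fun_prop) (one_sub_w1_ne_zero hη hz hne)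
      exact (hf z hz hne).continuousAt.mul ((h1.norm.pow 2).add (h1.norm.pow 3))) hW
  refine ⟨C, fun z hz => ?_⟩
  rw [inFrame_smul_fun, Real.rpow_one]
  simp only [norm_smul]
  have h1 := norm_inFrame_contact_le hη (hW.2.1 hz)
  have h2 := hC z hz
  rw [norm_mul, Real.norm_of_nonneg (by positivity : (0 : ℝ) ≤
    ‖(1 - w1 η z)⁻¹‖ ^ 2 + ‖(1 - w1 η z)⁻¹‖ ^ 3)] at h2
  calc ‖f z‖ * ‖inFrame (contact η) z‖ ≤
      ‖f z‖ * ((‖(1 - w1 η z)⁻¹‖ ^ 2 + ‖(1 - w1 η z)⁻¹‖ ^ 3) * rho z) := by gcongr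
    _ ≤ C * rho z := by
      rw [← mul_assoc]
      exact mul_le_mul_of_nonneg_right h2 (rho_pos (hW.2.1 hz)).le

theorem ContinuousOn.locallyIntegrableOn_form {k : ℕ} {ω : Form k} (h : ContinuousOn ω ball) :
    LocallyIntegrableOn ω ball :=
  (locL2_of_continuousOn h).locallyIntegrableOn

theorem continuousOn_wedge {α β : Form 1} (hα : ContinuousOn α ball) (hβ : ContinuousOn β ball) :
    ContinuousOn (wedge α β) ball := by
  rw [show wedge α β = fun z => wedgePt (α z) (β z) from funext (wedge_eq α β)]
  exact continuous_wedgePt.comp_continuousOn (hα.prodMk hβ)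

/-- The differential of the contact form is `-2 du ∧ dv`. -/
theorem hasWeakExtDeriv_contact (hη : ‖η‖ = 1) :
    HasWeakExtDeriv (contact η) ((-2 : ℝ) • wedge (dfun (uH η)) (dfun (vH η))) := by
  have su := smoothAway_uH hη
  have sv := smoothAway_vH hη
  have st := smoothAway_tH hη
  have cu := su.continuousOn hη
  have cv := sv.continuousOn hη
  have cdu := su.continuousOn_dfun hη
  have cdv := sv.continuousOn_dfun hη
  have d1 := (st.dfun_closed hη).smul (1 / 2 : ℝ)
  have d2 := (su.smul_dfun sv hη).smul (-1 : ℝ)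
  have d3 := sv.smul_dfun su hη
  have c2 := ContinuousOn.locallyIntegrableOn_form ((cu.smul cdv).const_smul (-1 : ℝ))
  have c3 := ContinuousOn.locallyIntegrableOn_form (cv.smul cdu)
  have e2 := ContinuousOn.locallyIntegrableOn_form ((continuousOn_wedge cdu cdv).const_smul (-1 : ℝ))
  have e3 := ContinuousOn.locallyIntegrableOn_form (continuousOn_wedge cdv cdu)
  have d4 := d2.add c2 c3 e2 e3 d3
  have d5 := d1.add (locallyIntegrableOn_smul (1 / 2 : ℝ) (st.locL2_dfun hη).locallyIntegrableOn)
    (locallyIntegrableOn_add c2 c3) (by rw [smul_zero]; exact locallyIntegrableOn_zero_form)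
    (locallyIntegrableOn_add e2 e3) d4
  have e : (1 / 2 : ℝ) • (0 : Form 2) + ((-1 : ℝ) • wedge (dfun (uH η)) (dfun (vH η)) +
      wedge (dfun (vH η)) (dfun (uH η))) = (-2 : ℝ) • wedge (dfun (uH η)) (dfun (vH η)) := by
    rw [wedge_swap (dfun (vH η)), smul_zero, zero_add, ← add_smul]
    norm_num
  rwa [e] at d5

/-- Up to an exact form, `d(u²) ∧ dv` is `- du ∧ contact`. -/
theorem hasWeakExtDeriv_smul_contact (hη : ‖η‖ = 1) :
    HasWeakExtDeriv (fun z => uH η z • contact η z : Form 1)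
      (wedge (dfun (uH η)) (contact η) +
        (-1 : ℝ) • wedge (dfun fun z => uH η z ^ 2) (dfun (vH η))) := by
  have su := smoothAway_uH hη
  have sv := smoothAway_vH hη
  have st := smoothAway_tH hη
  have su2 : SmoothAway η fun z => uH η z * uH η z := su.mul su
  have suv : SmoothAway η fun z => uH η z * vH η z := su.mul sv
  have cdu := su.continuousOn_dfun hη
  have cdv := sv.continuousOn_dfun hη
  have cdt := st.continuousOn_dfun hη
  -- Expand uθ = (u/2) dt - u² dv + uv du and apply the Leibniz rule to each term. The pointwise
  -- comparison gives d(uθ) = du∧θ - d(u²)∧dv.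
  have d1 := (su.smul_dfun st hη).smul (1 / 2 : ℝ)
  have d2 := (su2.smul_dfun sv hη).smul (-1 : ℝ)
  have d3 := suv.smul_dfun su hη
  have c1 := ContinuousOn.locallyIntegrableOn_form
    (((su.continuousOn hη).smul cdt).const_smul (1 / 2 : ℝ))
  have c2 := ContinuousOn.locallyIntegrableOn_form
    (((su2.continuousOn hη).smul cdv).const_smul (-1 : ℝ))
  have c3 := ContinuousOn.locallyIntegrableOn_form ((suv.continuousOn hη).smul cdu)
  have e1 := ContinuousOn.locallyIntegrableOn_form
    ((continuousOn_wedge cdu cdt).const_smul (1 / 2 : ℝ))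
  have e2 := ContinuousOn.locallyIntegrableOn_form
    ((continuousOn_wedge (su2.continuousOn_dfun hη) cdv).const_smul (-1 : ℝ))
  have e3 := ContinuousOn.locallyIntegrableOn_form
    (continuousOn_wedge (suv.continuousOn_dfun hη) cdu)
  have d := d1.add c1 (locallyIntegrableOn_add c2 c3) e1 (locallyIntegrableOn_add e2 e3)
    (d2.add c2 c3 e2 e3 d3)
  refine d.congr (fun z hz => ?_) fun z hz => ?_
  · ext x
    simp only [contact, Pi.add_apply, Pi.smul_apply, Pi.smul_apply', ContinuousAlternatingMap.add_apply,
      ContinuousAlternatingMap.smul_apply, smul_eq_mul, smul_add]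
    ring
  · ext x
    have hu := (su.contDiffAt hη hz).differentiableAt (by simp)
    have hv := (sv.contDiffAt hη hz).differentiableAt (by simp)
    have huv : fderiv ℝ (fun z => uH η z * vH η z) z =
        uH η z • fderiv ℝ (vH η) z + vH η z • fderiv ℝ (uH η) z := fderiv_fun_mul hu hv
    rw [eq_pair x]
    simp only [Pi.add_apply, Pi.smul_apply, ContinuousAlternatingMap.add_apply,
      ContinuousAlternatingMap.smul_apply, smul_eq_mul, wedge_apply, dfun_apply, contact_apply,
      huv, pow_two, _root_.add_apply, _root_.smul_apply]
    ring

end Heisenberg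

/-! ### Testing a weak derivative against linear vector fields. -/

section LinearFields

/-- A covector as a linear form. -/
def covec (a : C2 [⋀^Fin 1]→L[ℝ] ℝ) : C2 →L[ℝ] ℝ :=
  (ContinuousAlternatingMap.ofSubsingleton ℝ C2 ℝ (0 : Fin 1)).symm a

theorem covec_apply (a : C2 [⋀^Fin 1]→L[ℝ] ℝ) (v : C2) : covec a v = a ![v] := by
  have : (fun _ : Fin 1 => v) = ![v] := by ext i; fin_cases i; rfl
  rw [← this]
  rfl

theorem two_form_sum {ι : Type*} [Fintype ι] (ω : C2 [⋀^Fin 2]→L[ℝ] ℝ) (x y : ι → ℝ)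
    (b : ι → C2) : ω ![∑ i, x i • b i, ∑ j, y j • b j] =
      ∑ i, ∑ j, x i * y j * ω ![b i, b j] := by
  have hl : ∀ w v, ω ![v, w] = ω.toContinuousLinearMap ![0, w] 0 v := by
    intro w v
    simp only [ContinuousAlternatingMap.toContinuousLinearMap_apply]
    congr 1
    ext i; fin_cases i <;> simp
  have hr : ∀ v w, ω ![v, w] = ω.toContinuousLinearMap ![v, 0] 1 w := by
    intro w v
    simp only [ContinuousAlternatingMap.toContinuousLinearMap_apply]
    congr 1
    ext i; fin_cases i <;> simp
  rw [hl, map_sum]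
  refine Finset.sum_congr rfl fun i _ => ?_
  rw [map_smul, ← hl, hr, map_sum, smul_eq_mul, Finset.mul_sum]
  refine Finset.sum_congr rfl fun j _ => ?_
  rw [map_smul, ← hr, smul_eq_mul]
  ring

/-- A basis of `ℂ²` over `ℝ`. -/
def realBasis : Module.Basis (Fin (Module.finrank ℝ C2)) ℝ C2 := Module.finBasis ℝ C2

/-- The coordinates of a linear vector field. -/
def fieldCoord (Y : C2 →L[ℝ] C2) (i : Fin (Module.finrank ℝ C2)) : C2 →L[ℝ] ℝ :=
  (LinearMap.toContinuousLinearMap (realBasis.coord i)).comp Y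

theorem fieldCoord_apply (Y : C2 →L[ℝ] C2) (i : Fin (Module.finrank ℝ C2)) (z : C2) :
    fieldCoord Y i z = realBasis.repr (Y z) i := rfl

theorem sum_fieldCoord (Y : C2 →L[ℝ] C2) (z : C2) :
    ∑ i, fieldCoord Y i z • realBasis i = Y z := by
  simp only [fieldCoord_apply]
  exact realBasis.sum_repr (Y z)

theorem sum_fieldCoord_basis (Y : C2 →L[ℝ] C2) :
    ∑ i, fieldCoord Y i (realBasis i) = LinearMap.trace ℝ C2 Y := by
  rw [LinearMap.trace_eq_matrix_trace ℝ realBasis, Matrix.trace]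
  refine Finset.sum_congr rfl fun i _ => ?_
  rw [Matrix.diag_apply, LinearMap.toMatrix_apply]
  rfl

theorem clm_sum_fieldCoord (ℓ : C2 →L[ℝ] ℝ) (Y : C2 →L[ℝ] C2) (z : C2) :
    ℓ (Y z) = ∑ i, fieldCoord Y i z * ℓ (realBasis i) := by
  conv_lhs => rw [← sum_fieldCoord Y z, map_sum]
  simp

variable {φ : C2 → ℝ}

/-- This is the product rule for Σ ∂ᵢ(φ Yⁱ Zʲ) ℓⱼ. The missing term is φ (div Y) ℓ(Z), and the
divergence of a linear field is its trace. -/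
theorem sum_fderiv_test (hφ : Differentiable ℝ φ) {Y Z : C2 →L[ℝ] C2}
    (hY : LinearMap.trace ℝ C2 Y = 0) (ℓ : C2 →L[ℝ] ℝ) (z : C2) :
    ∑ i, ∑ j, fderiv ℝ (fun y => φ y * (fieldCoord Y i y * fieldCoord Z j y)) z (realBasis i) *
      ℓ (realBasis j) = fderiv ℝ φ z (Y z) * ℓ (Z z) + φ z * ℓ (Z (Y z)) := by
  have hd : ∀ i j, fderiv ℝ (fun y => φ y * (fieldCoord Y i y * fieldCoord Z j y)) z
      (realBasis i) = fderiv ℝ φ z (realBasis i) * fieldCoord Y i z * fieldCoord Z j z +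
        φ z * (fieldCoord Y i (realBasis i) * fieldCoord Z j z +
          fieldCoord Y i z * fieldCoord Z j (realBasis i)) := by
    intro i j
    have h1 := ((fieldCoord Y i).hasFDerivAt (x := z)).fun_mul ((fieldCoord Z j).hasFDerivAt (x := z))
    rw [((hφ z).hasFDerivAt.fun_mul h1).fderiv]
    simp only [_root_.add_apply, _root_.smul_apply, smul_eq_mul]
    ring
  have e1 := clm_sum_fieldCoord ℓ Z z
  have e2 := clm_sum_fieldCoord (fderiv ℝ φ z) Y z
  have e3 : ℓ (Z (Y z)) = ∑ i, ∑ j, fieldCoord Y i z * (fieldCoord Z j (realBasis i) *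
      ℓ (realBasis j)) := by
    rw [show ℓ (Z (Y z)) = (ℓ.comp Z) (Y z) from rfl, clm_sum_fieldCoord]
    refine Finset.sum_congr rfl fun i _ => ?_
    rw [← Finset.mul_sum, ← clm_sum_fieldCoord]
    rfl
  have e4 := sum_fieldCoord_basis Y
  rw [hY] at e4
  have e5 : ∑ i, ∑ j, φ z * (fieldCoord Y i (realBasis i) * fieldCoord Z j z * ℓ (realBasis j)) =
      0 := by
    have : ∀ i, ∑ j, φ z * (fieldCoord Y i (realBasis i) * fieldCoord Z j z * ℓ (realBasis j)) =
        fieldCoord Y i (realBasis i) * (φ z * ℓ (Z z)) := by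
      intro i
      rw [e1, Finset.mul_sum, Finset.mul_sum]
      exact Finset.sum_congr rfl fun j _ => by ring
    simp only [this]
    rw [← Finset.sum_mul, e4, zero_mul]
  have e6 : fderiv ℝ φ z (Y z) * ℓ (Z z) = ∑ i, ∑ j,
      fderiv ℝ φ z (realBasis i) * fieldCoord Y i z * (fieldCoord Z j z * ℓ (realBasis j)) := by
    rw [e1, e2, Finset.sum_mul_sum]
    exact Finset.sum_congr rfl fun i _ => Finset.sum_congr rfl fun j _ => by ring
  rw [← add_zero (fderiv ℝ φ z (Y z) * ℓ (Z z)), ← e5, e6, e3, Finset.mul_sum,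
    ← Finset.sum_add_distrib, ← Finset.sum_add_distrib]
  refine Finset.sum_congr rfl fun i _ => ?_
  rw [Finset.mul_sum, ← Finset.sum_add_distrib, ← Finset.sum_add_distrib]
  refine Finset.sum_congr rfl fun j _ => ?_
  rw [hd]
  ring

theorem integrableOn_test_fields {ω : Form 2} (hω : LocallyIntegrableOn ω ball)
    (hφ : Continuous φ) (hc : HasCompactSupport φ) (hs : tsupport φ ⊆ ball)
    (Y Z : C2 →L[ℝ] C2) : IntegrableOn (fun z => φ z * ω z ![Y z, Z z]) ball := by
  have h : ∀ z, φ z * ω z ![Y z, Z z] = ∑ i, ∑ j,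
      (φ z * (fieldCoord Y i z * fieldCoord Z j z)) * ω z ![realBasis i, realBasis j] := by
    intro z
    rw [← sum_fieldCoord Y z, ← sum_fieldCoord Z z, two_form_sum, Finset.mul_sum]
    refine Finset.sum_congr rfl fun i _ => ?_
    rw [Finset.mul_sum]
    exact Finset.sum_congr rfl fun j _ => by
      ring
  simp only [h]
  exact integrable_finsetSum _ fun i _ => integrable_finsetSum _ fun j _ =>
    integrableOn_test hω (hφ.mul ((fieldCoord Y i).continuous.mul (fieldCoord Z j).continuous))
      hc.mul_right ((tsupport_mul_subset_left).trans hs) _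

theorem integrableOn_test_field {ψ : Form 1} (hψ : LocallyIntegrableOn ψ ball)
    (hφ : Continuous φ) (hc : HasCompactSupport φ) (hs : tsupport φ ⊆ ball)
    (Y : C2 →L[ℝ] C2) : IntegrableOn (fun z => φ z * ψ z ![Y z]) ball := by
  have h : ∀ z, φ z * ψ z ![Y z] = ∑ i, (φ z * fieldCoord Y i z) * ψ z ![realBasis i] := by
    intro z
    rw [← covec_apply, clm_sum_fieldCoord, Finset.mul_sum]
    exact Finset.sum_congr rfl fun j _ => by
      rw [covec_apply]
      ring
  simp only [h]
  exact integrable_finsetSum _ fun i _ =>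
    integrableOn_test hψ (hφ.mul (fieldCoord Y i).continuous)
      hc.mul_right ((tsupport_mul_subset_left).trans hs) _

/-- The weak derivative of a `1`-form tested against two linear vector fields of trace zero. -/
theorem HasWeakExtDeriv.integral_fields {ψ : Form 1} {ω : Form 2}
    (hψ : LocallyIntegrableOn ψ ball) (hω : LocallyIntegrableOn ω ball) (h : HasWeakExtDeriv ψ ω)
    {Y Z : C2 →L[ℝ] C2} (hY : LinearMap.trace ℝ C2 Y = 0) (hZ : LinearMap.trace ℝ C2 Z = 0)
    (hφ : ContDiff ℝ (⊤ : ℕ∞) φ) (hc : HasCompactSupport φ) (hs : tsupport φ ⊆ ball) :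
    ∫ z in ball, φ z * ω z ![Y z, Z z] = -∫ z in ball, (fderiv ℝ φ z (Y z) * ψ z ![Z z] -
      fderiv ℝ φ z (Z z) * ψ z ![Y z] + φ z * (ψ z ![Z (Y z)] - ψ z ![Y (Z z)])) := by
  rw [hasWeakExtDeriv_one_iff] at h
  -- Constant vectors suffice in the definition once the coordinates of `Y` and `Z` are absorbed in
  -- the test functions. The outcome is Cartan's formula integrated by parts, where Z(Yz) - Y(Zz) is
  -- the bracket [Y, Z].
  set τ : Fin (Module.finrank ℝ C2) → Fin (Module.finrank ℝ C2) → C2 → ℝ := fun i j y =>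
    φ y * (fieldCoord Y i y * fieldCoord Z j y) with hτ
  have hτd : ∀ i j, ContDiff ℝ (⊤ : ℕ∞) (τ i j) := fun i j =>
    hφ.mul ((fieldCoord Y i).contDiff.mul (fieldCoord Z j).contDiff)
  have hτc : ∀ i j, HasCompactSupport (τ i j) := fun i j => hc.mul_right
  have hτs : ∀ i j, tsupport (τ i j) ⊆ ball := fun i j => (tsupport_mul_subset_left).trans hs
  have e1 : ∀ z, φ z * ω z ![Y z, Z z] = ∑ i, ∑ j, τ i j z * ω z ![realBasis i, realBasis j] := by
    intro z
    rw [← sum_fieldCoord Y z, ← sum_fieldCoord Z z, two_form_sum, Finset.mul_sum]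
    refine Finset.sum_congr rfl fun i _ => ?_
    rw [Finset.mul_sum]
    exact Finset.sum_congr rfl fun j _ => by
      simp only [hτ]
      ring
  have e2 : ∀ z, fderiv ℝ φ z (Y z) * ψ z ![Z z] -
      fderiv ℝ φ z (Z z) * ψ z ![Y z] + φ z * (ψ z ![Z (Y z)] - ψ z ![Y (Z z)]) =
      ∑ i, ∑ j, (fderiv ℝ (τ i j) z (realBasis i) * ψ z ![realBasis j] -
        fderiv ℝ (τ i j) z (realBasis j) * ψ z ![realBasis i]) := by
    intro z
    have a1 := sum_fderiv_test (hφ.differentiable (by simp)) (Z := Z) hY (covec (ψ z)) z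
    have a2 := sum_fderiv_test (hφ.differentiable (by simp)) (Z := Y) hZ (covec (ψ z)) z
    simp only [covec_apply] at a1 a2
    simp only [Finset.sum_sub_distrib]
    rw [a1, Finset.sum_comm (f := fun i j => fderiv ℝ (τ i j) z (realBasis j) * _)]
    have a3 : ∀ i j, τ j i = fun y => φ y * (fieldCoord Z i y * fieldCoord Y j y) := by
      intro i j
      funext y
      simp only [hτ]
      ring
    simp only [a3]
    rw [a2]
    ring
  have hI : ∀ i j k l, IntegrableOn (fun z => fderiv ℝ (τ i j) z (realBasis k) *
      ψ z ![realBasis l]) ball := fun i j k l =>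
    integrableOn_test_fderiv hψ (hτd i j) (hτc i j) (hτs i j) _ _
  simp only [e1, e2]
  rw [integral_finsetSum, integral_finsetSum, ← Finset.sum_neg_distrib]
  · refine Finset.sum_congr rfl fun i _ => ?_
    rw [integral_finsetSum, integral_finsetSum, ← Finset.sum_neg_distrib]
    · refine Finset.sum_congr rfl fun j _ => ?_
      rw [integral_sub (hI i j i j) (hI i j j i)]
      exact h (τ i j) (hτd i j) (hτc i j) (hτs i j) _ _
    · exact fun j _ => (hI i j i j).sub (hI i j j i)
    · exact fun j _ => integrableOn_test hω (hτd i j).continuous (hτc i j) (hτs i j) _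
  · exact fun i _ => integrable_finsetSum _ fun j _ => (hI i j i j).sub (hI i j j i)
  · exact fun i _ => integrable_finsetSum _ fun j _ =>
      integrableOn_test hω (hτd i j).continuous (hτc i j) (hτs i j) _

/-- Anticommutation and Q² = -1 give QPQ = P, while cyclicity gives tr(QPQ) = tr(PQ²) = -tr P. -/
theorem trace_eq_zero_of_anticomm {P Q : C2 →L[ℝ] C2} (hQ : ∀ z, Q (Q z) = -z)
    (h : ∀ z, Q (P z) = -P (Q z)) : LinearMap.trace ℝ C2 P = 0 := by
  have h1 := LinearMap.trace_mul_comm ℝ (Q : C2 →ₗ[ℝ] C2) ((P : C2 →ₗ[ℝ] C2) * Q)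
  have e1 : (Q : C2 →ₗ[ℝ] C2) * ((P : C2 →ₗ[ℝ] C2) * Q) = P := by
    ext1 z
    change Q (P (Q z)) = P z
    rw [h, hQ, map_neg, neg_neg]
  have e2 : (P : C2 →ₗ[ℝ] C2) * Q * Q = -(P : C2 →ₗ[ℝ] C2) := by
    ext1 z
    change P (Q (Q z)) = -P z
    rw [hQ, map_neg]
  rw [e1, e2, map_neg] at h1
  linarith

end LinearFields

/-! ### The frame T, J, K of the spheres. -/

section Quaternions

/-- Multiplication by `i`. -/
def fT : C2 →L[ℝ] C2 := (Complex.I • ContinuousLinearMap.id ℂ C2).restrictScalars ℝ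

/-- The horizontal field `(z₁, z₂) ↦ (-conj z₂, conj z₁)`. -/
def fJ : C2 →L[ℝ] C2 :=
  LinearMap.toContinuousLinearMap
    { toFun := fun z => !₂[-starRingEnd ℂ (z 1), starRingEnd ℂ (z 0)]
      map_add' := fun x y => by ext i; fin_cases i <;> simp [add_comm]
      map_smul' := fun c x => by ext i; fin_cases i <;> simp }

/-- The horizontal field `i J`. -/
def fK : C2 →L[ℝ] C2 := fT.comp fJ

theorem fT_apply (z : C2) : fT z = Complex.I • z := rfl

theorem fJ_zero (z : C2) : fJ z 0 = -starRingEnd ℂ (z 1) := rfl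

theorem fJ_one (z : C2) : fJ z 1 = starRingEnd ℂ (z 0) := rfl

theorem fK_apply (z : C2) : fK z = Complex.I • fJ z := rfl

theorem C2_ext {z w : C2} (h0 : z 0 = w 0) (h1 : z 1 = w 1) : z = w := by
  ext i; fin_cases i
  · exact h0
  · exact h1

theorem fT_fT (z : C2) : fT (fT z) = -z := by
  rw [fT_apply, fT_apply, smul_smul, Complex.I_mul_I, neg_smul, one_smul]

theorem fJ_fJ (z : C2) : fJ (fJ z) = -z := by
  refine C2_ext ?_ ?_ <;> simp [fJ_zero, fJ_one]

theorem fJ_fT (z : C2) : fJ (fT z) = -fT (fJ z) := by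
  refine C2_ext ?_ ?_ <;> simp [fT_apply, fJ_zero, fJ_one]

theorem fT_fJ (z : C2) : fT (fJ z) = fK z := rfl

theorem fK_fT (z : C2) : fK (fT z) = fJ z := by
  rw [← fT_fJ, fJ_fT, map_neg, fT_fT, neg_neg]

theorem fT_fK (z : C2) : fT (fK z) = -fJ z := by rw [← fT_fJ, fT_fT]

theorem fK_fJ (z : C2) : fK (fJ z) = -fT z := by rw [← fT_fJ, fJ_fJ, map_neg]

theorem fJ_fK (z : C2) : fJ (fK z) = fT z := by
  rw [← fT_fJ, fJ_fT, fJ_fJ, map_neg, neg_neg]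

theorem trace_fT : LinearMap.trace ℝ C2 fT = 0 :=
  trace_eq_zero_of_anticomm fJ_fJ fJ_fT

theorem trace_fJ : LinearMap.trace ℝ C2 fJ = 0 :=
  trace_eq_zero_of_anticomm fT_fT fun z => by rw [fJ_fT, neg_neg]

theorem trace_fK : LinearMap.trace ℝ C2 fK = 0 :=
  trace_eq_zero_of_anticomm fT_fT fun z => by rw [fT_fK, fK_fT]

theorem inner_fJ (z : C2) : inner ℂ z (fJ z) = 0 := by
  rw [inner_C2, fJ_zero, fJ_one]
  ring

theorem inner_fK (z : C2) : inner ℂ z (fK z) = 0 := by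
  rw [fK_apply, inner_smul_right, inner_fJ, mul_zero]

theorem norm_fJ (z : C2) : ‖fJ z‖ = ‖z‖ := by
  rw [EuclideanSpace.norm_eq, EuclideanSpace.norm_eq, Fin.sum_univ_two, Fin.sum_univ_two, fJ_zero,
    fJ_one, norm_neg, Complex.norm_conj, Complex.norm_conj, add_comm]

theorem norm_fK (z : C2) : ‖fK z‖ = ‖z‖ := by
  rw [fK_apply, norm_smul, Complex.norm_I, one_mul, norm_fJ]

theorem w2_fJ (η z : C2) : w2 η (fJ z) = starRingEnd ℂ (w1 η z) := by
  rw [w1_apply', w2_apply, fJ_zero, fJ_one]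
  simp

theorem fderiv_rho (z a : C2) : fderiv ℝ rho z a = -2 * (inner ℂ z a : ℂ).re := by
  have h1 : HasFDerivAt rho (-(2 • innerSL ℝ z)) z :=
    (hasStrictFDerivAt_norm_sq z).hasFDerivAt.const_sub 1
  have h2 : (inner ℝ z a : ℝ) = (inner ℂ z a : ℂ).re := by
    simp [PiLp.inner_apply, Fin.sum_univ_two, Complex.inner, mul_comm]
  rw [h1.fderiv]
  simp [h2]

end Quaternions

/-! ### Integrating against a bivector field with horizontal divergence. -/

section QuaternionTest

theorem one_form_neg (a : C2 [⋀^Fin 1]→L[ℝ] ℝ) (v : C2) : a ![-v] = -a ![v] := by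
  rw [← covec_apply, map_neg, covec_apply]

theorem integrableOn_fields_aux {φ : C2 → ℝ} {ψ : Form 1} (hψ : LocallyIntegrableOn ψ ball)
    (hφ : ContDiff ℝ (⊤ : ℕ∞) φ) (hc : HasCompactSupport φ) (hs : tsupport φ ⊆ ball)
    (Y Z : C2 →L[ℝ] C2) :
    IntegrableOn (fun z => fderiv ℝ φ z (Y z) * ψ z ![Z z] - fderiv ℝ φ z (Z z) * ψ z ![Y z] +
      φ z * (ψ z ![Z (Y z)] - ψ z ![Y (Z z)])) ball := by
  have hd : ∀ X : C2 →L[ℝ] C2, Continuous fun z => fderiv ℝ φ z (X z) := fun X =>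
    (hφ.continuous_fderiv (by simp)).clm_apply X.continuous
  have hsub : ∀ X : C2 →L[ℝ] C2, tsupport (fun z => fderiv ℝ φ z (X z)) ⊆ tsupport φ := fun X =>
    closure_minimal (fun z hz => support_fderiv_subset ℝ (f := φ) (fun h0 => hz (by simp [h0])))
      isClosed_closure
  have hdc : ∀ X : C2 →L[ℝ] C2, HasCompactSupport fun z => fderiv ℝ φ z (X z) := fun X =>
    hc.of_isClosed_subset isClosed_closure (hsub X)
  have i1 : ∀ X X' : C2 →L[ℝ] C2,
      IntegrableOn (fun z => fderiv ℝ φ z (X z) * ψ z ![X' z]) ball := fun X X' =>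
    integrableOn_test_field hψ (hd X) (hdc X) ((hsub X).trans hs) X'
  have i2 : ∀ X X' : C2 →L[ℝ] C2, IntegrableOn (fun z => φ z * ψ z ![X (X' z)]) ball :=
    fun X X' => integrableOn_test_field hψ hφ.continuous hc hs (X.comp X')
  refine (((i1 Y Z).sub (i1 Z Y)).add ((i2 Z Y).sub (i2 Y Z))).congr
    (Eventually.of_forall fun z => ?_)
  simp only [Pi.add_apply, Pi.sub_apply]
  ring

variable {ψ : Form 1} {ω : Form 2} {c f₁ f₂ : C2 → ℝ}

/-- The coefficient of the bivector `J ∧ K` for which the divergence of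
`f₁ T ∧ J + f₂ T ∧ K + f₃ J ∧ K` is horizontal. -/
def coeffJK (f₁ f₂ : C2 → ℝ) (z : C2) : ℝ :=
  -(1 / 2) * (fderiv ℝ f₁ z (fJ z) + fderiv ℝ f₂ z (fK z))

/-- The `J` component of the divergence of the bivector field. -/
def divJ (f₁ f₂ : C2 → ℝ) (z : C2) : ℝ :=
  fderiv ℝ f₁ z (fT z) + 2 * f₂ z - fderiv ℝ (coeffJK f₁ f₂) z (fK z)

/-- The `K` component of the divergence of the bivector field. -/
def divK (f₁ f₂ : C2 → ℝ) (z : C2) : ℝ :=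
  fderiv ℝ f₂ z (fT z) - 2 * f₁ z + fderiv ℝ (coeffJK f₁ f₂) z (fJ z)

theorem contDiff_fderiv_field {f : C2 → ℝ} (hf : ContDiff ℝ (⊤ : ℕ∞) f) (Y : C2 →L[ℝ] C2) :
    ContDiff ℝ (⊤ : ℕ∞) fun z => fderiv ℝ f z (Y z) :=
  (hf.fderiv_right (m := (⊤ : ℕ∞)) (by simp)).clm_apply Y.contDiff

theorem contDiff_coeffJK (h₁ : ContDiff ℝ (⊤ : ℕ∞) f₁) (h₂ : ContDiff ℝ (⊤ : ℕ∞) f₂) :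
    ContDiff ℝ (⊤ : ℕ∞) (coeffJK f₁ f₂) :=
  contDiff_const.mul ((contDiff_fderiv_field h₁ fJ).add (contDiff_fderiv_field h₂ fK))

theorem continuous_divJ (h₁ : ContDiff ℝ (⊤ : ℕ∞) f₁) (h₂ : ContDiff ℝ (⊤ : ℕ∞) f₂) :
    Continuous (divJ f₁ f₂) :=
  (((contDiff_fderiv_field h₁ fT).add (contDiff_const.mul h₂)).sub
    (contDiff_fderiv_field (contDiff_coeffJK h₁ h₂) fK)).continuous

theorem continuous_divK (h₁ : ContDiff ℝ (⊤ : ℕ∞) f₁) (h₂ : ContDiff ℝ (⊤ : ℕ∞) f₂) :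
    Continuous (divK f₁ f₂) :=
  (((contDiff_fderiv_field h₂ fT).sub (contDiff_const.mul h₁)).add
    (contDiff_fderiv_field (contDiff_coeffJK h₁ h₂) fJ)).continuous

/-- Apply the integrated Cartan formula to the three bivectors, with [T, J] = -2K, [T, K] = 2J, [J,
K] = -2T. The total coefficient of ψ(T) is -(J f₁ + K f₂ + 2 f₃), which vanishes for f₃ = `coeffJK
f₁ f₂`. Removing ψ(T) matters because it is the worst controlled component, of size ρ⁻¹|ψ| against
ρ^(-1/2)|ψ| for the horizontal ones. The cutoff `c` is constant along T, J and K, hence is never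
differentiated. -/
theorem HasWeakExtDeriv.integral_quaternion (hψ : LocallyIntegrableOn ψ ball)
    (hω : LocallyIntegrableOn ω ball) (h : HasWeakExtDeriv ψ ω)
    (hc : ContDiff ℝ (⊤ : ℕ∞) c) (hcc : HasCompactSupport c) (hcs : tsupport c ⊆ ball)
    (hcT : ∀ z, fderiv ℝ c z (fT z) = 0) (hcJ : ∀ z, fderiv ℝ c z (fJ z) = 0)
    (hcK : ∀ z, fderiv ℝ c z (fK z) = 0)
    (h₁ : ContDiff ℝ (⊤ : ℕ∞) f₁) (h₂ : ContDiff ℝ (⊤ : ℕ∞) f₂) :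
    IntegrableOn (fun z => c z * (f₁ z * ω z ![fT z, fJ z] + f₂ z * ω z ![fT z, fK z] +
      coeffJK f₁ f₂ z * ω z ![fJ z, fK z] + divJ f₁ f₂ z * ψ z ![fJ z] +
      divK f₁ f₂ z * ψ z ![fK z])) ball ∧
    ∫ z in ball, c z * (f₁ z * ω z ![fT z, fJ z] + f₂ z * ω z ![fT z, fK z] +
      coeffJK f₁ f₂ z * ω z ![fJ z, fK z] + divJ f₁ f₂ z * ψ z ![fJ z] +
      divK f₁ f₂ z * ψ z ![fK z]) = 0 := by
  have h₃ := contDiff_coeffJK h₁ h₂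
  have hder : ∀ {f : C2 → ℝ}, ContDiff ℝ (⊤ : ℕ∞) f → ∀ z v, fderiv ℝ c z v = 0 →
      fderiv ℝ (fun y => c y * f y) z v = c z * fderiv ℝ f z v := by
    intro f hf z v h0
    rw [fderiv_fun_mul ((hc.differentiable (by simp)) z) ((hf.differentiable (by simp)) z)]
    simp [h0]
  have key : ∀ {f : C2 → ℝ}, ContDiff ℝ (⊤ : ℕ∞) f → ∀ {Y Z : C2 →L[ℝ] C2},
      LinearMap.trace ℝ C2 Y = 0 → LinearMap.trace ℝ C2 Z = 0 →
      (IntegrableOn (fun z => (c z * f z) * ω z ![Y z, Z z]) ball ∧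
      IntegrableOn (fun z => fderiv ℝ (fun y => c y * f y) z (Y z) * ψ z ![Z z] -
        fderiv ℝ (fun y => c y * f y) z (Z z) * ψ z ![Y z] +
        (c z * f z) * (ψ z ![Z (Y z)] - ψ z ![Y (Z z)])) ball) ∧
      ∫ z in ball, (c z * f z) * ω z ![Y z, Z z] =
        -∫ z in ball, (fderiv ℝ (fun y => c y * f y) z (Y z) * ψ z ![Z z] -
        fderiv ℝ (fun y => c y * f y) z (Z z) * ψ z ![Y z] +
        (c z * f z) * (ψ z ![Z (Y z)] - ψ z ![Y (Z z)])) := by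
    intro f hf Y Z hY hZ
    have d := hc.mul hf
    have dc : HasCompactSupport fun z => c z * f z := hcc.mul_right
    have ds : tsupport (fun z => c z * f z) ⊆ ball := (tsupport_mul_subset_left).trans hcs
    exact ⟨⟨integrableOn_test_fields hω d.continuous dc ds Y Z,
      integrableOn_fields_aux hψ d dc ds Y Z⟩, h.integral_fields hψ hω hY hZ d dc ds⟩
  obtain ⟨⟨a1, b1⟩, e1⟩ := key h₁ trace_fT trace_fJ
  obtain ⟨⟨a2, b2⟩, e2⟩ := key h₂ trace_fT trace_fK
  obtain ⟨⟨a3, b3⟩, e3⟩ := key h₃ trace_fJ trace_fK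
  have i1 := a1.add b1
  have i2 := a2.add b2
  have i3 := a3.add b3
  have t : ∀ z, c z * (f₁ z * ω z ![fT z, fJ z] + f₂ z * ω z ![fT z, fK z] +
      coeffJK f₁ f₂ z * ω z ![fJ z, fK z] + divJ f₁ f₂ z * ψ z ![fJ z] +
      divK f₁ f₂ z * ψ z ![fK z]) =
      ((c z * f₁ z) * ω z ![fT z, fJ z] +
        (fderiv ℝ (fun y => c y * f₁ y) z (fT z) * ψ z ![fJ z] -
        fderiv ℝ (fun y => c y * f₁ y) z (fJ z) * ψ z ![fT z] +
        (c z * f₁ z) * (ψ z ![fJ (fT z)] - ψ z ![fT (fJ z)]))) +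
      ((c z * f₂ z) * ω z ![fT z, fK z] +
        (fderiv ℝ (fun y => c y * f₂ y) z (fT z) * ψ z ![fK z] -
        fderiv ℝ (fun y => c y * f₂ y) z (fK z) * ψ z ![fT z] +
        (c z * f₂ z) * (ψ z ![fK (fT z)] - ψ z ![fT (fK z)]))) +
      ((c z * coeffJK f₁ f₂ z) * ω z ![fJ z, fK z] +
        (fderiv ℝ (fun y => c y * coeffJK f₁ f₂ y) z (fJ z) * ψ z ![fK z] -
        fderiv ℝ (fun y => c y * coeffJK f₁ f₂ y) z (fK z) * ψ z ![fJ z] +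
        (c z * coeffJK f₁ f₂ z) * (ψ z ![fK (fJ z)] - ψ z ![fJ (fK z)]))) := by
    intro z
    rw [hder h₁ z _ (hcT z), hder h₁ z _ (hcJ z), hder h₂ z _ (hcT z), hder h₂ z _ (hcK z),
      hder h₃ z _ (hcJ z), hder h₃ z _ (hcK z), fJ_fT, fT_fJ, fK_fT, fT_fK, fK_fJ, fJ_fK,
      one_form_neg, one_form_neg, one_form_neg]
    have e : coeffJK f₁ f₂ z = -(1 / 2) * (fderiv ℝ f₁ z (fJ z) + fderiv ℝ f₂ z (fK z)) := rfl
    rw [divJ, divK]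
    linear_combination (2 * c z * ψ z ![fT z]) * e
  refine ⟨((i1.add i2).add i3).congr (Eventually.of_forall fun z => (t z).symm), ?_⟩
  rw [integral_congr_ae (Eventually.of_forall t)]
  refine (integral_add (i1.add i2) i3).trans ?_
  rw [integral_add' i1 i2, integral_add' a1 b1, integral_add' a2 b2,
    integral_add' a3 b3, e1, e2, e3]
  ring

end QuaternionTest

/-! ### Thin shells and radial cutoffs. -/

section Shell

open scoped Pointwise in
/-- The part of the shell `ε ≤ 1 - |z|² ≤ 2 ε` close to a boundary point has volume at least a
multiple of `ε`. -/
theorem exists_le_volume_shell {z₀ : C2} (hz₀ : ‖z₀‖ = 1) {δ : ℝ} (hδ : 0 < δ) :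
    ∃ m > 0, ∃ ε₀ > 0, ∀ ε, 0 < ε → ε < ε₀ →
      m * ε ≤ volume.real {z : C2 | ε ≤ rho z ∧ rho z ≤ 2 * ε ∧ ‖z - z₀‖ ≤ δ} := by
  -- Truncated cone over a spherical cap around `z₀`. It scales with `s`, so its volume is
  -- proportional to s⁴ and the shell volume is a difference of two such volumes.
  let C : ℝ → Set C2 := fun s => {z | z ≠ 0 ∧ ‖z‖ < s ∧ ‖‖z‖⁻¹ • z - z₀‖ < δ / 2}
  have hopen : IsOpen (C 1) := by
    rw [isOpen_iff_mem_nhds]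
    rintro z ⟨h0, h1, h2⟩
    have c1 : ContinuousAt (fun z : C2 => ‖‖z‖⁻¹ • z - z₀‖) z :=
      (((continuousAt_id.norm.inv₀ (norm_ne_zero_iff.2 h0)).smul continuousAt_id).sub
        continuousAt_const).norm
    filter_upwards [isOpen_ne.mem_nhds h0, continuousAt_id.norm.eventually_lt_const h1,
      c1.eventually_lt_const h2] with y a b c using ⟨a, b, c⟩
  have hne : (C 1).Nonempty := by
    refine ⟨(1 / 2 : ℝ) • z₀, ?_, ?_, ?_⟩
    · rw [smul_ne_zero_iff]
      refine ⟨by norm_num, ?_⟩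
      rw [← norm_ne_zero_iff, hz₀]
      norm_num
    · rw [norm_smul, hz₀]; norm_num
    · rw [norm_smul, hz₀, smul_smul]
      norm_num
      exact hδ
  have hfin : ∀ s, volume (C s) ≠ ⊤ := fun s =>
    ((measure_mono (fun z hz => by simpa using hz.2.1 : C s ⊆ Metric.ball 0 s)).trans_lt
      measure_ball_lt_top).ne
  set m := volume.real (C 1) with hm
  have hm0 : 0 < m := ENNReal.toReal_pos (hopen.measure_pos _ hne).ne' (hfin 1)
  have hmeas : ∀ s, 0 < s → C s = s • C 1 := by
    intro s hs
    ext z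
    rw [mem_smul_set_iff_inv_smul_mem₀ hs.ne']
    have h1 : ‖s⁻¹ • z‖ = s⁻¹ * ‖z‖ := by
      rw [norm_smul, Real.norm_of_nonneg (inv_nonneg.2 hs.le)]
    have h2 : ‖s⁻¹ • z‖⁻¹ • s⁻¹ • z = ‖z‖⁻¹ • z := by
      rw [h1, smul_smul]
      congr 1
      field_simp
    change (z ≠ 0 ∧ ‖z‖ < s ∧ ‖‖z‖⁻¹ • z - z₀‖ < δ / 2) ↔
      (s⁻¹ • z ≠ 0 ∧ ‖s⁻¹ • z‖ < 1 ∧ ‖‖s⁻¹ • z‖⁻¹ • s⁻¹ • z - z₀‖ < δ / 2)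
    rw [h2, h1, inv_mul_lt_iff₀ hs, mul_one, smul_ne_zero_iff]
    simp [hs.ne']
  have hvol : ∀ s, 0 < s → volume.real (C s) = s ^ 4 * m := by
    intro s hs
    rw [hmeas s hs, Measure.real, Measure.addHaar_smul, finrank_C2, ENNReal.toReal_mul,
      ENNReal.toReal_ofReal (abs_nonneg _), abs_of_pos (by positivity)]
    rfl
  -- The bound 1/3 ensures (1 - ε)² - (1 - 2ε)² = 2ε - 3ε² ≥ ε. The bound δ/4 keeps the radial
  -- displacement 1 - |z| ≤ 2ε below δ/2.
  refine ⟨m, hm0, min (1 / 3) (δ / 4), by positivity, fun ε hε hlt => ?_⟩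
  have hε1 : ε < 1 / 3 := hlt.trans_le (min_le_left _ _)
  have hε2 : ε < δ / 4 := hlt.trans_le (min_le_right _ _)
  set a := Real.sqrt (1 - 2 * ε) with ha
  set b := Real.sqrt (1 - ε) with hb
  have ha0 : 0 < a := Real.sqrt_pos.2 (by linarith)
  have hb0 : 0 < b := Real.sqrt_pos.2 (by linarith)
  have ha2 : a ^ 2 = 1 - 2 * ε := Real.sq_sqrt (by linarith)
  have hb2 : b ^ 2 = 1 - ε := Real.sq_sqrt (by linarith)
  have hsub : C b \ C a ⊆ {z : C2 | ε ≤ rho z ∧ rho z ≤ 2 * ε ∧ ‖z - z₀‖ ≤ δ} := by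
    rintro z ⟨⟨h0, h1, h2⟩, h3⟩
    have h4 : a ≤ ‖z‖ := by
      by_contra! h
      exact h3 ⟨h0, h, h2⟩
    have hz0 := norm_nonneg z
    have h5 : ‖z‖ ^ 2 ≤ 1 - ε := by nlinarith
    have h6 : 1 - 2 * ε ≤ ‖z‖ ^ 2 := by nlinarith
    refine ⟨by rw [rho]; linarith, by rw [rho]; linarith, ?_⟩
    have h7 : z - ‖z‖⁻¹ • z = (1 - ‖z‖⁻¹) • z := by rw [sub_smul, one_smul]
    have h8 : ‖z - ‖z‖⁻¹ • z‖ = 1 - ‖z‖ := by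
      have hzp : 0 < ‖z‖ := norm_pos_iff.2 h0
      have h9 : ‖z‖ ≤ 1 := by nlinarith
      rw [h7, norm_smul, Real.norm_eq_abs, abs_of_nonpos (by
        have := (one_le_inv₀ hzp).2 h9
        linarith)]
      field_simp
      ring
    have h10 : 1 - ‖z‖ ≤ 2 * ε := by
      by_contra! h
      nlinarith
    calc ‖z - z₀‖ ≤ ‖z - ‖z‖⁻¹ • z‖ + ‖‖z‖⁻¹ • z - z₀‖ := norm_sub_le_norm_sub_add_norm_sub _ _ _
      _ ≤ δ := by linarith
  have hbig : {z : C2 | ε ≤ rho z ∧ rho z ≤ 2 * ε ∧ ‖z - z₀‖ ≤ δ} ⊆ Metric.closedBall z₀ δ :=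
    fun z hz => by simpa [dist_eq_norm] using hz.2.2
  have h1 : volume.real (C b) - volume.real (C a) ≤ volume.real (C b \ C a) :=
    le_measureReal_sdiff (hfin a)
  refine le_trans ?_ (h1.trans (measureReal_mono hsub
    ((measure_mono hbig).trans_lt measure_closedBall_lt_top).ne))
  rw [hvol b hb0, hvol a ha0, show b ^ 4 = (b ^ 2) ^ 2 by ring, show a ^ 4 = (a ^ 2) ^ 2 by ring,
    ha2, hb2]
  nlinarith [mul_nonneg hm0.le (mul_nonneg hε.le (by linarith : 0 ≤ 1 - 3 * ε))]

/-- The cutoff of the shell `ε ≤ 1 - |z|² ≤ 2 ε`. -/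
theorem exists_radial_cutoff {ε : ℝ} (hε : 0 < ε) (hε1 : ε ≤ 1 / 3) :
    ∃ c : C2 → ℝ, ContDiff ℝ (⊤ : ℕ∞) c ∧ HasCompactSupport c ∧ tsupport c ⊆ ball ∧
      (∀ z a, (inner ℂ z a : ℂ).re = 0 → fderiv ℝ c z a = 0) ∧
      (∀ z, 0 ≤ c z ∧ c z ≤ 1) ∧ (∀ z, ε ≤ rho z → rho z ≤ 2 * ε → c z = 1) ∧
      ∀ z, c z ≠ 0 → rho z < 5 / 2 * ε := by
  -- Applied to ρ/ε, this bump is 1 on [1, 2] and is supported in [1/2, 5/2].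
  let χ : ContDiffBump (3 / 2 : ℝ) := ⟨1 / 2, 1, by norm_num, by norm_num⟩
  have hχ : ContDiff ℝ (⊤ : ℕ∞) χ := χ.contDiff
  have hd : ContDiff ℝ (⊤ : ℕ∞) fun z => rho z / ε := contDiff_rho.div_const ε
  have hsupp : tsupport (fun z : C2 => χ (rho z / ε)) ⊆ {z | ε / 2 ≤ rho z} := by
    refine closure_minimal (fun z hz => ?_) (isClosed_le continuous_const continuous_rho)
    have h1 : rho z / ε ∈ Function.support χ := hz
    rw [χ.support_eq, Metric.mem_ball, Real.dist_eq, abs_lt] at h1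
    have h2 : 1 / 2 < rho z / ε := by
      have := h1.1
      change -(1 : ℝ) < _ at this
      linarith
    rw [lt_div_iff₀ hε] at h2
    change ε / 2 ≤ rho z
    linarith
  have hball : {z : C2 | ε / 2 ≤ rho z} ⊆ ball := fun z hz => by
    change ε / 2 ≤ rho z at hz
    rw [rho] at hz
    rw [mem_ball_iff]
    nlinarith [norm_nonneg z]
  refine ⟨fun z => χ (rho z / ε), hχ.comp hd, ?_, hsupp.trans hball, fun z a h => ?_,
    fun z => ⟨χ.nonneg, χ.le_one⟩, fun z h1 h2 => ?_, fun z hz => ?_⟩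
  · refine (isCompact_closedBall (0 : C2) 1).of_isClosed_subset isClosed_closure
      ((hsupp.trans hball).trans Metric.ball_subset_closedBall)
  · have h1 : HasFDerivAt (fun z => rho z / ε) (fderiv ℝ (fun z => rho z / ε) z) z :=
      ((hd.differentiable (by simp)) z).hasFDerivAt
    have h2 := ((hχ.differentiable (by simp)) (rho z / ε)).hasFDerivAt.comp z h1
    have h3 : fderiv ℝ (fun z => rho z / ε) z a = 0 := by
      simp only [div_eq_mul_inv]
      rw [fderiv_mul_const ((contDiff_rho.differentiable (by simp)) z)]
      simp [fderiv_rho, h]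
    change fderiv ℝ (χ ∘ fun z => rho z / ε) z a = 0
    rw [h2.fderiv, ContinuousLinearMap.comp_apply, h3, map_zero]
  · refine χ.one_of_mem_closedBall ?_
    rw [Metric.mem_closedBall, Real.dist_eq, abs_le]
    have h3 : 1 ≤ rho z / ε := by rwa [le_div_iff₀ hε, one_mul]
    have h4 : rho z / ε ≤ 2 := by rwa [div_le_iff₀ hε]
    change -(1 / 2 : ℝ) ≤ _ ∧ _ ≤ (1 / 2 : ℝ)
    constructor <;> linarith
  · have h1 : rho z / ε ∈ Function.support χ := hz
    rw [χ.support_eq, Metric.mem_ball, Real.dist_eq, abs_lt] at h1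
    have h2 : rho z / ε < 5 / 2 := by
      have := h1.2
      change _ < (1 : ℝ) at this
      linarith
    rwa [div_lt_iff₀ hε] at h2

/-- A function that is bounded below near a boundary point, and is at least `-(1 - |z|²) M` for an
integrable `M`, up to this correction, is not orthogonal to the radial cutoffs. -/
theorem false_of_integral_radial_eq_zero {z₀ : C2} (hz₀ : ‖z₀‖ = 1) {δ κ : ℝ} (hδ : 0 < δ)
    (hκ : 0 < κ) {g M : C2 → ℝ} (hM : IntegrableOn M ball) (hM0 : ∀ z, 0 ≤ M z)
    (hg : ∀ z ∈ ball, -(rho z * M z) ≤ g z)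
    (hg' : ∀ z ∈ ball, ‖z - z₀‖ ≤ δ → κ - rho z * M z ≤ g z)
    (h : ∀ c : C2 → ℝ, ContDiff ℝ (⊤ : ℕ∞) c → HasCompactSupport c → tsupport c ⊆ ball →
      (∀ z a, (inner ℂ z a : ℂ).re = 0 → fderiv ℝ c z a = 0) →
      IntegrableOn (fun z => c z * g z) ball ∧ ∫ z in ball, c z * g z = 0) : False := by
  obtain ⟨m, hm, ε₀, hε₀, hvol⟩ := exists_le_volume_shell hz₀ hδ
  let A : ℝ → Set C2 := fun ε => ball ∩ {z | rho z < 5 / 2 * ε}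
  have hA : ∀ ε, MeasurableSet (A ε) := fun ε => isOpen_ball.measurableSet.inter
    (isOpen_lt continuous_rho continuous_const).measurableSet
  -- The main term is at least κ m ε by the volume of the shell, the correction at most (5/2) ε
  -- times the integral of `M` over ρ < 5ε/2. The factor ε cancels.
  have key : ∀ ε, 0 < ε → ε < ε₀ → ε ≤ 1 / 3 → κ * m ≤ 5 / 2 * ∫ z in A ε, M z := by
    intro ε hε hlt hε1
    obtain ⟨c, hc, hcc, hcs, hcr, hc01, hc1, hcA⟩ := exists_radial_cutoff hε hε1
    obtain ⟨hi, h0⟩ := h c hc hcc hcs hcr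
    set S : Set C2 := {z | ε ≤ rho z ∧ rho z ≤ 2 * ε ∧ ‖z - z₀‖ ≤ δ} with hS
    have hSm : MeasurableSet S :=
      ((isClosed_le continuous_const continuous_rho).inter
        ((isClosed_le continuous_rho continuous_const).inter
        (isClosed_le (continuous_id.sub continuous_const).norm continuous_const))).measurableSet
    have hSb : S ⊆ ball := fun z hz => by
      have h1 := hz.1
      rw [rho] at h1
      rw [mem_ball_iff]
      nlinarith [norm_nonneg z]
    have hSfin : volume S ≠ ⊤ := ((measure_mono hSb).trans_lt measure_ball_lt_top).ne
    have i1 : IntegrableOn (S.indicator fun _ => κ) ball :=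
      ((integrable_indicator_iff hSm).2 (integrableOn_const hSfin)).integrableOn
    have i2 : IntegrableOn ((A ε).indicator fun z => 5 / 2 * ε * M z) ball :=
      (hM.const_mul _).indicator (hA ε)
    have hle : ∫ z in ball, (S.indicator (fun _ => κ) z -
        (A ε).indicator (fun z => 5 / 2 * ε * M z) z) ≤ ∫ z in ball, c z * g z := by
      refine setIntegral_mono_on (i1.sub i2) hi isOpen_ball.measurableSet fun z hz => ?_
      have hρ := rho_pos hz
      obtain ⟨c0, c1⟩ := hc01 z
      by_cases hcz : c z = 0
      · have hzS : z ∉ S := fun h' => by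
          have := hc1 z h'.1 h'.2.1
          linarith
        rw [indicator_of_notMem hzS, hcz, zero_mul, zero_sub, neg_nonpos]
        refine indicator_nonneg (fun y _ => ?_) z
        have := hM0 y
        positivity
      · have hzA : z ∈ A ε := ⟨hz, hcA z hcz⟩
        have hlt' : rho z < 5 / 2 * ε := hcA z hcz
        rw [indicator_of_mem hzA]
        have e1 : rho z * M z ≤ 5 / 2 * ε * M z := by
          have := hM0 z
          gcongr
        by_cases hzS : z ∈ S
        · rw [indicator_of_mem hzS, hc1 z hzS.1 hzS.2.1, one_mul]
          have := hg' z hz hzS.2.2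
          linarith
        · rw [indicator_of_notMem hzS]
          have e2 := mul_le_mul_of_nonneg_left (hg z hz) c0
          have e3 : c z * (rho z * M z) ≤ rho z * M z :=
            mul_le_of_le_one_left (mul_nonneg hρ.le (hM0 z)) c1
          linarith
    rw [h0, integral_sub i1 i2, setIntegral_indicator hSm, setIntegral_indicator (hA ε),
      setIntegral_const, inter_eq_self_of_subset_right hSb,
      inter_eq_self_of_subset_right (inter_subset_left : A ε ⊆ ball), integral_const_mul,
      smul_eq_mul] at hle
    have h1 := hvol ε hε hlt
    have h2 := mul_le_mul_of_nonneg_right h1 hκ.le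
    have h3 : ε * (κ * m) ≤ ε * (5 / 2 * ∫ z in A ε, M z) := by linarith
    exact le_of_mul_le_mul_left h3 hε
  set ε₁ := min (ε₀ / 2) (1 / 3) with hε₁
  have hε₁0 : 0 < ε₁ := by positivity
  -- The sets where ρ < 5ε/2 decrease to the empty set inside the open ball, so the integrals of the
  -- integrable `M` over them tend to 0, against the fixed lower bound.
  have hlim : Tendsto (fun n : ℕ => ∫ z in A (ε₁ / (n + 1)), M z) atTop
      (𝓝 (∫ z in ⋂ n : ℕ, A (ε₁ / (n + 1)), M z)) := by
    refine tendsto_setIntegral_of_antitone (fun n => hA _) (fun i j hij z hz => ⟨hz.1, ?_⟩)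
      ⟨0, hM.mono_set inter_subset_left⟩
    have h1 : rho z < 5 / 2 * (ε₁ / (j + 1)) := hz.2
    have h2 : ε₁ / ((j : ℝ) + 1) ≤ ε₁ / (i + 1) := by gcongr
    change rho z < 5 / 2 * (ε₁ / (i + 1))
    linarith
  have hempty : ⋂ n : ℕ, A (ε₁ / (n + 1)) = ∅ := by
    refine eq_empty_of_forall_notMem fun z hz => ?_
    rw [mem_iInter] at hz
    have hρ := rho_pos (hz 0).1
    obtain ⟨n, hn⟩ := exists_nat_gt (5 / 2 * ε₁ / rho z)
    have h1 : rho z < 5 / 2 * (ε₁ / (n + 1)) := (hz n).2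
    rw [div_lt_iff₀ hρ] at hn
    rw [← mul_div_assoc, lt_div_iff₀ (by positivity)] at h1
    nlinarith
  rw [hempty, setIntegral_empty] at hlim
  have hge : ∀ n : ℕ, κ * m * (2 / 5) ≤ ∫ z in A (ε₁ / (n + 1)), M z := by
    intro n
    have h1 : ε₁ / ((n : ℝ) + 1) ≤ ε₁ := div_le_self hε₁0.le (by simp)
    have h2 := key (ε₁ / (n + 1)) (by positivity)
      (h1.trans_lt ((min_le_left _ _).trans_lt (by linarith))) (h1.trans (min_le_right _ _))
    linarith
  have := ge_of_tendsto' hlim hge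
  nlinarith [mul_pos hκ hm]

end Shell

/-! ### Bounds for the terms of the pairing. -/

section Obstruction

variable {η : C2}

/-- Hölder against ρ^(3/2), whose product with the density ρ⁻³ is ρ^(-3/2). The conjugate exponent
must satisfy (3/2) p/(p - 1) > 2, which is p < 4. -/
theorem LpLoc.integrableOn_indicator {ψ : Form 1} {p : ℝ} (hp : 2 < p) (hp' : p < 4)
    (hψ : ψ ∈ LpLoc 1 (ENNReal.ofReal p) η) {W : Set C2} (hW : IsAway η W) :
    IntegrableOn (W.indicator fun z => rho z ^ (-(3 / 2) : ℝ) * ‖inFrame ψ z‖) ball := by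
  have h1 : MemLp (fun z => ‖inFrame ψ z‖) (ENNReal.ofReal p) (bergmanVol.restrict W) :=
    (hψ.2 W hW).norm
  have hpq : p.HolderConjugate (Real.conjExponent p) := .conjExponent (by linarith)
  have h2 : MemLp (fun z => rho z ^ (3 / 2 : ℝ)) (ENNReal.ofReal (Real.conjExponent p))
      (bergmanVol.restrict W) := by
    refine (memLp_rho_rpow hpq.symm.pos ?_).restrict W
    rw [Real.conjExponent, ← mul_div_assoc, lt_div_iff₀ (by linarith)]
    linarith
  have : ENNReal.HolderConjugate (ENNReal.ofReal p) (ENNReal.ofReal (Real.conjExponent p)) :=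
    hpq.ennrealOfReal
  have h3 : IntegrableOn (fun z => rho z ^ (3 / 2 : ℝ) * ‖inFrame ψ z‖) W bergmanVol :=
    (h1.integrable_mul h2).congr (Eventually.of_forall fun z => mul_comm _ _)
  have h4 := integrable_bergmanVol_iff.1 ((integrable_indicator_iff hW.1.measurableSet).2 h3)
  refine h4.congr_fun (fun z hz => ?_) isOpen_ball.measurableSet
  have hρ := rho_pos hz
  by_cases hzW : z ∈ W
  · simp only [indicator_of_mem hzW]
    rw [← mul_assoc]
    congr 1
    rw [show (rho z ^ 3)⁻¹ = rho z ^ (-3 : ℝ) by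
      rw [Real.rpow_neg hρ.le]
      norm_cast, ← Real.rpow_add hρ]
    norm_num
  · simp [indicator_of_notMem hzW]

/-- A horizontal vector is scaled by ρ^(1/2) in the frame, so |ψ(v)| ≤ ρ^(-1/2)|ψ|. The power is
split so as to exhibit the integrable factor ρ^(-3/2)|ψ|. -/
theorem abs_horizontal_le (ψ : Form 1) {z v : C2} (hz : z ∈ ball) (h : inner ℂ z v = 0)
    (hv : ‖v‖ ≤ 1) :
    |ψ z ![v]| ≤ rho z * (rho z ^ (-(3 / 2) : ℝ) * ‖inFrame ψ z‖) := by
  have hρ := rho_pos hz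
  have h1 : inFrame ψ z ![v] = Real.sqrt (rho z) * ψ z ![v] := by
    rw [inFrame_one_apply, ← covec_apply, ← covec_apply]
    simp [bergmanFrame_of_inner_eq_zero h]
  have h2 := abs_one_form_le (inFrame ψ z) v
  rw [h1, abs_mul, abs_of_nonneg (Real.sqrt_nonneg _)] at h2
  have h3 : rho z * rho z ^ (-(3 / 2) : ℝ) * Real.sqrt (rho z) = 1 := by
    nth_rewrite 1 [← Real.rpow_one (rho z)]
    rw [Real.sqrt_eq_rpow, ← Real.rpow_add hρ, ← Real.rpow_add hρ]
    norm_num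
  have h4 : Real.sqrt (rho z) * |ψ z ![v]| ≤ ‖inFrame ψ z‖ :=
    h2.trans (mul_le_of_le_one_right (norm_nonneg _) hv)
  calc |ψ z ![v]| = rho z * rho z ^ (-(3 / 2) : ℝ) * (Real.sqrt (rho z) * |ψ z ![v]|) := by
        rw [← mul_assoc, h3, one_mul]
    _ ≤ rho z * rho z ^ (-(3 / 2) : ℝ) * ‖inFrame ψ z‖ := by
        have := Real.rpow_nonneg hρ.le (-(3 / 2))
        gcongr
    _ = _ := by ring

/-- Near -η the coordinate `w1` is within 1 of -1, so the denominators of the Heisenberg formulas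
are harmless. -/
theorem one_le_norm_one_sub_w1 (hη : ‖η‖ = 1) {z : C2} (hz : ‖z + η‖ < 1) :
    1 < ‖1 - w1 η z‖ := by
  have h1 : w1 η (z + η) = w1 η z + 1 := by
    rw [map_add, w1_apply η η, inner_self_eq_norm_sq_to_K, hη]
    simp
  have h2 : ‖w1 η (z + η)‖ < 1 := by
    rw [w1_apply]
    refine (norm_inner_le_norm _ _).trans_lt ?_
    rwa [hη, one_mul]
  rw [h1] at h2
  have h3 : ‖(2 : ℂ)‖ ≤ ‖1 - w1 η z‖ + ‖w1 η z + 1‖ :=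
    le_of_eq_of_le (by ring_nf) (norm_add_le _ _)
  rw [Complex.norm_ofNat] at h3
  linarith

/-- On a horizontal vector the first term of `contact_eq` vanishes and the other carries the factor
`rho z`. -/
theorem abs_contact_horizontal_le (hη : ‖η‖ = 1) {z v : C2} (hz : z ∈ ball) (hz' : ‖z + η‖ < 1)
    (h : inner ℂ z v = 0) (hv : ‖v‖ ≤ 1) : |contact η z ![v]| ≤ rho z := by
  have hρ := rho_pos hz
  have h1 := one_le_norm_one_sub_w1 hη hz'
  have h0 : 1 - w1 η z ≠ 0 := norm_pos_iff.1 (by linarith)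
  have hc : ‖1 - starRingEnd ℂ (w1 η z)‖ = ‖1 - w1 η z‖ := by
    rw [← Complex.norm_conj (1 - w1 η z), map_sub, map_one]
  rw [contact_eq hη h0, h, neg_zero, zero_div, zero_add]
  refine (Complex.abs_im_le_norm _).trans ?_
  rw [norm_div, norm_mul, norm_mul, norm_pow, hc, Complex.norm_real, Real.norm_of_nonneg hρ.le]
  have h2 : ‖w1 η v‖ ≤ 1 := by
    rw [w1_apply]
    refine (norm_inner_le_norm _ _).trans ?_
    rwa [hη, one_mul]
  have h3 : 1 ≤ ‖1 - w1 η z‖ ^ 2 * ‖1 - w1 η z‖ := by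
    rw [← pow_succ]
    exact one_le_pow₀ h1.le
  refine (div_le_self (by positivity) h3).trans (mul_le_of_le_one_right hρ.le h2)

/-- The value of `du ∧ contact` on the bivector `T ∧ grad u`. -/
def pairing (η z : C2) : ℝ :=
  fderiv ℝ (uH η) z (fJ z) * wedge (dfun (uH η)) (contact η) z ![fT z, fJ z] +
    fderiv ℝ (uH η) z (fK z) * wedge (dfun (uH η)) (contact η) z ![fT z, fK z]

/-- At -η the contact form is -1/4 on T and 0 on J and K, while du is -1/2 on J and 0 on K. The
positive value is, up to the factor 1/4, the square of the horizontal gradient of u. -/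
theorem pairing_neg_self (hη : ‖η‖ = 1) : pairing η (-η) = 1 / 16 := by
  have e1 : w1 η (-η) = -1 := by
    rw [map_neg, w1_apply, inner_self_eq_norm_sq_to_K, hη]
    simp
  have e2 : w2 η (-η) = 0 := by
    rw [map_neg, w2_apply]
    ring
  have e3 : rho (-η) = 0 := by rw [rho, norm_neg, hη]; norm_num
  have h0 : 1 - w1 η (-η) ≠ 0 := by rw [e1]; norm_num
  have e4 : inner ℂ (-η) (-η) = (1 : ℂ) := by
    rw [inner_neg_neg, inner_self_eq_norm_sq_to_K, hη]
    simp
  have c1 : contact η (-η) ![fT (-η)] = -(1 / 4) := by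
    rw [contact_eq hη h0, e1, e3, fT_apply, inner_smul_right, e4]
    simp
    norm_num
  have c2 : contact η (-η) ![fJ (-η)] = 0 := by
    rw [contact_eq hη h0, inner_fJ, e3]
    simp
  have c3 : contact η (-η) ![fK (-η)] = 0 := by
    rw [contact_eq hη h0, inner_fK, e3]
    simp
  have d1 : fderiv ℝ (uH η) (-η) (fJ (-η)) = -(1 / 2) := by
    rw [fderiv_uH h0, dHeis, w2_fJ, e1, e2]
    norm_num
  have d2 : fderiv ℝ (uH η) (-η) (fK (-η)) = 0 := by
    rw [fderiv_uH h0, dHeis, fK_apply, map_smul, w2_fJ, e1, e2]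
    simp
    norm_num
  rw [pairing, wedge_apply, wedge_apply, dfun_apply, dfun_apply, dfun_apply, c1, c2, c3, d1, d2]
  norm_num

theorem SmoothAway.continuousAt_fderiv {f : C2 → ℝ} (hf : SmoothAway η f) {z : C2}
    (hz : ‖z‖ ≤ 1) (hne : z ≠ η) (Y : C2 →L[ℝ] C2) :
    ContinuousAt (fun z => fderiv ℝ f z (Y z)) z :=
  ((hf z hz hne).fderiv_right (m := 0) (by simp)).continuousAt.clm_apply Y.continuous.continuousAt

theorem continuousAt_pairing (hη : ‖η‖ = 1) : ContinuousAt (pairing η) (-η) := by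
  have hz : ‖-η‖ ≤ 1 := by rw [norm_neg, hη]
  have hne : -η ≠ η := by
    intro h
    have h2 : (2 : ℝ) • η = 0 := by
      rw [two_smul]
      nth_rewrite 1 [← h]
      simp
    have h3 : η = 0 := (smul_eq_zero.1 h2).resolve_left two_ne_zero
    simp [h3] at hη
  have su := smoothAway_uH hη
  have sv := smoothAway_vH hη
  have du := fun Y => su.continuousAt_fderiv hz hne Y
  have dv := fun Y => sv.continuousAt_fderiv hz hne Y
  have dt := fun Y => (smoothAway_tH hη).continuousAt_fderiv hz hne Y
  have cu := (su _ hz hne).continuousAt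
  have cv := (sv _ hz hne).continuousAt
  have dc : ∀ Y : C2 →L[ℝ] C2, ContinuousAt (fun z => contact η z ![Y z]) (-η) := by
    intro Y
    simp only [contact_apply]
    exact ((continuousAt_const.mul (dt Y)).sub (cu.mul (dv Y))).add (cv.mul (du Y))
  have dw : ∀ Y Z : C2 →L[ℝ] C2, ContinuousAt
      (fun z => wedge (dfun (uH η)) (contact η) z ![Y z, Z z]) (-η) := by
    intro Y Z
    simp only [wedge_apply, dfun_apply]
    exact ((du Y).mul (dc Z)).sub ((du Z).mul (dc Y))
  exact ((du fJ).mul (dw fT fJ)).add ((du fK).mul (dw fT fK))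

theorem coeffJK_eventuallyEq_zero {f₁ f₂ : C2 → ℝ} {z : C2} (h₁ : f₁ =ᶠ[𝓝 z] 0)
    (h₂ : f₂ =ᶠ[𝓝 z] 0) : coeffJK f₁ f₂ =ᶠ[𝓝 z] 0 := by
  filter_upwards [h₁.fderiv (𝕜 := ℝ), h₂.fderiv (𝕜 := ℝ)] with y e1 e2
  rw [coeffJK, e1, e2]
  simp

theorem divJ_eq_zero {f₁ f₂ : C2 → ℝ} {z : C2} (h₁ : f₁ =ᶠ[𝓝 z] 0) (h₂ : f₂ =ᶠ[𝓝 z] 0) :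
    divJ f₁ f₂ z = 0 := by
  rw [divJ, h₁.fderiv_eq, h₂.eq_of_nhds, (coeffJK_eventuallyEq_zero h₁ h₂).fderiv_eq]
  simp

theorem divK_eq_zero {f₁ f₂ : C2 → ℝ} {z : C2} (h₁ : f₁ =ᶠ[𝓝 z] 0) (h₂ : f₂ =ᶠ[𝓝 z] 0) :
    divK f₁ f₂ z = 0 := by
  rw [divK, h₂.fderiv_eq, h₁.eq_of_nhds, (coeffJK_eventuallyEq_zero h₁ h₂).fderiv_eq]
  simp

end Obstruction

/-! ### Non-exactness of du ∧ contact. -/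

section NotExact

variable {η : C2}

theorem isAway_near_neg (hη : ‖η‖ = 1) : IsAway η (ball ∩ Metric.ball (-η) 1) := by
  refine ⟨isOpen_ball.inter Metric.isOpen_ball, inter_subset_left, fun h => ?_⟩
  have h1 : η ∈ Metric.closedBall (-η) 1 :=
    closure_minimal (inter_subset_right.trans Metric.ball_subset_closedBall)
      Metric.isClosed_closedBall h
  rw [Metric.mem_closedBall, dist_eq_norm, sub_neg_eq_add, ← two_smul ℝ, norm_smul, hη] at h1
  norm_num at h1

/-- The bump is supported away from the singular set of the Heisenberg coordinate, so the product
extends smoothly by zero to the whole space, as the test fields require. -/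
theorem contDiff_bump_mul (hη : ‖η‖ = 1) {b : C2 → ℝ}
    (hb : ContDiff ℝ (⊤ : ℕ∞) b) (hbs : tsupport b ⊆ Metric.closedBall (-η) (1 / 2))
    (Y : C2 →L[ℝ] C2) : ContDiff ℝ (⊤ : ℕ∞) fun z => b z * fderiv ℝ (uH η) z (Y z) := by
  refine contDiff_iff_contDiffAt.2 fun z => ?_
  by_cases hz : z ∈ tsupport b
  · have hz' : ‖z + η‖ < 1 := by
      have := hbs hz
      rw [Metric.mem_closedBall, dist_eq_norm, sub_neg_eq_add] at this
      linarith
    have h1 := one_le_norm_one_sub_w1 hη hz'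
    have h0 : 1 - w1 η z ≠ 0 := norm_pos_iff.1 (by linarith)
    have h2 : ContDiffAt ℝ (⊤ : ℕ∞) (uH η) z :=
      Complex.reCLM.contDiff.contDiffAt.comp z (contDiffAt_heisenberg h0)
    exact hb.contDiffAt.mul ((h2.fderiv_right (m := (⊤ : ℕ∞)) (by simp)).clm_apply
      Y.contDiff.contDiffAt)
  · have h1 : b =ᶠ[𝓝 z] 0 := notMem_tsupport_iff_eventuallyEq.1 hz
    refine (contDiffAt_const (c := (0 : ℝ))).congr_of_eventuallyEq ?_
    filter_upwards [h1] with y hy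
    rw [hy, Pi.zero_apply, zero_mul]

/-- The form `du ∧ contact` is not the differential of a form in `L^p`, `2 < p < 4`. -/
theorem not_hasWeakExtDeriv_wedge_contact (hη : ‖η‖ = 1) {p : ℝ} (hp : 2 < p) (hp' : p < 4)
    {ψ : Form 1} (hψ : ψ ∈ LpLoc 1 (ENNReal.ofReal p) η) :
    ¬HasWeakExtDeriv ψ (wedge (dfun (uH η)) (contact η)) := by
  intro h
  set ω := wedge (dfun (uH η)) (contact η) with hωdef
  have hω : LocallyIntegrableOn ω ball := ContinuousOn.locallyIntegrableOn_form
    (continuousOn_wedge ((smoothAway_uH hη).continuousOn_dfun hη) (continuousOn_contact hη))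
  -- 1/32 is half the value 1/16 of the pairing at -η.
  obtain ⟨δ₀, hδ₀, hpair⟩ : ∃ δ > 0, ∀ z, dist z (-η) < δ → 1 / 32 < pairing η z :=
    Metric.eventually_nhds_iff.1 ((continuousAt_pairing hη).eventually_const_lt
      (by rw [pairing_neg_self hη]; norm_num))
  set δ := min (δ₀ / 2) (1 / 2) with hδ
  have hδ0 : 0 < δ := by positivity
  have hδ1 : δ ≤ 1 / 2 := min_le_right _ _
  have hδ2 : δ < δ₀ := (min_le_left _ _).trans_lt (by linarith)
  let b : ContDiffBump (-η) := ⟨δ / 2, δ, by positivity, by linarith⟩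
  have hbs : tsupport b ⊆ Metric.closedBall (-η) (1 / 2) :=
    b.tsupport_eq.le.trans (Metric.closedBall_subset_closedBall hδ1)
  have hb : ContDiff ℝ (⊤ : ℕ∞) b := b.contDiff
  set f₁ : C2 → ℝ := fun z => b z * fderiv ℝ (uH η) z (fJ z) with hf₁
  set f₂ : C2 → ℝ := fun z => b z * fderiv ℝ (uH η) z (fK z) with hf₂
  have d₁ : ContDiff ℝ (⊤ : ℕ∞) f₁ := contDiff_bump_mul hη hb hbs fJ
  have d₂ : ContDiff ℝ (⊤ : ℕ∞) f₂ := contDiff_bump_mul hη hb hbs fK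
  have hzero : ∀ z ∉ Metric.closedBall (-η) (1 / 2), f₁ =ᶠ[𝓝 z] 0 ∧ f₂ =ᶠ[𝓝 z] 0 := by
    intro z hz
    have h1 : b =ᶠ[𝓝 z] 0 := notMem_tsupport_iff_eventuallyEq.1 fun h => hz (hbs h)
    constructor <;> filter_upwards [h1] with y hy <;> simp [hf₁, hf₂, hy]
  set W := ball ∩ Metric.ball (-η) 1 with hW
  have hWa : IsAway η W := isAway_near_neg hη
  have hcompact : IsCompact (Metric.closedBall (-η) (1 / 2)) := isCompact_closedBall _ _
  have hdu : ∀ Y : C2 →L[ℝ] C2, ContinuousOn (fun z => fderiv ℝ (uH η) z (Y z))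
      (Metric.closedBall (-η) (1 / 2)) := by
    intro Y z hz
    have hz' : ‖z + η‖ < 1 := by
      rw [Metric.mem_closedBall, dist_eq_norm, sub_neg_eq_add] at hz
      linarith
    have h0 : 1 - w1 η z ≠ 0 :=
      norm_pos_iff.1 (zero_lt_one.trans (one_le_norm_one_sub_w1 hη hz'))
    have h2 : ContDiffAt ℝ (⊤ : ℕ∞) (uH η) z :=
      Complex.reCLM.contDiff.contDiffAt.comp z (contDiffAt_heisenberg h0)
    exact ((h2.fderiv_right (m := 0) (by simp)).continuousAt.clm_apply
      Y.continuous.continuousAt).continuousWithinAt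
  obtain ⟨C₁, hC₁⟩ := hcompact.exists_bound_of_continuousOn
    ((contDiff_coeffJK d₁ d₂).continuous.continuousOn.mul (hdu fJ))
  obtain ⟨C₂, hC₂⟩ := hcompact.exists_bound_of_continuousOn
    ((contDiff_coeffJK d₁ d₂).continuous.continuousOn.mul (hdu fK))
  obtain ⟨D₁, hD₁⟩ := hcompact.exists_bound_of_continuousOn (continuous_divJ d₁ d₂).continuousOn
  obtain ⟨D₂, hD₂⟩ := hcompact.exists_bound_of_continuousOn (continuous_divK d₁ d₂).continuousOn
  have hmem : -η ∈ Metric.closedBall (-η) (1 / 2) := Metric.mem_closedBall_self (by norm_num)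
  have hC₁0 := (norm_nonneg _).trans (hC₁ _ hmem)
  have hC₂0 := (norm_nonneg _).trans (hC₂ _ hmem)
  have hD₁0 := (norm_nonneg _).trans (hD₁ _ hmem)
  have hD₂0 := (norm_nonneg _).trans (hD₂ _ hmem)
  -- Every error term will be at most ρ times this integrable majorant: the J∧K term through the
  -- smallness of the contact form, the ψ terms through the weight ρ^(-3/2).
  set N : C2 → ℝ := W.indicator fun z => rho z ^ (-(3 / 2) : ℝ) * ‖inFrame ψ z‖ with hN
  set M : C2 → ℝ := fun z => (C₁ + C₂) + (D₁ + D₂) * N z with hMdef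
  have hN0 : ∀ z, 0 ≤ N z := fun z => indicator_nonneg (fun y hy =>
    mul_nonneg (Real.rpow_nonneg (rho_pos hy.1).le _) (norm_nonneg _)) z
  have hM0 : ∀ z, 0 ≤ M z := fun z =>
    add_nonneg (add_nonneg hC₁0 hC₂0) (mul_nonneg (add_nonneg hD₁0 hD₂0) (hN0 z))
  have hM : IntegrableOn M ball :=
    (integrableOn_const measure_ball_lt_top.ne).add
      ((LpLoc.integrableOn_indicator hp hp' hψ hWa).const_mul _)
  set g : C2 → ℝ := fun z => f₁ z * ω z ![fT z, fJ z] + f₂ z * ω z ![fT z, fK z] +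
      coeffJK f₁ f₂ z * ω z ![fJ z, fK z] + divJ f₁ f₂ z * ψ z ![fJ z] +
      divK f₁ f₂ z * ψ z ![fK z] with hg
  -- Since f₁ and f₂ are b times the horizontal derivatives of u, the T∧J and T∧K terms add up to b
  -- times `pairing`.
  have hgz : ∀ z, g z = b z * pairing η z + (coeffJK f₁ f₂ z * ω z ![fJ z, fK z] +
      divJ f₁ f₂ z * ψ z ![fJ z] + divK f₁ f₂ z * ψ z ![fK z]) := by
    intro z
    simp only [hg, hf₁, hf₂, pairing]
    ring
  have hrem : ∀ z ∈ ball, |coeffJK f₁ f₂ z * ω z ![fJ z, fK z] +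
      divJ f₁ f₂ z * ψ z ![fJ z] + divK f₁ f₂ z * ψ z ![fK z]| ≤ rho z * M z := by
    intro z hz
    have hρ := rho_pos hz
    by_cases hzc : z ∈ Metric.closedBall (-η) (1 / 2)
    · have hz' : ‖z + η‖ < 1 := by
        rw [Metric.mem_closedBall, dist_eq_norm, sub_neg_eq_add] at hzc
        linarith
      have hzW : z ∈ W := ⟨hz, by rwa [Metric.mem_ball, dist_eq_norm, sub_neg_eq_add]⟩
      have hJ : ‖fJ z‖ ≤ 1 := by rw [norm_fJ]; exact (mem_ball_iff.1 hz).le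
      have hK : ‖fK z‖ ≤ 1 := by rw [norm_fK]; exact (mem_ball_iff.1 hz).le
      have t1 := abs_contact_horizontal_le hη hz hz' (inner_fJ z) hJ
      have t2 := abs_contact_horizontal_le hη hz hz' (inner_fK z) hK
      have t3 := abs_horizontal_le ψ hz (inner_fJ z) hJ
      have t4 := abs_horizontal_le ψ hz (inner_fK z) hK
      have eN : N z = rho z ^ (-(3 / 2) : ℝ) * ‖inFrame ψ z‖ := indicator_of_mem hzW _
      rw [← eN] at t3 t4
      have e : coeffJK f₁ f₂ z * ω z ![fJ z, fK z] =
          coeffJK f₁ f₂ z * fderiv ℝ (uH η) z (fJ z) * contact η z ![fK z] -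
          coeffJK f₁ f₂ z * fderiv ℝ (uH η) z (fK z) * contact η z ![fJ z] := by
        rw [hωdef, wedge_apply, dfun_apply, dfun_apply]
        ring
      rw [e]
      have b1 := mul_le_mul (hC₁ z hzc) t2 (abs_nonneg _) hC₁0
      have b2 := mul_le_mul (hC₂ z hzc) t1 (abs_nonneg _) hC₂0
      have b3 := mul_le_mul (hD₁ z hzc) t3 (abs_nonneg _) hD₁0
      have b4 := mul_le_mul (hD₂ z hzc) t4 (abs_nonneg _) hD₂0
      rw [Real.norm_eq_abs, ← abs_mul] at b1 b2 b3 b4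
      refine (abs_add_three _ _ _).trans ?_
      have b5 := abs_sub (coeffJK f₁ f₂ z * fderiv ℝ (uH η) z (fJ z) * contact η z ![fK z])
        (coeffJK f₁ f₂ z * fderiv ℝ (uH η) z (fK z) * contact η z ![fJ z])
      calc _ ≤ (C₁ * rho z + C₂ * rho z) + D₁ * (rho z * N z) + D₂ * (rho z * N z) :=
            add_le_add (add_le_add (b5.trans (add_le_add b1 b2)) b3) b4
        _ = rho z * M z := by
            simp only [hMdef]
            ring
    · obtain ⟨z1, z2⟩ := hzero z hzc
      rw [(coeffJK_eventuallyEq_zero z1 z2).eq_of_nhds, divJ_eq_zero z1 z2, divK_eq_zero z1 z2]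
      simpa using mul_nonneg hρ.le (hM0 z)
  have hbpair : ∀ z, 1 / 32 * b z ≤ b z * pairing η z := by
    intro z
    by_cases hz : dist z (-η) < δ
    · rw [mul_comm]
      exact mul_le_mul_of_nonneg_left (hpair z (hz.trans hδ2)).le b.nonneg
    · rw [b.zero_of_le_dist (not_lt.1 hz)]
      simp
  refine false_of_integral_radial_eq_zero (z₀ := -η) (by rwa [norm_neg]) (half_pos hδ0)
    (by norm_num : (0 : ℝ) < 1 / 32) hM hM0 (g := g) (fun z hz => ?_) (fun z hz hzδ => ?_)
    fun c hc hcc hcs hcr => ?_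
  · have h1 := (abs_le.1 (hrem z hz)).1
    have h2 := hbpair z
    have h3 : 0 ≤ b z := b.nonneg
    rw [hgz]
    linarith
  · have h1 := (abs_le.1 (hrem z hz)).1
    have h2 := hbpair z
    have h3 : b z = 1 := b.one_of_mem_closedBall (by rwa [Metric.mem_closedBall, dist_eq_norm])
    rw [h3] at h2
    rw [hgz, h3]
    linarith
  -- T, J and K are tangent to the spheres: ⟨Tz, z⟩ is imaginary and ⟨Jz, z⟩ = ⟨Kz, z⟩ = 0. So the
  -- radial cutoff is constant along them.
  · have hT : ∀ z, (inner ℂ z (fT z) : ℂ).re = 0 := by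
      intro z
      rw [fT_apply, inner_smul_right, inner_self_eq_norm_sq_to_K]
      change (Complex.I * ((‖z‖ : ℝ) : ℂ) ^ 2).re = 0
      rw [Complex.I_mul_re, ← Complex.ofReal_pow, Complex.ofReal_im, neg_zero]
    exact h.integral_quaternion hψ.1 hω hc hcc hcs (fun z => hcr z _ (hT z))
      (fun z => hcr z _ (by rw [inner_fJ]; rfl)) (fun z => hcr z _ (by rw [inner_fK]; rfl)) d₁ d₂

end NotExact

/-! ### The two cup products. -/

section Main

variable {η : C2}

/-- The differential of a function that is smooth away from `η`, as a closed form. -/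
def SmoothAway.closedForm {f : C2 → ℝ} (hf : SmoothAway η f) (hη : ‖η‖ = 1) {q : ℝ}
    (hq : 4 < q) : closedForms 1 (ENNReal.ofReal q) η :=
  ⟨dfun f, hf.dfun_mem_LpLoc hη hq, hf.dfun_closed hη⟩

theorem SmoothAway.cls_dForm {f : C2 → ℝ} (hf : SmoothAway η f) (hη : ‖η‖ = 1) {q : ℝ}
    (hq : 4 < q) (h : f ∈ Royden (ENNReal.ofReal q) η) :
    cls (dForm f h) = cls (hf.closedForm hη hq) :=
  cls_dForm_eq h _ (hf.hasWeakExtDeriv hη)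

theorem smoothAway_uH_sq (hη : ‖η‖ = 1) : SmoothAway η fun z => uH η z ^ 2 := by
  simpa only [pow_two] using (smoothAway_uH hη).mul (smoothAway_uH hη)

theorem isCup_dForm {f g : C2 → ℝ} (hf : SmoothAway η f) (hg : SmoothAway η g) (hη : ‖η‖ = 1)
    {p : ℝ} (hp : 2 < p) (hf' : f ∈ Royden (ENNReal.ofReal (2 * p)) η)
    (hg' : g ∈ Royden (ENNReal.ofReal (2 * p)) η) :
    ∃ h : wedge (dfun f) (dfun g) ∈ closedForms 2 (ENNReal.ofReal p) η,
      IsCup (cls (dForm f hf')) (cls (dForm g hg')) (cls ⟨wedge (dfun f) (dfun g), h⟩) := by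
  have hq : 4 < 2 * p := by linarith
  rw [hf.cls_dForm hη hq, hg.cls_dForm hη hq]
  exact isCup_of_potential (α₀ := hf.closedForm hη hq) (β₀ := hg.closedForm hη hq) hη
    (by linarith) (hf.locL2 hη) (hf.hasWeakExtDeriv hη)

/-- The primitive is minus one half of the contact form, which is in L^p since p > 2. -/
theorem cls_wedge_uH_vH (hη : ‖η‖ = 1) {p : ℝ} (hp : 2 < p)
    (h : wedge (dfun (uH η)) (dfun (vH η)) ∈ closedForms 2 (ENNReal.ofReal p) η) :
    cls ⟨wedge (dfun (uH η)) (dfun (vH η)), h⟩ = 0 := by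
  have h0 : (0 : HLoc 2 (ENNReal.ofReal p) η) = cls 0 := rfl
  rw [h0]
  refine cls_eq_iff.2 ⟨(-(1 / 2) : ℝ) • contact η, Submodule.smul_mem _ _ ?_, ?_⟩
  · simpa using smul_contact_mem_LpLoc hη (f := fun _ => 1)
      (fun _ _ _ => contDiffAt_const) hp
  · have h1 := (hasWeakExtDeriv_contact hη).smul (-(1 / 2) : ℝ)
    rw [smul_smul] at h1
    norm_num at h1
    simpa using h1

/-- If ψ were an L^p primitive, adding uθ, also in L^p, would give a primitive of du ∧ θ, which is
excluded for p < 4. -/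
theorem cls_wedge_uH_sq_vH_ne_zero (hη : ‖η‖ = 1) {p : ℝ} (hp : 2 < p) (hp' : p < 4)
    (h : wedge (dfun fun z => uH η z ^ 2) (dfun (vH η)) ∈ closedForms 2 (ENNReal.ofReal p) η) :
    cls ⟨wedge (dfun fun z => uH η z ^ 2) (dfun (vH η)), h⟩ ≠ 0 := by
  intro h0
  have h0' : (0 : HLoc 2 (ENNReal.ofReal p) η) = cls 0 := rfl
  rw [h0'] at h0
  obtain ⟨ψ, hψ, hd⟩ := cls_eq_iff.1 h0
  have hu := smoothAway_uH hη
  have hc := continuousOn_contact hη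
  have hL := smul_contact_mem_LpLoc hη hu hp
  have cdu := hu.continuousOn_dfun hη
  have c1 := continuousOn_wedge cdu hc
  have c2 := continuousOn_wedge ((smoothAway_uH_sq hη).continuousOn_dfun hη)
    ((smoothAway_vH hη).continuousOn_dfun hη)
  have hd' : HasWeakExtDeriv ψ (wedge (dfun fun z => uH η z ^ 2) (dfun (vH η))) := by
    simpa using hd
  have h1 := hd'.add hψ.1 hL.1 (ContinuousOn.locallyIntegrableOn_form c2)
    (ContinuousOn.locallyIntegrableOn_form (c1.add (c2.const_smul (-1 : ℝ))))
    (hasWeakExtDeriv_smul_contact hη)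
  refine not_hasWeakExtDeriv_wedge_contact hη hp hp' (add_mem hψ hL) ?_
  convert h1 using 1
  rw [neg_one_smul]
  abel

theorem SmoothAway.tendsto {f : C2 → ℝ} (hf : SmoothAway η f) {ζ : C2} (hζ : ‖ζ‖ = 1)
    (hne : ζ ≠ η) : Tendsto f (𝓝[ball] ζ) (𝓝 (f ζ)) :=
  (hf ζ hζ.le hne).continuousAt.mono_left nhdsWithin_le_nhds

end Main

end CH2

end

theorem mainTheorem4 (p q r : ℝ) (hp : 2 < p) (hp' : p < 4) (hq : q = 2 * p) (hr : r = 2 * p)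
    (η : CH2.C2) (hη : ‖η‖ = 1) :
    ∃ (κ : CH2.HLoc 1 (ENNReal.ofReal r) η) (u v : CH2.C2 → ℝ)
      (hu : u ∈ CH2.Royden (ENNReal.ofReal q) η)
      (hu2 : (fun z => u z ^ 2) ∈ CH2.Royden (ENNReal.ofReal q) η)
      (hv : v ∈ CH2.Royden (ENNReal.ofReal r) η),
      CH2.IsCup (CH2.cls (CH2.dForm u hu)) κ (0 : CH2.HLoc 2 (ENNReal.ofReal p) η) ∧
      (∃ c : CH2.HLoc 2 (ENNReal.ofReal p) η, c ≠ 0 ∧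
        CH2.IsCup (CH2.cls (CH2.dForm (fun z => u z ^ 2) hu2)) κ c) ∧
      κ = CH2.cls (CH2.dForm v hv) ∧
      ∀ ζ : CH2.C2, ‖ζ‖ = 1 → ζ ≠ η →
        Tendsto u (𝓝[CH2.ball] ζ) (𝓝 (CH2.heisenberg η ζ).re) ∧
        Tendsto v (𝓝[CH2.ball] ζ) (𝓝 (CH2.heisenberg η ζ).im) := by
  subst hq hr
  have hq : 4 < 2 * p := by linarith
  have su := CH2.smoothAway_uH hη
  have su2 := CH2.smoothAway_uH_sq hη
  have sv := CH2.smoothAway_vH hη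
  have hu := su.mem_Royden hη hq
  have hu2 := su2.mem_Royden hη hq
  have hv := sv.mem_Royden hη hq
  obtain ⟨h1, c1⟩ := CH2.isCup_dForm su sv hη hp hu hv
  obtain ⟨h2, c2⟩ := CH2.isCup_dForm su2 sv hη hp hu2 hv
  rw [CH2.cls_wedge_uH_vH hη hp h1] at c1
  exact ⟨_, CH2.uH η, CH2.vH η, hu, hu2, hv, c1,
    ⟨_, CH2.cls_wedge_uH_sq_vH_ne_zero hη hp hp' h2, c2⟩, rfl,
    fun ζ hζ hne => ⟨su.tendsto hζ hne, sv.tendsto hζ hne⟩⟩
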